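/- Let $\mathbb K$ be a field of characteristic $0$ and let $\mathbf{Art}$ be the category of local Artinian $\mathbb K$-algebras $A$ with residue field $\mathbb K$; write $\mathfrak m_A$ for the maximal ideal. Let $\chi\colon L\to M$ be a morphism of ($\mathbb Z$-graded) differential graded Lie algebras over $\mathbb K$, and let $C_\chi^i=L^i\oplus M^{i-1}$ be its suspended mapping cone. (1) Let $H_\chi=\{(l,m)\in L\times M[t,dt]\mid m(0)=0,\ m(1)=\chi(l)\}$, $q_2(z_1\odot z_2)=(-1)^{\deg z_1}[z_1,z_2]$ on $H_\chi[1]$, $\imath(l,m)=(l,t\chi(l)+dt\,m)$, $\pi(l,m)=(l,\int_0^1 m)$ and $K(l,m)=(0,\int_0^t m-t\int_0^1 m)$. The $L_\infty$-algebra $\widetilde C(\chi)$ is $C_\chi$ with the operations on $C_\chi[1]$ transferred from $H_\chi$, that is, $\langle (l,m)\rangle_1=(-dl,-\chi(l)+dm)$ and, for $n\ge 2$, $$\langle\gamma_1\odot\cdots\odot\gamma_n\rangle_n=\tfrac12\sum_{\sigma\in S_n}\varepsilon(\sigma)\,\pi q_2(\imath\gamma_{\sigma(1)}\odot Kq_2(\imath\gamma_{\sigma(2)}\odot\cdots\odot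 Kq_2(\imath\gamma_{\sigma(n-1)}\odot\imath\gamma_{\sigma(n)})\cdots)),$$ where $\varepsilon(\sigma)$ is the Koszul sign in $C_\chi[1]$. For an $L_\infty$-algebra $V$ with operations $q_n$ on $V[1]$, let $\operatorname{MC}_V(A)$ be the set of $\gamma\in V^1\otimes\mathfrak m_A$ with $\sum_{n\ge1}\frac1{n!}q_n(\gamma^{\odot n})=0$, and let $\operatorname{Def}_V(A)$ be the quotient of $\operatorname{MC}_V(A)$ by (the equivalence relation generated by) homotopy equivalence: $\gamma_0\sim\gamma_1$ if some $\gamma(t,dt)\in\operatorname{MC}_{V[t,dt]}(A)$ has $\gamma(0)=\gamma_0$ and $\gamma(1)=\gamma_1$. (2) Let $e^a*y=y+\sum_{n\ge0}\frac{\operatorname{ad}_a^n}{(n+1)!}([a,y]-da)$ denote the gauge action, and $\exp(M^0\otimes\mathfrak m_A)$ the set $\{e^a\mid a\in M^0\otimes\mathfrak m_A\}$ with the Baker–Campbell–Hausdorff product. Let $\operatorname{MC}_\chi(A)$ be the set of pairs $(x,e^a)\in(L^1\otimes\mathfrak m_A)\times\exp(M^0\otimes\mathfrak m_A)$ with $dx+\frac12[x,x]=0$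 and $e^a*\chi(x)=0$, and let $\operatorname{Def}_\chi(A)$ be its quotient by gauge equivalence: $(l_0,e^{m_0})\sim(l_1,e^{m_1})$ if there are $a\in L^0\otimes\mathfrak m_A$ and $b\in M^{-1}\otimes\mathfrak m_A$ with $l_1=e^a*l_0$ and $e^{m_1}=e^{db}e^{m_0}e^{-\chi(a)}$. Then the functors $\operatorname{Def}_{\widetilde C(\chi)}$ and $\operatorname{Def}_\chi$ from $\mathbf{Art}$ to sets are isomorphic. More precisely, there is an isomorphism of functors $\operatorname{Def}_{\widetilde C(\chi)}\to\operatorname{Def}_\chi$ which sends the class of $\gamma=(l,m)\in\operatorname{MC}_{\widetilde C(\chi)}(A)$, with $l\in L^1\otimes\mathfrak m_A$ and $m\in M^0\otimes\mathfrak m_A$, to the class of $(l,e^m)$; in particular $(l,e^m)\in\operatorname{MC}_\chi(A)$. -/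

import Mathlib

open scoped TensorProduct Polynomial
open CategoryTheory

universe u v v₁ v₂ w

namespace LInfCone

section Graded

variable {K : Type u} [Field K] {V : Type v} [AddCommGroup V] [Module K V]

/-- On a graded space `V = ⨁ V^i`, the linear map which multiplies `V^i` by the scalar `c i`. -/
noncomputable def degreeScale (gr : ℤ → Submodule K V) (h : DirectSum.IsInternal gr)
    (c : ℤ → K) : V →ₗ[K] V :=
  letI := h.chooseDecomposition
  DirectSum.toModule K ℤ V (fun i => c i • (gr i).subtype) ∘ₗ
    (DirectSum.decomposeLinearEquiv gr).toLinearMap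

theorem degreeScale_of_mem (gr : ℤ → Submodule K V) (h : DirectSum.IsInternal gr)
    (c : ℤ → K) {i : ℤ} {x : V} (hx : x ∈ gr i) : degreeScale gr h c x = c i • x := by
  let _ := h.chooseDecomposition
  have h1 : DirectSum.decompose gr x = DirectSum.lof K ℤ (fun i => gr i) i ⟨x, hx⟩ :=
    DirectSum.decompose_of_mem gr hx
  simp only [degreeScale, LinearMap.comp_apply, LinearEquiv.coe_coe,
    DirectSum.decomposeLinearEquiv_apply]
  erw [h1, DirectSum.toModule_lof]
  rfl

end Graded

/-! ### Differential graded Lie algebras -/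

/-- A structure of `ℤ`-graded differential graded Lie algebra on the `K`-vector space `L`. -/
structure DGLA (K : Type u) [Field K] (L : Type v) [AddCommGroup L] [Module K L] where
  /-- the homogeneous components -/
  gr : ℤ → Submodule K L
  isInternal : DirectSum.IsInternal gr
  /-- the differential -/
  d : L →ₗ[K] L
  /-- the bracket -/
  bracket : L →ₗ[K] L →ₗ[K] L
  d_mem : ∀ i, ∀ x ∈ gr i, d x ∈ gr (i + 1)
  d_d : ∀ x, d (d x) = 0
  bracket_mem : ∀ i j, ∀ x ∈ gr i, ∀ y ∈ gr j, bracket x y ∈ gr (i + j)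
  bracket_skew : ∀ i j, ∀ x ∈ gr i, ∀ y ∈ gr j,
    bracket x y = -((i * j).negOnePow • bracket y x)
  jacobi : ∀ i j, ∀ x ∈ gr i, ∀ y ∈ gr j, ∀ z,
    bracket x (bracket y z) = bracket (bracket x y) z + (i * j).negOnePow • bracket y (bracket x z)
  leibniz : ∀ i, ∀ x ∈ gr i, ∀ y,
    d (bracket x y) = bracket (d x) y + i.negOnePow • bracket x (d y)

/-- Morphisms of differential graded Lie algebras. -/
structure DGLA.Hom {K : Type u} [Field K] {L : Type v₁} [AddCommGroup L] [Module K L]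
    {M : Type v₂} [AddCommGroup M] [Module K M] (𝓛 : DGLA K L) (𝓜 : DGLA K M) where
  /-- the underlying linear map -/
  toLin : L →ₗ[K] M
  map_mem : ∀ i, ∀ x ∈ 𝓛.gr i, toLin x ∈ 𝓜.gr i
  map_d : ∀ x, toLin (𝓛.d x) = 𝓜.d (toLin x)
  map_bracket : ∀ x y, toLin (𝓛.bracket x y) = 𝓜.bracket (toLin x) (toLin y)

/-! ### Extension of scalars and polynomials -/

section Scalars

variable {K : Type u} [Field K]

/-- The map `R ⊗ V → S ⊗ V` induced by an algebra morphism `R → S`. -/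
noncomputable def push {R S : Type*} [CommRing R] [Algebra K R] [CommRing S] [Algebra K S]
    (φ : R →ₐ[K] S) (V : Type*) [AddCommGroup V] [Module K V] : R ⊗[K] V →ₗ[K] S ⊗[K] V :=
  LinearMap.rTensor V φ.toLinearMap

/-- `I ⊗ W` as a subspace of `R ⊗ V`, for an ideal `I` of `R` and a subspace `W` of `V`. -/
def ext {R : Type*} [CommRing R] [Algebra K R] {V : Type*} [AddCommGroup V] [Module K V]
    (I : Ideal R) (W : Submodule K V) : Submodule K (R ⊗[K] V) :=
  Submodule.span K {z | ∃ a ∈ I, ∃ x ∈ W, z = a ⊗ₜ[K] x}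

variable (R : Type*) [CommRing R] [Algebra K R] (V : Type*) [AddCommGroup V] [Module K V]

/-- Evaluation `V[t] ⊗ R → V ⊗ R` at `t = a`. -/
noncomputable def evalAt (a : R) : R[X] ⊗[K] V →ₗ[K] R ⊗[K] V :=
  push ((Polynomial.aeval (R := R) a).restrictScalars K) V

/-- Constant polynomials. -/
noncomputable def const : R ⊗[K] V →ₗ[K] R[X] ⊗[K] V :=
  push ((Polynomial.CAlgHom (R := R) (A := R)).restrictScalars K) V

/-- The derivative with respect to `t`. -/
noncomputable def deriv : R[X] ⊗[K] V →ₗ[K] R[X] ⊗[K] V :=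
  LinearMap.rTensor V ((Polynomial.derivative (R := R)).restrictScalars K)

/-- The primitive `∑ aₙ tⁿ ↦ ∑ aₙ tⁿ⁺¹ / (n + 1)` of polynomials. -/
noncomputable def primPoly : R[X] →ₗ[K] R[X] :=
  Polynomial.lsum fun n =>
    ((n + 1 : K)⁻¹) • (Polynomial.monomial (R := R) (n + 1)).restrictScalars K

/-- The integral `∫₀ᵗ`. -/
noncomputable def prim : R[X] ⊗[K] V →ₗ[K] R[X] ⊗[K] V :=
  LinearMap.rTensor V (primPoly R)

/-- The integral `∫₀¹`. -/
noncomputable def integral : R[X] ⊗[K] V →ₗ[K] R ⊗[K] V :=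
  evalAt R V 1 ∘ₗ prim R V

end Scalars

section MultilinearBaseChange

variable {K : Type u} [Field K] (R : Type w) [CommRing R] [Algebra K R]
  {V : Type v} [AddCommGroup V] [Module K V]

instance multilinearMap_isScalarTower (n : ℕ) :
    IsScalarTower K R (MultilinearMap R (fun _ : Fin n => R ⊗[K] V) (R ⊗[K] V)) :=
  ⟨fun a r f => by ext v; exact smul_assoc a r (f v)⟩

/-- The `R`-multilinear extension of a multilinear map `Vⁿ → V` to `R ⊗ V`. -/
noncomputable def mbc : (n : ℕ) → (MultilinearMap K (fun _ : Fin n => V) V →ₗ[K]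
      MultilinearMap R (fun _ : Fin n => R ⊗[K] V) (R ⊗[K] V))
  | 0 =>
    { toFun := fun f => MultilinearMap.constOfIsEmpty R _ (1 ⊗ₜ[K] f 0)
      map_add' := fun f g => by ext; simp [TensorProduct.tmul_add]
      map_smul' := fun c f => by ext; simp }
  | n + 1 =>
    { toFun := fun f => ((mbc n ∘ₗ f.curryLeft).liftBaseChange R).uncurryLeft
      map_add' := fun f g => by
        ext v
        simp only [LinearMap.uncurryLeft_apply, add_apply]
        generalize v 0 = x
        induction x with
        | zero => simp
        | add x y hx hy => simp only [map_add, add_apply, hx, hy]; abel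
        | tmul r x =>
          have : (f + g).curryLeft x = f.curryLeft x + g.curryLeft x := by ext; simp
          simp [this]
      map_smul' := fun c f => by
        ext v
        simp only [LinearMap.uncurryLeft_apply, smul_apply, RingHom.id_apply]
        generalize v 0 = x
        induction x with
        | zero => simp
        | add x y hx hy => simp only [map_add, add_apply, hx, hy, smul_add]
        | tmul r x =>
          have : (c • f).curryLeft x = c • f.curryLeft x := by ext; simp
          simp [this, smul_comm r c] }

theorem mbc_tmul (n : ℕ) (f : MultilinearMap K (fun _ : Fin n => V) V)
    (r : Fin n → R) (x : Fin n → V) :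
    mbc R n f (fun i => r i ⊗ₜ[K] x i) = (∏ i, r i) ⊗ₜ[K] f x := by
  induction n with
  | zero => simp [mbc, Subsingleton.elim x 0]
  | succ n ih =>
    have h : (Fin.tail fun i => r i ⊗ₜ[K] x i) = fun i : Fin n => r i.succ ⊗ₜ[K] x i.succ := rfl
    have hx : Fin.cons (x 0) (fun i : Fin n => x i.succ) = x := Fin.cons_self_tail x
    simp only [mbc, LinearMap.coe_mk, AddHom.coe_mk, LinearMap.uncurryLeft_apply, h,
      LinearMap.liftBaseChange_tmul, smul_apply, LinearMap.comp_apply, ih,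
      MultilinearMap.curryLeft_apply, Fin.prod_univ_succ, TensorProduct.smul_tmul', smul_eq_mul]
    erw [hx]

end MultilinearBaseChange

/-! ### Graded spaces with higher operations

An `L∞`-algebra is a graded space `V` with graded symmetric operations `qₙ : (V[1])ⁿ → V[1]` of
degree one, `n ≥ 1`, satisfying quadratic relations.  The Maurer-Cartan and deformation functors
depend on the operations only.  The space underlying `V[1]` is identified with `V`, so that
`x ∈ V^i` has degree `i - 1` in `V[1]`. -/

/-- A graded space `V = ⨁ V^i` with multilinear operations `qₙ`, `n ≥ 1`, on `V[1]`
(the value at `n = 0` is never used). -/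
structure HigherOps (K : Type u) [Field K] (V : Type v) [AddCommGroup V] [Module K V] where
  /-- the homogeneous components of `V` (not of `V[1]`) -/
  gr : ℤ → Submodule K V
  isInternal : DirectSum.IsInternal gr
  /-- the operations -/
  q : (n : ℕ) → MultilinearMap K (fun _ : Fin n => V) V

section Cone

variable {K : Type u} [Field K] {L : Type v₁} [AddCommGroup L] [Module K L]
  {M : Type v₂} [AddCommGroup M] [Module K M]

/-! ### The operations on the suspended mapping cone

For a morphism `χ : L → M`, put `C_χ^i = L^i ⊕ M^{i-1}` and
`H_χ = {(l, m) ∈ L × M[t,dt] | m(0) = 0, m(1) = χ(l)}`.  An element of `M[t,dt]` is written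
`x + dt y` with `x, y ∈ M[t]`, and stored as the pair `(x, y)`.  The operations on `C_χ` are those
which are transferred from the differential graded Lie algebra `H_χ` along
`ι : C_χ → H_χ`, `π : H_χ → C_χ` and the homotopy `K` below.  All maps are written on
`L × M[t,dt]`; they preserve the subspace `H_χ`, in which `ι` takes its values. -/

/-- The underlying space of `L × M[t,dt]`. -/
abbrev LMtdt (K : Type u) [Field K] (L : Type v₁) [AddCommGroup L] [Module K L]
    (M : Type v₂) [AddCommGroup M] [Module K M] : Type _ :=
  L × ((K[X] ⊗[K] M) × (K[X] ⊗[K] M))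

/-- The operator `x ↦ (-1)^{deg x} x` of a differential graded Lie algebra. -/
noncomputable def DGLA.sign (𝓛 : DGLA K L) : L →ₗ[K] L :=
  degreeScale 𝓛.gr 𝓛.isInternal fun i => ((i.negOnePow : ℤ) : K)

/-- The `R`-bilinear extension of the bracket to `R ⊗ L`. -/
noncomputable def DGLA.bracketR (𝓛 : DGLA K L) (R : Type w) [CommRing R] [Algebra K R] :
    R ⊗[K] L →ₗ[R] R ⊗[K] L →ₗ[R] R ⊗[K] L :=
  LinearMap.BilinMap.baseChange R 𝓛.bracket

/-- The `R`-linear extension of the differential to `R ⊗ L`. -/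
noncomputable def DGLA.dR (𝓛 : DGLA K L) (R : Type w) [CommRing R] [Algebra K R] :
    R ⊗[K] L →ₗ[R] R ⊗[K] L :=
  𝓛.d.baseChange R

/-- The bracket of `M[t,dt]`:
`[x₁ + dt y₁, x₂ + dt y₂] = [x₁, x₂] + dt ([y₁, x₂] + (-1)^{deg x₁} [x₁, y₂])`. -/
noncomputable def bracketTdt (𝓜 : DGLA K M) (z₁ z₂ : (K[X] ⊗[K] M) × (K[X] ⊗[K] M)) :
    (K[X] ⊗[K] M) × (K[X] ⊗[K] M) :=
  (𝓜.bracketR K[X] z₁.1 z₂.1,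
    𝓜.bracketR K[X] z₁.2 z₂.1 + 𝓜.bracketR K[X] (𝓜.sign.baseChange K[X] z₁.1) z₂.2)

/-- The operation `q₂(z₁ ⊙ z₂) = (-1)^{deg z₁} [z₁, z₂]` on `(L × M[t,dt])[1]`, where `deg` is the
degree in `L × M[t,dt]`, and where `dt y` has degree `deg y + 1`. -/
noncomputable def q₂ (𝓛 : DGLA K L) (𝓜 : DGLA K M) :
    LMtdt K L M →ₗ[K] LMtdt K L M →ₗ[K] LMtdt K L M :=
  LinearMap.mk₂ K
    (fun z₁ z₂ => (𝓛.bracket (𝓛.sign z₁.1) z₂.1,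
      bracketTdt 𝓜 (𝓜.sign.baseChange K[X] z₁.2.1, -𝓜.sign.baseChange K[X] z₁.2.2) z₂.2))
    (fun z z' y => by
      refine Prod.ext (by simp) (Prod.ext (by simp [bracketTdt]) ?_)
      simp only [bracketTdt, Prod.fst_add, Prod.snd_add, map_add, map_neg, LinearMap.add_apply,
        LinearMap.neg_apply]
      abel)
    (fun c z y => by
      refine Prod.ext (by simp) (Prod.ext (by simp [bracketTdt, LinearMap.map_smul_of_tower]) ?_)
      simp [bracketTdt, LinearMap.map_smul_of_tower])
    (fun z y y' => by
      refine Prod.ext (by simp) (Prod.ext (by simp [bracketTdt]) ?_)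
      simp only [bracketTdt, Prod.fst_add, Prod.snd_add, map_add]
      abel)
    (fun c z y => by
      refine Prod.ext (by simp) (Prod.ext (by simp [bracketTdt, LinearMap.map_smul_of_tower]) ?_)
      simp [bracketTdt, LinearMap.map_smul_of_tower])

/-- `∫₀¹ : M[t] → M`. -/
noncomputable def integralM (K : Type u) [Field K] (M : Type v₂) [AddCommGroup M] [Module K M] :
    K[X] ⊗[K] M →ₗ[K] M :=
  (TensorProduct.lid K M).toLinearMap ∘ₗ integral K M

/-- `ι(l, m) = (l, t χ(l) + dt m)`. -/
noncomputable def coneι {𝓛 : DGLA K L} {𝓜 : DGLA K M} (χ : DGLA.Hom 𝓛 𝓜) :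
    L × M →ₗ[K] LMtdt K L M :=
  (LinearMap.fst K L M).prod
    ((TensorProduct.mk K K[X] M Polynomial.X ∘ₗ χ.toLin ∘ₗ LinearMap.fst K L M).prod
      (TensorProduct.mk K K[X] M 1 ∘ₗ LinearMap.snd K L M))

/-- `π(l, x + dt y) = (l, ∫₀¹ y dt)`. -/
noncomputable def coneπ (K : Type u) [Field K] (L : Type v₁) [AddCommGroup L] [Module K L]
    (M : Type v₂) [AddCommGroup M] [Module K M] : LMtdt K L M →ₗ[K] L × M :=
  LinearMap.prodMap LinearMap.id (integralM K M ∘ₗ LinearMap.snd K _ _)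

/-- `K(l, x + dt y) = (0, ∫₀ᵗ y dt - t ∫₀¹ y dt)`. -/
noncomputable def coneK (K : Type u) [Field K] (L : Type v₁) [AddCommGroup L] [Module K L]
    (M : Type v₂) [AddCommGroup M] [Module K M] : LMtdt K L M →ₗ[K] LMtdt K L M :=
  LinearMap.prodMap 0
    (LinearMap.inl K _ _ ∘ₗ
      (prim K M - TensorProduct.mk K K[X] M Polynomial.X ∘ₗ integralM K M) ∘ₗ
      LinearMap.snd K _ _)

/-- The multilinear map `(v₀, …, vₙ) ↦ B(v₀, T(v₁, …, vₙ))`. -/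
def graft {U W W' : Type*} [AddCommGroup U] [Module K U] [AddCommGroup W] [Module K W]
    [AddCommGroup W'] [Module K W'] (B : U →ₗ[K] W →ₗ[K] W') {n : ℕ}
    (T : MultilinearMap K (fun _ : Fin n => U) W) :
    MultilinearMap K (fun _ : Fin (n + 1) => U) W' :=
  LinearMap.uncurryLeft
    { toFun := fun v => (B v).compMultilinearMap T
      map_add' := fun v v' => by ext; simp
      map_smul' := fun c v => by ext; simp }

/-- `(v₀, …, vₙ) ↦ K q₂(ι v₀ ⊙ K q₂(ι v₁ ⊙ ⋯ ⊙ K q₂(ι vₙ₋₁ ⊙ ι vₙ) ⋯ ))`, and `ι v₀` for `n = 0`. -/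
noncomputable def comb {𝓛 : DGLA K L} {𝓜 : DGLA K M} (χ : DGLA.Hom 𝓛 𝓜) :
    (n : ℕ) → MultilinearMap K (fun _ : Fin (n + 1) => L × M) (LMtdt K L M)
  | 0 => (coneι χ).compMultilinearMap
      (MultilinearMap.ofSubsingleton K (L × M) (L × M) (0 : Fin 1) LinearMap.id)
  | n + 1 => graft ((q₂ 𝓛 𝓜 ∘ₗ coneι χ).compr₂ (coneK K L M)) (comb χ n)

/-- The homogeneous components of `C_χ`. -/
def coneGr (𝓛 : DGLA K L) (𝓜 : DGLA K M) (i : ℤ) : Submodule K (L × M) :=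
  (𝓛.gr i).prod (𝓜.gr (i - 1))

theorem coneGr_isInternal (𝓛 : DGLA K L) (𝓜 : DGLA K M) :
    DirectSum.IsInternal (coneGr 𝓛 𝓜) := by
  rw [DirectSum.isInternal_submodule_iff_iSupIndep_and_iSup_eq_top]
  have hL := 𝓛.isInternal
  have hM := 𝓜.isInternal
  rw [DirectSum.isInternal_submodule_iff_iSupIndep_and_iSup_eq_top] at hL hM
  constructor
  · intro i
    rw [Submodule.disjoint_def]
    intro x hx hx'
    have h1 : x.1 ∈ ⨆ j, ⨆ (_ : j ≠ i), 𝓛.gr j := by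
      have := Submodule.mem_map_of_mem (f := LinearMap.fst K L M) hx'
      simp only [Submodule.map_iSup] at this
      revert this
      apply SetLike.le_def.1
      refine iSup₂_mono (fun j _ => ?_)
      rintro _ ⟨y, hy, rfl⟩
      exact hy.1
    have h2 : x.2 ∈ ⨆ j, ⨆ (_ : j ≠ i - 1), 𝓜.gr j := by
      have := Submodule.mem_map_of_mem (f := LinearMap.snd K L M) hx'
      simp only [Submodule.map_iSup] at this
      revert this
      apply SetLike.le_def.1
      refine iSup₂_le (fun j hj => ?_)
      refine le_trans ?_ (le_iSup₂ (f := fun j (_ : j ≠ i - 1) => 𝓜.gr j) (j - 1)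
        (fun h => hj (by linarith)))
      rintro _ ⟨y, hy, rfl⟩
      exact hy.2
    exact Prod.ext (Submodule.disjoint_def.1 (hL.1 i) _ hx.1 h1)
      (Submodule.disjoint_def.1 (hM.1 (i - 1)) _ hx.2 h2)
  · rw [eq_top_iff]
    rintro ⟨l, m⟩ -
    have e1 : (⊤ : Submodule K L).map (LinearMap.inl K L M) ≤ ⨆ i, coneGr 𝓛 𝓜 i := by
      rw [← hL.2, Submodule.map_iSup]
      refine iSup_le fun i => le_trans ?_ (le_iSup _ i)
      rintro _ ⟨y, hy, rfl⟩
      exact ⟨hy, Submodule.zero_mem _⟩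
    have e2 : (⊤ : Submodule K M).map (LinearMap.inr K L M) ≤ ⨆ i, coneGr 𝓛 𝓜 i := by
      rw [← hM.2, Submodule.map_iSup]
      refine iSup_le fun i => le_trans ?_ (le_iSup _ (i + 1))
      rintro _ ⟨y, hy, rfl⟩
      refine ⟨Submodule.zero_mem _, ?_⟩
      simpa using hy
    have := Submodule.add_mem _ (e1 ⟨l, trivial, rfl⟩) (e2 ⟨m, trivial, rfl⟩)
    simpa using this

/-- The projection of `C_χ[1]` onto its part of even (`p = 0`) or odd (`p = 1`) degree. -/
noncomputable def coneParity (𝓛 : DGLA K L) (𝓜 : DGLA K M) (p : ZMod 2) : L × M →ₗ[K] L × M :=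
  degreeScale (coneGr 𝓛 𝓜) (coneGr_isInternal 𝓛 𝓜)
    fun i => if ((i - 1 : ℤ) : ZMod 2) = p then 1 else 0

/-- The Koszul sign `ε(σ)` with `v_{σ(1)} ⊙ ⋯ ⊙ v_{σ(n)} = ε(σ) v₁ ⊙ ⋯ ⊙ vₙ`, for `vᵢ` of
parity `p i`. -/
def koszulSign {n : ℕ} (p : Fin n → ZMod 2) (σ : Equiv.Perm (Fin n)) : ℤ :=
  ∏ i, ∏ j, if i < j ∧ σ j < σ i ∧ p (σ i) = 1 ∧ p (σ j) = 1 then -1 else 1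

/-- `⟨(l, m)⟩₁ = (-dl, -χ(l) + dm)`. -/
def coneQ₁ {𝓛 : DGLA K L} {𝓜 : DGLA K M} (χ : DGLA.Hom 𝓛 𝓜) : L × M →ₗ[K] L × M :=
  (-(𝓛.d ∘ₗ LinearMap.fst K L M)).prod
    (-(χ.toLin ∘ₗ LinearMap.fst K L M) + 𝓜.d ∘ₗ LinearMap.snd K L M)

/-- The transferred operations on `C_χ[1]`: for `n ≥ 2` and homogeneous `vᵢ`,
`⟨v₁ ⊙ ⋯ ⊙ vₙ⟩ₙ = ½ ∑_σ ε(σ) π q₂(ι v_{σ(1)} ⊙ K q₂(ι v_{σ(2)} ⊙ ⋯ ⊙ K q₂(ι v_{σ(n-1)} ⊙ ι v_{σ(n)}) ⋯ ))`;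
the sum over `p` splits arbitrary vectors into their even and odd parts. -/
noncomputable def coneQ {𝓛 : DGLA K L} {𝓜 : DGLA K M} (χ : DGLA.Hom 𝓛 𝓜) :
    (n : ℕ) → MultilinearMap K (fun _ : Fin n => L × M) (L × M)
  | 0 => 0
  | 1 => (coneQ₁ χ).compMultilinearMap
      (MultilinearMap.ofSubsingleton K (L × M) (L × M) (0 : Fin 1) LinearMap.id)
  | n + 2 => (2⁻¹ : K) • ∑ p : Fin (n + 2) → ZMod 2, ∑ σ : Equiv.Perm (Fin (n + 2)),
      koszulSign p σ •
        ((graft ((q₂ 𝓛 𝓜 ∘ₗ coneι χ).compr₂ (coneπ K L M)) (comb χ n)).domDomCongr σ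
          ).compLinearMap fun i => coneParity 𝓛 𝓜 (p i)

/-- The `L∞`-algebra `C̃(χ)`: the space `C_χ` with the transferred operations. -/
noncomputable def cone {𝓛 : DGLA K L} {𝓜 : DGLA K M} (χ : DGLA.Hom 𝓛 𝓜) :
    HigherOps K (L × M) where
  gr := coneGr 𝓛 𝓜
  isInternal := coneGr_isInternal 𝓛 𝓜
  q := coneQ χ

end Cone

/-! ### Gauge action and Baker-Campbell-Hausdorff product -/

section Gauge

variable {K : Type u} [Field K] {M : Type v} [AddCommGroup M] [Module K M] (𝓜 : DGLA K M)
  (R : Type w) [CommRing R] [Algebra K R]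

/-- The gauge action `e^a * y = y + ∑ₙ ad_a^n / (n + 1)! ([a, y] - da)` (a finite sum for `a` in
`M^0 ⊗ I` with `I` nilpotent). -/
noncomputable def gauge (a y : R ⊗[K] M) : R ⊗[K] M :=
  y + ∑ᶠ n : ℕ, ((n + 1).factorial : K)⁻¹ •
    (𝓜.bracketR R a)^[n] (𝓜.bracketR R a y - 𝓜.dR R a)

/-- `e^{ad_a} z = ∑ₙ ad_a^n z / n!`. -/
noncomputable def expAd (a z : R ⊗[K] M) : R ⊗[K] M :=
  ∑ᶠ n : ℕ, (n.factorial : K)⁻¹ • (𝓜.bracketR R a)^[n] z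

/-- The operator `1 - e^{ad_a} e^{t ad_b}` on `M[t] ⊗ R`. -/
noncomputable def bchU (a b : R ⊗[K] M) (z : R[X] ⊗[K] M) : R[X] ⊗[K] M :=
  z - expAd 𝓜 R[X] (const R M a)
    (expAd 𝓜 R[X] ((Polynomial.X : R[X]) • const R M b) z)

/-- The Baker-Campbell-Hausdorff product `a • b`, with `e^{a • b} = e^a e^b`, in Poincaré's integral
form `a • b = a + ∫₀¹ ψ(e^{ad_a} e^{t ad_b}) b dt`, where
`ψ(w) = w log w / (w - 1) = 1 - ∑_{n ≥ 1} (1 - w)^n / (n (n + 1))` (a finite sum for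
`a, b` in `M^0 ⊗ I` with `I` nilpotent). -/
noncomputable def bch (a b : R ⊗[K] M) : R ⊗[K] M :=
  a + integral R M (const R M b - ∑ᶠ n : ℕ, (((n + 1 : ℕ) * (n + 2 : ℕ) : K))⁻¹ •
    (bchU 𝓜 R a b)^[n + 1] (const R M b))

end Gauge

/-! ### Functoriality of these constructions in the ring of scalars -/

section Naturality

variable {K : Type u} [Field K] {V : Type*} [AddCommGroup V] [Module K V]
  {R : Type*} [CommRing R] [Algebra K R] {S : Type*} [CommRing S] [Algebra K S] (φ : R →ₐ[K] S)

theorem push_tmul (r : R) (x : V) : push φ V (r ⊗ₜ[K] x) = φ r ⊗ₜ[K] x := rfl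

theorem push_smul (r : R) (z : R ⊗[K] V) : push φ V (r • z) = φ r • push φ V z := by
  induction z with
  | zero => simp
  | add x y hx hy => simp only [smul_add, map_add, hx, hy]
  | tmul s x => simp [push_tmul, TensorProduct.smul_tmul']

theorem push_baseChange {V' : Type*} [AddCommGroup V'] [Module K V'] (f : V →ₗ[K] V')
    (z : R ⊗[K] V) : push φ V' (f.baseChange R z) = f.baseChange S (push φ V z) := by
  induction z with
  | zero => simp
  | add x y hx hy => simp only [map_add, hx, hy]
  | tmul s x => simp [push_tmul]

theorem ext_mono {I J : Ideal R} (h : I ≤ J) {W W' : Submodule K V} (hW : W ≤ W') :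
    ext I W ≤ ext J W' := by
  apply Submodule.span_mono
  rintro _ ⟨a, ha, x, hx, rfl⟩
  exact ⟨a, h ha, x, hW hx, rfl⟩

theorem push_mem_ext {I : Ideal R} {J : Ideal S} (h : ∀ a ∈ I, φ a ∈ J) {W : Submodule K V}
    {z : R ⊗[K] V} (hz : z ∈ ext I W) : push φ V z ∈ ext J W := by
  have : (ext I W).map (push φ V) ≤ ext J W := by
    rw [ext, Submodule.map_span_le]
    rintro _ ⟨a, ha, x, hx, rfl⟩
    exact Submodule.subset_span ⟨φ a, h a ha, x, hx, rfl⟩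
  exact this ⟨z, hz, rfl⟩

theorem smul_mem_ext {I J : Ideal R} {W : Submodule K V} {r : R} (hr : r ∈ I) {z : R ⊗[K] V}
    (hz : z ∈ ext J W) : r • z ∈ ext (I * J) W := by
  induction hz using Submodule.span_induction with
  | zero => simp
  | add x y _ _ hx hy => rw [smul_add]; exact Submodule.add_mem _ hx hy
  | smul c x _ hx => rw [smul_comm]; exact Submodule.smul_mem _ c hx
  | mem x h =>
    obtain ⟨a, ha, v, hv, rfl⟩ := h
    exact Submodule.subset_span ⟨r * a, Ideal.mul_mem_mul hr ha, v, hv,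
      by rw [TensorProduct.smul_tmul', smul_eq_mul]⟩

theorem mem_ext_one (z : R ⊗[K] V) : z ∈ ext (1 : Ideal R) (⊤ : Submodule K V) := by
  induction z with
  | zero => exact Submodule.zero_mem _
  | add x y hx hy => exact Submodule.add_mem _ hx hy
  | tmul s x => exact Submodule.subset_span ⟨s, by simp, x, trivial, rfl⟩

theorem eq_zero_of_mem_ext {I : Ideal R} {N n : ℕ} (hI : I ^ N = ⊥) (hn : N ≤ n)
    {W : Submodule K V} {z : R ⊗[K] V} (hz : z ∈ ext (I ^ n) W) : z = 0 := by
  have h1 : I ^ n ≤ ⊥ := (Ideal.pow_le_pow_right hn).trans hI.le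
  have h2 : ext (⊥ : Ideal R) W ≤ ⊥ := by
    rw [ext, Submodule.span_le]
    rintro _ ⟨a, ha, x, -, rfl⟩
    simp [(Submodule.mem_bot R).1 ha]
  exact h2 (ext_mono h1 le_rfl hz)

theorem baseChange_mem_ext {V' : Type*} [AddCommGroup V'] [Module K V'] (f : V →ₗ[K] V')
    {W : Submodule K V} {W' : Submodule K V'} (hf : ∀ x ∈ W, f x ∈ W')
    {I : Ideal R} {z : R ⊗[K] V} (hz : z ∈ ext I W) : f.baseChange R z ∈ ext I W' := by
  induction hz using Submodule.span_induction with
  | zero => simp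
  | add x y _ _ hx hy => rw [map_add]; exact Submodule.add_mem _ hx hy
  | smul c x _ hx => rw [LinearMap.map_smul_of_tower]; exact Submodule.smul_mem _ c hx
  | mem x h =>
    obtain ⟨a, ha, v, hv, rfl⟩ := h
    exact Submodule.subset_span ⟨a, ha, f v, hf v hv, rfl⟩

theorem map_finsum_nat {W W' : Type*} [AddCommGroup W] [Module K W] [AddCommGroup W'] [Module K W']
    (g : W →ₗ[K] W') (f : ℕ → W) (N : ℕ) (h : ∀ n, N ≤ n → f n = 0) :
    g (∑ᶠ n, f n) = ∑ᶠ n, g (f n) := by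
  refine g.toAddMonoidHom.map_finsum ((Finset.range N).finite_toSet.subset ?_)
  intro n hn
  by_contra h'
  exact hn (h n (by simpa using h'))

theorem finsum_mem_of {W : Type*} [AddCommGroup W] [Module K W] (P : Submodule K W) (f : ℕ → W)
    (h : ∀ n, f n ∈ P) : ∑ᶠ n, f n ∈ P :=
  finsum_induction (· ∈ P) P.zero_mem (fun _ _ => P.add_mem) h

theorem mbc_succ_tmul (n : ℕ) (f : MultilinearMap K (fun _ : Fin (n + 1) => V) V)
    (x : Fin (n + 1) → R ⊗[K] V) :
    mbc R (n + 1) f x = ((mbc R n ∘ₗ f.curryLeft).liftBaseChange R) (x 0) (Fin.tail x) := rfl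

theorem mbc_push (n : ℕ) (f : MultilinearMap K (fun _ : Fin n => V) V)
    (x : Fin n → R ⊗[K] V) :
    push φ V (mbc R n f x) = mbc S n f (fun i => push φ V (x i)) := by
  induction n with
  | zero => simp [mbc, push_tmul]
  | succ n ih =>
    have ht : Fin.tail (fun i => push φ V (x i)) = fun i => push φ V (Fin.tail x i) := rfl
    rw [mbc_succ_tmul, mbc_succ_tmul, ht]
    generalize x 0 = z
    induction z with
    | zero => simp
    | add x y hx hy => simp only [map_add, add_apply, hx, hy]
    | tmul r v =>
      simp only [LinearMap.liftBaseChange_tmul, smul_apply, LinearMap.comp_apply, push_tmul,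
        push_smul, ih]

theorem mbc_mem (n : ℕ) (f : MultilinearMap K (fun _ : Fin n => V) V) {I : Ideal R}
    (x : Fin n → R ⊗[K] V) (hx : ∀ i, x i ∈ ext I (⊤ : Submodule K V)) :
    mbc R n f x ∈ ext (I ^ n) (⊤ : Submodule K V) := by
  induction n with
  | zero => simpa using mem_ext_one _
  | succ n ih =>
    rw [mbc_succ_tmul]
    have h0 := hx 0
    generalize x 0 = z at h0
    induction h0 using Submodule.span_induction with
    | zero => simp
    | add x y _ _ hx hy => rw [map_add, add_apply]; exact Submodule.add_mem _ hx hy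
    | smul c x _ hx =>
      rw [LinearMap.map_smul_of_tower, smul_apply]
      exact Submodule.smul_mem _ c hx
    | mem z h =>
      obtain ⟨a, ha, v, hv, rfl⟩ := h
      rw [LinearMap.liftBaseChange_tmul, smul_apply, pow_succ']
      exact smul_mem_ext ha (ih _ _ fun i => hx i.succ)

variable (𝓜 : DGLA K V)

theorem bracketR_push (x y : R ⊗[K] V) :
    push φ V (𝓜.bracketR R x y) = 𝓜.bracketR S (push φ V x) (push φ V y) := by
  induction x with
  | zero => simp
  | add x x' hx hx' => simp only [map_add, LinearMap.add_apply, hx, hx']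
  | tmul r v =>
    induction y with
    | zero => simp
    | add y y' hy hy' => simp only [map_add, hy, hy']
    | tmul s w => simp [DGLA.bracketR, push_tmul]

theorem dR_push (x : R ⊗[K] V) : push φ V (𝓜.dR R x) = 𝓜.dR S (push φ V x) :=
  push_baseChange φ 𝓜.d x

theorem bracketR_mem {I J : Ideal R} {x y : R ⊗[K] V} (hx : x ∈ ext I (⊤ : Submodule K V))
    (hy : y ∈ ext J (⊤ : Submodule K V)) :
    𝓜.bracketR R x y ∈ ext (I * J) (⊤ : Submodule K V) := by
  induction hx using Submodule.span_induction with
  | zero => simp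
  | add x x' _ _ hx hx' =>
    rw [map_add, LinearMap.add_apply]; exact Submodule.add_mem _ hx hx'
  | smul c x _ hx =>
    rw [LinearMap.map_smul_of_tower, LinearMap.smul_apply]; exact Submodule.smul_mem _ c hx
  | mem x h =>
    obtain ⟨a, ha, v, hv, rfl⟩ := h
    induction hy using Submodule.span_induction with
    | zero => simp
    | add x x' _ _ hx hx' => rw [map_add]; exact Submodule.add_mem _ hx hx'
    | smul c x _ hx => rw [LinearMap.map_smul_of_tower]; exact Submodule.smul_mem _ c hx
    | mem y h =>
      obtain ⟨b, hb, w, hw, rfl⟩ := h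
      exact Submodule.subset_span ⟨a * b, Ideal.mul_mem_mul ha hb, _, trivial, rfl⟩

theorem iterate_mem {I : Ideal R} (u : R ⊗[K] V → R ⊗[K] V)
    (hu : ∀ k, ∀ z ∈ ext (I ^ k) (⊤ : Submodule K V), u z ∈ ext (I ^ (k + 1)) (⊤ : Submodule K V))
    (z : R ⊗[K] V) (k : ℕ) (hz : z ∈ ext (I ^ k) (⊤ : Submodule K V)) (n : ℕ) :
    u^[n] z ∈ ext (I ^ (k + n)) (⊤ : Submodule K V) := by
  induction n with
  | zero => simpa using hz
  | succ n ih => rw [Function.iterate_succ_apply', ← add_assoc]; exact hu _ _ ih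

theorem ad_raise {I : Ideal R} {a : R ⊗[K] V} (ha : a ∈ ext I (⊤ : Submodule K V)) (k : ℕ)
    (z : R ⊗[K] V) (hz : z ∈ ext (I ^ k) (⊤ : Submodule K V)) :
    𝓜.bracketR R a z ∈ ext (I ^ (k + 1)) (⊤ : Submodule K V) := by
  rw [pow_succ']; exact bracketR_mem 𝓜 ha hz

theorem ad_iterate_eq_zero {I : Ideal R} {N : ℕ} (hI : I ^ N = ⊥) {a : R ⊗[K] V}
    (ha : a ∈ ext I (⊤ : Submodule K V)) (z : R ⊗[K] V) {n : ℕ} (hn : N ≤ n) :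
    (𝓜.bracketR R a)^[n] z = 0 :=
  eq_zero_of_mem_ext hI (by omega : N ≤ 0 + n)
    (iterate_mem _ (ad_raise 𝓜 ha) z 0 (by simpa using mem_ext_one z) n)

theorem ad_iterate_push (a z : R ⊗[K] V) (n : ℕ) :
    push φ V ((𝓜.bracketR R a)^[n] z) = (𝓜.bracketR S (push φ V a))^[n] (push φ V z) := by
  induction n with
  | zero => rfl
  | succ n ih => rw [Function.iterate_succ_apply', Function.iterate_succ_apply', bracketR_push, ih]

theorem gauge_push {I : Ideal R} {N : ℕ} (hI : I ^ N = ⊥) {a : R ⊗[K] V}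
    (ha : a ∈ ext I (⊤ : Submodule K V)) (y : R ⊗[K] V) :
    push φ V (gauge 𝓜 R a y) = gauge 𝓜 S (push φ V a) (push φ V y) := by
  rw [gauge, gauge, map_add, map_finsum_nat _ _ N]
  · simp only [map_smul, ad_iterate_push, map_sub, bracketR_push, DGLA.dR, push_baseChange]
  · intro n hn
    rw [ad_iterate_eq_zero 𝓜 hI ha _ hn, smul_zero]

theorem expAd_push {I : Ideal R} {N : ℕ} (hI : I ^ N = ⊥) {a : R ⊗[K] V}
    (ha : a ∈ ext I (⊤ : Submodule K V)) (y : R ⊗[K] V) :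
    push φ V (expAd 𝓜 R a y) = expAd 𝓜 S (push φ V a) (push φ V y) := by
  rw [expAd, expAd, map_finsum_nat _ _ N]
  · simp only [map_smul, ad_iterate_push]
  · intro n hn
    rw [ad_iterate_eq_zero 𝓜 hI ha _ hn, smul_zero]

theorem expAd_sub_mem {I : Ideal R} {N : ℕ} (hI : I ^ N = ⊥) {a : R ⊗[K] V}
    (ha : a ∈ ext I (⊤ : Submodule K V)) (k : ℕ) (z : R ⊗[K] V)
    (hz : z ∈ ext (I ^ k) (⊤ : Submodule K V)) :
    z - expAd 𝓜 R a z ∈ ext (I ^ (k + 1)) (⊤ : Submodule K V) := by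
  have h : expAd 𝓜 R a z = ∑ n ∈ Finset.range (N + 1),
      (n.factorial : K)⁻¹ • (𝓜.bracketR R a)^[n] z := by
    refine finsum_eq_sum_of_support_subset _ fun n hn => ?_
    by_contra h'
    refine hn ?_
    have h2 : N ≤ n := by
      have : ¬ n < N + 1 := by simpa using h'
      omega
    simp only [ad_iterate_eq_zero 𝓜 hI ha _ h2, smul_zero]
  rw [h, Finset.sum_range_succ']
  simp only [Nat.factorial_zero, Nat.cast_one, inv_one, one_smul, Function.iterate_zero, id_eq]
  rw [sub_add_eq_sub_sub_swap, sub_self, zero_sub]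
  refine Submodule.neg_mem _ (Submodule.sum_mem _ fun n _ => Submodule.smul_mem _ _ ?_)
  exact ext_mono (Ideal.pow_le_pow_right (by omega)) le_rfl
    (iterate_mem _ (ad_raise 𝓜 ha) z k hz (n + 1))

/-- The map induced on polynomials by a morphism of the coefficients. -/
noncomputable abbrev polyHom : R[X] →ₐ[K] S[X] := Polynomial.mapAlgHom φ

theorem push_push {T : Type*} [CommRing T] [Algebra K T] (ψ : S →ₐ[K] T) (z : R ⊗[K] V) :
    push ψ V (push φ V z) = push (ψ.comp φ) V z := by
  induction z with
  | zero => simp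
  | add x y hx hy => simp only [map_add, hx, hy]
  | tmul s x => rfl

theorem push_id (z : R ⊗[K] V) : push (AlgHom.id K R) V z = z := by
  induction z with
  | zero => simp
  | add x y hx hy => simp only [map_add, hx, hy]
  | tmul s x => rfl

theorem const_push (z : R ⊗[K] V) :
    push (polyHom φ) V (const R V z) = const S V (push φ V z) := by
  induction z with
  | zero => simp
  | add x y hx hy => simp only [map_add, hx, hy]
  | tmul s x =>
    change (Polynomial.map _ (Polynomial.C s)) ⊗ₜ[K] x = (Polynomial.C (φ s)) ⊗ₜ[K] x
    simp

theorem evalAt_push (a : R) (z : R[X] ⊗[K] V) :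
    push φ V (evalAt R V a z) = evalAt S V (φ a) (push (polyHom φ) V z) := by
  induction z with
  | zero => simp
  | add x y hx hy => simp only [map_add, hx, hy]
  | tmul s x =>
    change φ (Polynomial.aeval a s) ⊗ₜ[K] x
      = (Polynomial.aeval (φ a) (Polynomial.map (φ : R →+* S) s)) ⊗ₜ[K] x
    congr 1
    rw [Polynomial.coe_aeval_eq_eval, Polynomial.coe_aeval_eq_eval, Polynomial.eval_map]
    exact (Polynomial.eval₂_at_apply (φ : R →+* S) a).symm

theorem deriv_push (z : R[X] ⊗[K] V) :
    push (polyHom φ) V (deriv R V z) = deriv S V (push (polyHom φ) V z) := by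
  induction z with
  | zero => simp
  | add x y hx hy => simp only [map_add, hx, hy]
  | tmul s x =>
    change (Polynomial.map (φ : R →+* S) (Polynomial.derivative s)) ⊗ₜ[K] x
      = (Polynomial.derivative (Polynomial.map (φ : R →+* S) s)) ⊗ₜ[K] x
    rw [Polynomial.derivative_map]

theorem primPoly_map (s : R[X]) :
    polyHom φ (primPoly (K := K) R s) = primPoly (K := K) S (polyHom φ s) := by
  induction s using Polynomial.induction_on' with
  | add p q hp hq => simp only [map_add, hp, hq]
  | monomial n a =>
    simp [primPoly, Polynomial.lsum_apply, Polynomial.sum_monomial_index]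

theorem integral_push (z : R[X] ⊗[K] V) :
    push φ V (integral R V z) = integral S V (push (polyHom φ) V z) := by
  have h : push (polyHom φ) V (prim R V z) = prim S V (push (polyHom φ) V z) := by
    induction z with
    | zero => simp
    | add x y hx hy => simp only [map_add, hx, hy]
    | tmul s x =>
      change (polyHom φ (primPoly R s)) ⊗ₜ[K] x = (primPoly S (polyHom φ s)) ⊗ₜ[K] x
      rw [primPoly_map]
  rw [integral, integral, LinearMap.comp_apply, LinearMap.comp_apply, evalAt_push, h, map_one]

theorem const_mem {I : Ideal R} {W : Submodule K V} {z : R ⊗[K] V} (hz : z ∈ ext I W) :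
    const R V z ∈ ext (I.map Polynomial.C) W :=
  push_mem_ext ((Polynomial.CAlgHom (R := R) (A := R)).restrictScalars K)
    (J := I.map (Polynomial.C : R →+* R[X]))
    (fun _ ha => Ideal.mem_map_of_mem (Polynomial.C : R →+* R[X]) ha) hz

theorem map_C_pow_eq_bot {I : Ideal R} {N : ℕ} (hI : I ^ N = ⊥) :
    (I.map (Polynomial.C : R →+* R[X])) ^ N = ⊥ := by
  rw [← Ideal.map_pow, hI, Ideal.map_bot]

theorem bchU_push {I : Ideal R} {N : ℕ} (hI : I ^ N = ⊥) {a b : R ⊗[K] V}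
    (ha : a ∈ ext I (⊤ : Submodule K V)) (hb : b ∈ ext I (⊤ : Submodule K V)) (z : R[X] ⊗[K] V) :
    push (polyHom φ) V (bchU 𝓜 R a b z)
      = bchU 𝓜 S (push φ V a) (push φ V b) (push (polyHom φ) V z) := by
  have hb' : (Polynomial.X : R[X]) • const R V b
      ∈ ext (I.map Polynomial.C) (⊤ : Submodule K V) := by
    have := smul_mem_ext (I := (⊤ : Ideal R[X])) (r := Polynomial.X) trivial (const_mem hb)
    rwa [Ideal.top_mul] at this
  rw [bchU, bchU, map_sub, expAd_push _ 𝓜 (map_C_pow_eq_bot hI) (const_mem ha),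
    expAd_push _ 𝓜 (map_C_pow_eq_bot hI) hb', push_smul, const_push, const_push]
  simp

theorem bchU_mem {I : Ideal R} {N : ℕ} (hI : I ^ N = ⊥) {a b : R ⊗[K] V}
    (ha : a ∈ ext I (⊤ : Submodule K V)) (hb : b ∈ ext I (⊤ : Submodule K V)) (k : ℕ)
    (z : R[X] ⊗[K] V) (hz : z ∈ ext ((I.map Polynomial.C) ^ k) (⊤ : Submodule K V)) :
    bchU 𝓜 R a b z ∈ ext ((I.map Polynomial.C) ^ (k + 1)) (⊤ : Submodule K V) := by
  have hb' : (Polynomial.X : R[X]) • const R V b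
      ∈ ext (I.map Polynomial.C) (⊤ : Submodule K V) := by
    have := smul_mem_ext (I := (⊤ : Ideal R[X])) (r := Polynomial.X) trivial (const_mem hb)
    rwa [Ideal.top_mul] at this
  have h1 := expAd_sub_mem 𝓜 (map_C_pow_eq_bot hI) hb' k z hz
  have h2 := Submodule.sub_mem _ hz
    (ext_mono (Ideal.pow_le_pow_right (Nat.le_succ k)) le_rfl h1)
  rw [sub_sub_cancel] at h2
  have h3 := expAd_sub_mem 𝓜 (map_C_pow_eq_bot hI) (const_mem ha) k _ h2
  have := Submodule.add_mem _ h1 h3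
  rwa [sub_add_sub_cancel] at this

theorem bchU_iterate_push {I : Ideal R} {N : ℕ} (hI : I ^ N = ⊥) {a b : R ⊗[K] V}
    (ha : a ∈ ext I (⊤ : Submodule K V)) (hb : b ∈ ext I (⊤ : Submodule K V)) (z : R[X] ⊗[K] V)
    (n : ℕ) : push (polyHom φ) V ((bchU 𝓜 R a b)^[n] z)
      = (bchU 𝓜 S (push φ V a) (push φ V b))^[n] (push (polyHom φ) V z) := by
  induction n with
  | zero => rfl
  | succ n ih =>
    rw [Function.iterate_succ_apply', Function.iterate_succ_apply', bchU_push φ 𝓜 hI ha hb, ih]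

theorem bch_push {I : Ideal R} {N : ℕ} (hI : I ^ N = ⊥) {a b : R ⊗[K] V}
    (ha : a ∈ ext I (⊤ : Submodule K V)) (hb : b ∈ ext I (⊤ : Submodule K V)) :
    push φ V (bch 𝓜 R a b) = bch 𝓜 S (push φ V a) (push φ V b) := by
  rw [bch, bch, map_add, integral_push, map_sub, map_finsum_nat _ _ N]
  · simp only [map_smul, const_push, bchU_iterate_push φ 𝓜 hI ha hb]
  · intro n hn
    rw [eq_zero_of_mem_ext (map_C_pow_eq_bot hI) (by omega : N ≤ 0 + (n + 1))
      (iterate_mem _ (bchU_mem 𝓜 hI ha hb) _ 0 (by simpa using mem_ext_one _) (n + 1)), smul_zero]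

theorem integral_mem {I : Ideal R} {z : R[X] ⊗[K] V}
    (hz : z ∈ ext (I.map (Polynomial.C : R →+* R[X])) (⊤ : Submodule K V)) :
    integral R V z ∈ ext I (⊤ : Submodule K V) := by
  induction hz using Submodule.span_induction with
  | zero => simp
  | add x y _ _ hx hy => rw [map_add]; exact Submodule.add_mem _ hx hy
  | smul c x _ hx => rw [map_smul]; exact Submodule.smul_mem _ c hx
  | mem x h =>
    obtain ⟨p, hp, v, hv, rfl⟩ := h
    refine Submodule.subset_span ⟨Polynomial.aeval (1 : R) (primPoly (K := K) R p), ?_, v, hv, rfl⟩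
    rw [Ideal.mem_map_C_iff] at hp
    rw [primPoly, Polynomial.lsum_apply, Polynomial.sum, map_sum]
    refine Ideal.sum_mem _ fun n _ => ?_
    have := I.mul_mem_left (algebraMap K R ((n + 1 : K)⁻¹)) (hp n)
    simpa [Algebra.smul_def] using this

theorem bch_mem {I : Ideal R} {N : ℕ} (hI : I ^ N = ⊥) {a b : R ⊗[K] V}
    (ha : a ∈ ext I (⊤ : Submodule K V)) (hb : b ∈ ext I (⊤ : Submodule K V)) :
    bch 𝓜 R a b ∈ ext I (⊤ : Submodule K V) := by
  refine Submodule.add_mem _ ha (integral_mem (Submodule.sub_mem _ (const_mem hb)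
    (finsum_mem_of _ _ fun n => Submodule.smul_mem _ _ ?_)))
  have := iterate_mem _ (bchU_mem 𝓜 hI ha hb) (const R V b) 1
    (by simpa using const_mem hb) (n + 1)
  exact ext_mono ((Ideal.pow_le_pow_right (by omega)).trans (pow_one _).le) le_rfl this

end Naturality

/-! ### Local Artinian algebras -/

/-- Local Artinian `K`-algebras with residue field `K`. -/
structure Art (K : Type u) [Field K] where
  /-- the underlying type -/
  carrier : Type w
  [commRing : CommRing carrier]
  [algebra : Algebra K carrier]
  [isLocalRing : IsLocalRing carrier]
  [isArtinianRing : IsArtinianRing carrier]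
  residue : Function.Bijective (algebraMap K (IsLocalRing.ResidueField carrier))

attribute [instance] Art.commRing Art.algebra Art.isLocalRing Art.isArtinianRing

/-- The morphisms are the morphisms of `K`-algebras (they are automatically local). -/
instance (K : Type u) [Field K] : Category (Art.{u, w} K) where
  Hom A B := A.carrier →ₐ[K] B.carrier
  id A := AlgHom.id K A.carrier
  comp f g := AlgHom.comp g f

section Functors

variable {K : Type u} [Field K]

/-- The maximal ideal `𝔪_A`. -/
abbrev Art.m (A : Art.{u, w} K) : Ideal A.carrier := IsLocalRing.maximalIdeal A.carrier

/-- A morphism of `Art` as a morphism of algebras. -/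
abbrev Art.alg {A B : Art.{u, w} K} (f : A ⟶ B) : A.carrier →ₐ[K] B.carrier := f

theorem Art.m_nilpotent (A : Art.{u, w} K) : ∃ N, A.m ^ N = ⊥ := by
  have h := IsArtinianRing.isNilpotent_jacobson_bot (R := A.carrier)
  rwa [IsLocalRing.jacobson_eq_maximalIdeal ⊥ bot_ne_top] at h

theorem Art.map_m {A B : Art.{u, w} K} (f : A ⟶ B) : ∀ a ∈ A.m, Art.alg f a ∈ B.m := by
  intro a ha
  obtain ⟨N, hN⟩ := A.m_nilpotent
  have h0 : a ^ N = 0 := by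
    have := Ideal.pow_mem_pow ha N
    rw [hN] at this
    exact this
  have h1 : IsNilpotent (Art.alg f a) := ⟨N, by rw [← map_pow, h0, map_zero]⟩
  exact (IsLocalRing.mem_maximalIdeal _).2 h1.not_isUnit

theorem Art.map_m_poly {A B : Art.{u, w} K} (f : A ⟶ B) :
    ∀ a ∈ A.m.map (Polynomial.C : A.carrier →+* A.carrier[X]),
      polyHom (Art.alg f) a ∈ B.m.map (Polynomial.C : B.carrier →+* B.carrier[X]) := by
  intro a ha
  rw [Ideal.mem_map_C_iff] at ha ⊢
  intro n
  simpa [Polynomial.coeff_map] using Art.map_m f _ (ha n)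

/-! ### The deformation functor of an `L∞`-algebra -/

section DefLInf

variable {V : Type v} [AddCommGroup V] [Module K V] (Q : HigherOps K V)

/-- The left hand side `∑_{n ≥ 1} qₙ(γ, …, γ) / n!` of the Maurer-Cartan equation in `V ⊗ R`. -/
noncomputable def HigherOps.mcSum (R : Type w) [CommRing R] [Algebra K R] (γ : R ⊗[K] V) :
    R ⊗[K] V :=
  ∑ᶠ n : ℕ, ((n + 1).factorial : K)⁻¹ • mbc R (n + 1) (Q.q (n + 1)) fun _ => γ

/-- The operator `x ↦ (-1)^{deg x} x` of `V[1]`. -/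
noncomputable def HigherOps.sign : V →ₗ[K] V :=
  degreeScale Q.gr Q.isInternal fun i => (((i - 1).negOnePow : ℤ) : K)

/-- The operations of `V[t,dt] ⊗ R`, where `(x, y)` stands for `x + dt y` with
`x, y ∈ V[t] ⊗ R`.  In degree `n`,
`qₙ(x₁, …, dt yᵢ, …, xₙ) = -(-1)^{deg x₁ + ⋯ + deg xᵢ₋₁} dt qₙ(x₁, …, yᵢ, …, xₙ)` with degrees in
`V[1]`, terms with two factors `dt` vanish, and `q₁` contains in addition `-dt x'(t)`. -/
noncomputable def HigherOps.qTdt (R : Type w) [CommRing R] [Algebra K R] (n : ℕ)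
    (z : Fin n → (R[X] ⊗[K] V) × (R[X] ⊗[K] V)) : (R[X] ⊗[K] V) × (R[X] ⊗[K] V) :=
  (mbc R[X] n (Q.q n) fun i => (z i).1,
    (-∑ i, mbc R[X] n (Q.q n) fun j =>
      if j < i then Q.sign.baseChange R[X] (z j).1 else if j = i then (z j).2 else (z j).1)
    - if n = 1 then ∑ i, deriv R V (z i).1 else 0)

/-- The left hand side of the Maurer-Cartan equation in `V[t,dt] ⊗ R`. -/
noncomputable def HigherOps.mcSumTdt (R : Type w) [CommRing R] [Algebra K R]
    (z : (R[X] ⊗[K] V) × (R[X] ⊗[K] V)) : (R[X] ⊗[K] V) × (R[X] ⊗[K] V) :=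
  ∑ᶠ n : ℕ, ((n + 1).factorial : K)⁻¹ • Q.qTdt R (n + 1) fun _ => z

/-- The Maurer-Cartan elements of `V[1]^0 ⊗ 𝔪_A = V^1 ⊗ 𝔪_A`. -/
def HigherOps.MC (A : Art.{u, w} K) : Type (max w v) :=
  {γ : A.carrier ⊗[K] V // γ ∈ ext A.m (Q.gr 1) ∧ Q.mcSum A.carrier γ = 0}

/-- Homotopy equivalence: there is a Maurer-Cartan element `x(t) + dt y(t)` of `V[t,dt] ⊗ 𝔪_A`,
with `x(t)` in `V^1[t] ⊗ 𝔪_A` and `y(t)` in `V^0[t] ⊗ 𝔪_A`, and with values `γ₀`, `γ₁` at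
`t = 0`, `t = 1`. -/
def HigherOps.Homotopic (A : Art.{u, w} K) (γ₀ γ₁ : Q.MC A) : Prop :=
  ∃ x ∈ ext (A.m.map (Polynomial.C : A.carrier →+* A.carrier[X])) (Q.gr 1),
  ∃ y ∈ ext (A.m.map (Polynomial.C : A.carrier →+* A.carrier[X])) (Q.gr 0),
    Q.mcSumTdt A.carrier (x, y) = 0 ∧
    evalAt A.carrier V 0 x = γ₀.1 ∧ evalAt A.carrier V 1 x = γ₁.1

theorem HigherOps.mcSum_push {R S : Type w} [CommRing R] [Algebra K R] [CommRing S] [Algebra K S]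
    (φ : R →ₐ[K] S) {I : Ideal R} {N : ℕ} (hI : I ^ N = ⊥) {γ : R ⊗[K] V}
    (hγ : γ ∈ ext I (⊤ : Submodule K V)) :
    push φ V (Q.mcSum R γ) = Q.mcSum S (push φ V γ) := by
  rw [mcSum, mcSum, map_finsum_nat _ _ N]
  · simp only [map_smul, mbc_push]
  · intro n hn
    rw [eq_zero_of_mem_ext hI (by omega : N ≤ n + 1) (mbc_mem (n + 1) _ _ fun _ => hγ), smul_zero]

theorem HigherOps.qTdt_push {R S : Type w} [CommRing R] [Algebra K R] [CommRing S] [Algebra K S]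
    (φ : R →ₐ[K] S) (n : ℕ) (z : Fin n → (R[X] ⊗[K] V) × (R[X] ⊗[K] V)) :
    (push (polyHom φ) V).prodMap (push (polyHom φ) V) (Q.qTdt R n z)
      = Q.qTdt S n fun i => (push (polyHom φ) V).prodMap (push (polyHom φ) V) (z i) := by
  refine Prod.ext ?_ ?_
  · exact mbc_push _ _ _ _
  · simp only [qTdt, LinearMap.prodMap_apply, map_sub, map_neg, map_sum, mbc_push, apply_ite
      (push (polyHom φ) V), push_baseChange, deriv_push, map_zero]

theorem HigherOps.mcSumTdt_push {R S : Type w} [CommRing R] [Algebra K R] [CommRing S]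
    [Algebra K S] (φ : R →ₐ[K] S) {I : Ideal R[X]} {N : ℕ} (hI : I ^ N = ⊥)
    {x y : R[X] ⊗[K] V} (hx : x ∈ ext I (⊤ : Submodule K V)) (hy : y ∈ ext I (⊤ : Submodule K V)) :
    (push (polyHom φ) V).prodMap (push (polyHom φ) V) (Q.mcSumTdt R (x, y))
      = Q.mcSumTdt S (push (polyHom φ) V x, push (polyHom φ) V y) := by
  rw [mcSumTdt, mcSumTdt, map_finsum_nat _ _ (N + 1)]
  · exact finsum_congr fun n => by rw [map_smul, qTdt_push]; rfl
  · intro n hn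
    have hz : ∀ f : MultilinearMap K (fun _ : Fin (n + 1) => V) V,
        ∀ u : Fin (n + 1) → R[X] ⊗[K] V, (∀ i, u i ∈ ext I (⊤ : Submodule K V)) →
        mbc R[X] (n + 1) f u = 0 := fun f u hu =>
      eq_zero_of_mem_ext hI (by omega : N ≤ n + 1) (mbc_mem (n + 1) f u hu)
    have h1 : Q.qTdt R (n + 1) (fun _ => (x, y)) = 0 := by
      refine Prod.ext (hz _ _ fun _ => hx) ?_
      have : ¬ n + 1 = 1 := by omega
      simp only [qTdt, this, if_false, sub_zero, Prod.snd_zero]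
      rw [neg_eq_zero]
      refine Finset.sum_eq_zero fun i _ => hz _ _ fun j => ?_
      split_ifs
      · exact baseChange_mem_ext _ (fun _ _ => Submodule.mem_top) hx
      · exact hy
      · exact hx
    rw [h1, smul_zero]

/-- The action of a morphism `A ⟶ B` on Maurer-Cartan elements. -/
noncomputable def HigherOps.MC.map {A B : Art.{u, w} K} (f : A ⟶ B) (γ : Q.MC A) : Q.MC B :=
  ⟨push (Art.alg f) V γ.1, push_mem_ext _ (Art.map_m f) γ.2.1, by
    obtain ⟨N, hN⟩ := A.m_nilpotent
    rw [← Q.mcSum_push _ hN (ext_mono le_rfl le_top γ.2.1), γ.2.2, map_zero]⟩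

theorem HigherOps.Homotopic.map {A B : Art.{u, w} K} (f : A ⟶ B) {γ₀ γ₁ : Q.MC A}
    (h : Q.Homotopic A γ₀ γ₁) : Q.Homotopic B (MC.map Q f γ₀) (MC.map Q f γ₁) := by
  obtain ⟨x, hx, y, hy, h, h0, h1⟩ := h
  obtain ⟨N, hN⟩ := A.m_nilpotent
  refine ⟨push (polyHom (Art.alg f)) V x, push_mem_ext _ (Art.map_m_poly f) hx,
    push (polyHom (Art.alg f)) V y, push_mem_ext _ (Art.map_m_poly f) hy, ?_, ?_, ?_⟩
  · rw [← Q.mcSumTdt_push _ (map_C_pow_eq_bot hN) (ext_mono le_rfl le_top hx)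
      (ext_mono le_rfl le_top hy), h, map_zero]
  · have := evalAt_push (Art.alg f) 0 x
    rw [h0, map_zero] at this
    exact this.symm
  · have := evalAt_push (Art.alg f) 1 x
    rw [h1, map_one] at this
    exact this.symm

/-- The deformation functor: Maurer-Cartan elements modulo (the equivalence relation generated by)
homotopy equivalence. -/
noncomputable def HigherOps.defFunctor : Art.{u, w} K ⥤ Type (max w v) where
  obj A := Quot (Q.Homotopic A)
  map f := TypeCat.ofHom (Quot.map (HigherOps.MC.map Q f) fun _ _ h => h.map Q f)
  map_id A := by
    ext ⟨γ⟩
    exact congrArg (Quot.mk _) (Subtype.ext (push_id γ.1))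
  map_comp f g := by
    ext ⟨γ⟩
    exact congrArg (Quot.mk _) (Subtype.ext (push_push (Art.alg f) (Art.alg g) γ.1).symm)

end DefLInf

/-! ### The deformation functor of a morphism -/

section DefChi

variable {L : Type v₁} [AddCommGroup L] [Module K L] {M : Type v₂} [AddCommGroup M] [Module K M]
  {𝓛 : DGLA K L} {𝓜 : DGLA K M} (χ : DGLA.Hom 𝓛 𝓜)

/-- The pairs `(x, e^a)` with `x ∈ L^1 ⊗ 𝔪_A`, `e^a ∈ exp(M^0 ⊗ 𝔪_A)`, `dx + ½ [x, x] = 0` and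
`e^a * χ(x) = 0`.  The group `exp(M^0 ⊗ 𝔪_A)` is the set `M^0 ⊗ 𝔪_A` with the
Baker-Campbell-Hausdorff product, and `e^a` is represented by `a`. -/
def MCχ (A : Art.{u, w} K) : Type (max w v₁ v₂) :=
  {p : (A.carrier ⊗[K] L) × (A.carrier ⊗[K] M) //
    p.1 ∈ ext A.m (𝓛.gr 1) ∧ p.2 ∈ ext A.m (𝓜.gr 0) ∧
    𝓛.dR A.carrier p.1 + (2⁻¹ : K) • 𝓛.bracketR A.carrier p.1 p.1 = 0 ∧
    gauge 𝓜 A.carrier p.2 (χ.toLin.baseChange A.carrier p.1) = 0}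

/-- Gauge equivalence of `(l₀, e^{m₀})` and `(l₁, e^{m₁})`: there are `a ∈ L^0 ⊗ 𝔪_A` and
`b ∈ M^{-1} ⊗ 𝔪_A` with `l₁ = e^a * l₀` and `e^{m₁} = e^{db} e^{m₀} e^{-χ(a)}`. -/
def GaugeEquiv (A : Art.{u, w} K) (p₀ p₁ : MCχ χ A) : Prop :=
  ∃ a ∈ ext A.m (𝓛.gr 0), ∃ b ∈ ext A.m (𝓜.gr (-1)),
    p₁.1.1 = gauge 𝓛 A.carrier a p₀.1.1 ∧
    p₁.1.2 = bch 𝓜 A.carrier (bch 𝓜 A.carrier (𝓜.dR A.carrier b) p₀.1.2)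
      (-(χ.toLin.baseChange A.carrier a))

/-- The action of a morphism `A ⟶ B` on the pairs `(x, e^a)`. -/
noncomputable def MCχ.map {A B : Art.{u, w} K} (f : A ⟶ B) (p : MCχ χ A) : MCχ χ B :=
  ⟨(push (Art.alg f) L p.1.1, push (Art.alg f) M p.1.2),
    push_mem_ext _ (Art.map_m f) p.2.1, push_mem_ext _ (Art.map_m f) p.2.2.1, by
      have := congrArg (push (Art.alg f) L) p.2.2.2.1
      simpa only [map_add, map_smul, DGLA.dR, push_baseChange, bracketR_push, map_zero] using this,
    by
      obtain ⟨N, hN⟩ := A.m_nilpotent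
      have := congrArg (push (Art.alg f) M) p.2.2.2.2
      rwa [gauge_push _ 𝓜 hN (ext_mono le_rfl le_top p.2.2.1), push_baseChange, map_zero] at this⟩

theorem GaugeEquiv.map {A B : Art.{u, w} K} (f : A ⟶ B) {p₀ p₁ : MCχ χ A}
    (h : GaugeEquiv χ A p₀ p₁) : GaugeEquiv χ B (MCχ.map χ f p₀) (MCχ.map χ f p₁) := by
  obtain ⟨a, ha, b, hb, h1, h2⟩ := h
  obtain ⟨N, hN⟩ := A.m_nilpotent
  have hdb : 𝓜.dR A.carrier b ∈ ext A.m (⊤ : Submodule K M) :=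
    baseChange_mem_ext _ (fun _ _ => Submodule.mem_top) hb
  have hχ : -(χ.toLin.baseChange A.carrier a) ∈ ext A.m (⊤ : Submodule K M) :=
    Submodule.neg_mem _ (baseChange_mem_ext _ (fun _ _ => Submodule.mem_top) ha)
  have hm : p₀.1.2 ∈ ext A.m (⊤ : Submodule K M) := ext_mono le_rfl le_top p₀.2.2.1
  refine ⟨push (Art.alg f) L a, push_mem_ext _ (Art.map_m f) ha,
    push (Art.alg f) M b, push_mem_ext _ (Art.map_m f) hb, ?_, ?_⟩
  · have := congrArg (push (Art.alg f) L) h1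
    rwa [gauge_push _ 𝓛 hN (ext_mono le_rfl le_top ha)] at this
  · have := congrArg (push (Art.alg f) M) h2
    rwa [bch_push _ 𝓜 hN (bch_mem 𝓜 hN hdb hm) hχ, bch_push _ 𝓜 hN hdb hm, map_neg,
      push_baseChange, dR_push] at this

/-- The functor `Def_χ`. -/
noncomputable def defχ : Art.{u, w} K ⥤ Type (max w v₁ v₂) where
  obj A := Quot (GaugeEquiv χ A)
  map f := TypeCat.ofHom (Quot.map (MCχ.map χ f) fun _ _ h => h.map χ f)
  map_id A := by
    ext ⟨p⟩
    exact congrArg (Quot.mk _) (Subtype.ext (Prod.ext (push_id p.1.1) (push_id p.1.2)))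
  map_comp f g := by
    ext ⟨p⟩
    exact congrArg (Quot.mk _) (Subtype.ext (Prod.ext
      (push_push (Art.alg f) (Art.alg g) p.1.1).symm
      (push_push (Art.alg f) (Art.alg g) p.1.2).symm))

end DefChi

end Functors

end LInfCone

open LInfCone

/-! Write `φ(z) = (e^z - 1)/z` and `f(z) = z e^z/(e^z - 1)`, so that `f φ = e^z`. Since `𝔪_A` is
nilpotent, every power series can be evaluated at `ad_m` for `m ∈ M^0 ⊗ 𝔪_A`, and `φ(ad_m)` is
invertible.

Maurer-Cartan elements. In a nested term of the transferred bracket the variable `t` separates from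
the Lie algebra: each `K q₂` applies the operator `p ↦ ∫₀ᵗ p - t ∫₀¹ p` to a polynomial and one
bracket to an element of `M`. The resulting numbers are the coefficients of `f`
(`coneSeries_mul_phiS`). Hence `γ = (l, m)` is a Maurer-Cartan element iff `dl + ½[l, l] = 0` and
`dm = f(ad_m) χ(l)`. Because `e^m * χ(l) = e^{ad_m} χ(l) - φ(ad_m) dm = φ(ad_m)(f(ad_m) χ(l) - dm)`,
the second equation says `e^m * χ(l) = 0` (`gauge_eq_zero_iff`). So `(l, m) ↦ (l, e^m)` is a
bijection on Maurer-Cartan elements.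

Homotopies. For a path `x = (l, m)` and `y = (a, b)`, the `dt`-part of the Maurer-Cartan equation
says that `x'` is minus the linearized equation in the direction `y`. After applying `φ(ad_m)` it
reads `l' = da - [a, l]` and `φ(ad_m) m' = e^{ad_m} χ(a) - d(φ(ad_m) b)` (`phiS_linear_part`,
`mcSumTdt_eq_zero_iff`). The left hand side is the logarithmic derivative `(e^m)' e^{-m}`, so the
solutions are `l = e^g * l(0)` and `e^m = e^{dc} e^{m(0)} e^{-χ(g)}` for paths `g`, `c` starting at
`0`. At `t = 1` this is gauge equivalence (`exists_gauge_of_path`). Conversely `g = t a`, `dc = t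
db` turn a gauge equivalence into a homotopy (`exists_path_of_gauge`). The two relations therefore
correspond exactly, and so do the quotients.

Two tools carry the calculations. Duhamel's formula (`linEval_expS`) computes the linear part of an
exponential. The affine representation `DGLA.affine`, which adjoins to the Lie algebra an element
acting as a derivation `δ`, contains the adjoint action, the gauge action and logarithmic
derivatives as special cases, so that the single statement `exp_affine_bch` gives the behaviour of
all three under the Baker-Campbell-Hausdorff product. -/

namespace LInfCone

/-! ### Evaluation of power series at nilpotent elements -/

section NilEval

open PowerSeries (coeff trunc)

variable {K : Type*} [Field K] {E : Type*} [Ring E] [Algebra K E]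

/-- The value `∑ fₙ Aⁿ` of a power series at a nilpotent element. -/
noncomputable def nilEval (A : E) (f : PowerSeries K) : E := ∑ᶠ n, coeff n f • A ^ n

theorem nilEval_eq_sum {A : E} {N : ℕ} (hA : A ^ N = 0) (f : PowerSeries K) :
    nilEval A f = ∑ n ∈ Finset.range N, coeff n f • A ^ n := by
  refine finsum_eq_sum_of_support_subset _ fun n hn => ?_
  by_contra h'
  exact hn (by simp only [pow_eq_zero_of_le (by simpa using h' : N ≤ n) hA, smul_zero])

theorem nilEval_eq_aeval {A : E} {N : ℕ} (hA : A ^ N = 0) (f : PowerSeries K) :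
    nilEval A f = Polynomial.aeval A (trunc N f) := by
  rw [nilEval_eq_sum hA, PowerSeries.trunc_apply, map_sum, ← Finset.range_eq_Ico]
  simp [Polynomial.aeval_monomial, Algebra.smul_def]

theorem aeval_congr_of_pow_eq_zero {A : E} {N : ℕ} (hA : A ^ N = 0) {p q : K[X]}
    (h : ∀ n < N, p.coeff n = q.coeff n) : Polynomial.aeval A p = Polynomial.aeval A q := by
  have : (Polynomial.X : K[X]) ^ N ∣ p - q := by
    rw [Polynomial.X_pow_dvd_iff]
    intro d hd
    simp [h d hd]
  obtain ⟨r, hr⟩ := this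
  rw [← sub_eq_zero, ← map_sub, hr]
  simp [hA]

theorem nilEval_congr {A : E} {N : ℕ} (hA : A ^ N = 0) {f g : PowerSeries K}
    (h : ∀ n < N, coeff n f = coeff n g) : nilEval A f = nilEval A g := by
  rw [nilEval_eq_sum hA, nilEval_eq_sum hA]
  exact Finset.sum_congr rfl fun n hn => by rw [h n (Finset.mem_range.1 hn)]

/-- Coefficients of a product below degree `N` involve only coefficients below `N`, and higher ones
are invisible at `A`. Operator identities below are thereby reduced to identities of power series.
-/
theorem nilEval_mul {A : E} (hA : IsNilpotent A) (f g : PowerSeries K) :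
    nilEval A (f * g) = nilEval A f * nilEval A g := by
  obtain ⟨N, hN⟩ := hA
  rw [nilEval_eq_aeval hN, nilEval_eq_aeval hN, nilEval_eq_aeval hN, ← map_mul]
  refine aeval_congr_of_pow_eq_zero hN fun n hn => ?_
  rw [PowerSeries.coeff_trunc, if_pos hn, PowerSeries.coeff_mul, Polynomial.coeff_mul]
  refine Finset.sum_congr rfl fun p hp => ?_
  have := Finset.HasAntidiagonal.mem_antidiagonal.1 hp
  rw [PowerSeries.coeff_trunc, PowerSeries.coeff_trunc, if_pos (by omega), if_pos (by omega)]

theorem nilEval_add {A : E} (hA : IsNilpotent A) (f g : PowerSeries K) :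
    nilEval A (f + g) = nilEval A f + nilEval A g := by
  obtain ⟨N, hN⟩ := hA
  simp only [nilEval_eq_aeval hN, map_add]

theorem nilEval_sub {A : E} (hA : IsNilpotent A) (f g : PowerSeries K) :
    nilEval A (f - g) = nilEval A f - nilEval A g := by
  obtain ⟨N, hN⟩ := hA
  simp only [nilEval_eq_aeval hN, map_sub]

theorem nilEval_smul {A : E} (hA : IsNilpotent A) (c : K) (f : PowerSeries K) :
    nilEval A (c • f) = c • nilEval A f := by
  obtain ⟨N, hN⟩ := hA
  simp only [nilEval_eq_sum hN, PowerSeries.coeff_smul, smul_assoc, Finset.smul_sum]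

theorem nilEval_one {A : E} : nilEval A (1 : PowerSeries K) = 1 := by
  rw [nilEval, finsum_eq_single _ 0 fun n hn => by simp [PowerSeries.coeff_one, hn]]
  simp

theorem nilEval_X {A : E} : nilEval A (PowerSeries.X : PowerSeries K) = A := by
  rw [nilEval, finsum_eq_single _ 1 fun n hn => by simp [PowerSeries.coeff_X, hn]]
  simp

theorem nilEval_sum {A : E} (hA : IsNilpotent A) {ι : Type*} (s : Finset ι)
    (f : ι → PowerSeries K) : nilEval A (∑ i ∈ s, f i) = ∑ i ∈ s, nilEval A (f i) := by
  classical
  induction s using Finset.induction_on with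
  | empty => simp [nilEval]
  | insert i s hi ih => rw [Finset.sum_insert hi, Finset.sum_insert hi, nilEval_add hA, ih]

/-! ### Linearization of `A ↦ f(A)` -/

/-- The linear part `∑_{i + j = n - 1} Aⁱ B Aʲ` of `(A + B)ⁿ` in `B`. -/
def polar (A B : E) : ℕ → E
  | 0 => 0
  | n + 1 => A * polar A B n + B * A ^ n

/-- The linear part of `f(A + B)` in `B`. -/
noncomputable def linEval (A B : E) (f : PowerSeries K) : E := ∑ᶠ n, coeff n f • polar A B n

/-- The first order deformation `A + ε B`. -/
def dual (A B : E) : TrivSqZeroExt E E := TrivSqZeroExt.inl A + TrivSqZeroExt.inr B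

theorem dual_pow (A B : E) (n : ℕ) :
    dual A B ^ n = TrivSqZeroExt.inl (A ^ n) + TrivSqZeroExt.inr (polar A B n) := by
  induction n with
  | zero => simp [polar]
  | succ n ih =>
    rw [pow_succ', ih]
    ext <;> simp [dual, polar, pow_succ']

/-- The `N`-th power has only an `ε`-part, and `ε² = 0`. This is the origin of the bound `N + N`
wherever `polar` or `linEval` occurs. -/
theorem dual_pow_eq_zero {A : E} {N : ℕ} (hA : A ^ N = 0) (B : E) : dual A B ^ (N + N) = 0 := by
  rw [pow_add, dual_pow, hA]
  ext <;> simp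

theorem polar_eq_zero {A : E} {N n : ℕ} (hA : A ^ N = 0) (B : E) (hn : N + N ≤ n) :
    polar A B n = 0 := by
  have h := pow_eq_zero_of_le hn (dual_pow_eq_zero hA B)
  rw [dual_pow] at h
  simpa using congrArg TrivSqZeroExt.snd h

theorem linEval_eq_sum {A : E} {N T : ℕ} (hA : A ^ N = 0) (hT : N + N ≤ T) (B : E)
    (f : PowerSeries K) : linEval A B f = ∑ n ∈ Finset.range T, coeff n f • polar A B n := by
  refine finsum_eq_sum_of_support_subset _ fun n hn => ?_
  by_contra h'
  have : T ≤ n := by simpa using h'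
  exact hn (by simp only [polar_eq_zero hA B (hT.trans this), smul_zero])

theorem nilEval_dual {A : E} (hA : IsNilpotent A) (B : E) (f : PowerSeries K) :
    nilEval (dual A B) f
      = TrivSqZeroExt.inl (nilEval A f) + TrivSqZeroExt.inr (linEval A B f) := by
  obtain ⟨N, hN⟩ := hA
  rw [nilEval_eq_sum (dual_pow_eq_zero hN B), linEval_eq_sum hN le_rfl,
    nilEval_eq_sum (pow_eq_zero_of_le (Nat.le_add_right N N) hN)]
  simp only [dual_pow, smul_add, Finset.sum_add_distrib, ← TrivSqZeroExt.inl_smul,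
    ← TrivSqZeroExt.inr_smul, TrivSqZeroExt.inl_sum, TrivSqZeroExt.inr_sum]

/-- The product rule is the `ε`-part of multiplicativity of evaluation at `A + ε B`. -/
theorem linEval_mul {A : E} (hA : IsNilpotent A) (B : E) (f g : PowerSeries K) :
    linEval A B (f * g) = nilEval A f * linEval A B g + linEval A B f * nilEval A g := by
  have hn : IsNilpotent (dual A B) := by
    obtain ⟨N, hN⟩ := hA
    exact ⟨_, dual_pow_eq_zero hN B⟩
  have := nilEval_mul hn f g
  rw [nilEval_dual hA, nilEval_dual hA, nilEval_dual hA] at this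
  simpa using congrArg TrivSqZeroExt.snd this

theorem commutator_pow (D A : E) (n : ℕ) :
    D * A ^ n = A ^ n * D + polar A (D * A - A * D) n := by
  induction n with
  | zero => simp [polar]
  | succ n ih =>
    calc D * A ^ (n + 1) = A * (D * A ^ n) + (D * A - A * D) * A ^ n := by
          rw [pow_succ']; noncomm_ring
      _ = _ := by rw [ih, polar, pow_succ']; noncomm_ring

/-- As `[D, ·]` is a derivation, `[D, f(A)]` is the linear part of `f` at `A` in the direction `[D,
A]`. It is applied both to differential operators `D` and to arbitrary ring elements. -/
theorem commutator_nilEval {A : E} (hA : IsNilpotent A) (D : E) (f : PowerSeries K) :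
    D * nilEval A f = nilEval A f * D + linEval A (D * A - A * D) f := by
  obtain ⟨N, hN⟩ := hA
  rw [nilEval_eq_sum (pow_eq_zero_of_le (Nat.le_add_right N N) hN), linEval_eq_sum hN le_rfl,
    Finset.mul_sum, Finset.sum_mul, ← Finset.sum_add_distrib]
  refine Finset.sum_congr rfl fun n _ => ?_
  rw [mul_smul_comm, commutator_pow, smul_add, smul_mul_assoc]

/-! ### Duhamel's formula -/

/-- The operator `B ↦ A B - B A`. -/
def adOp (K : Type*) [Field K] {E : Type*} [Ring E] [Algebra K E] (A : E) : Module.End K E :=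
  LinearMap.mulLeft K A - LinearMap.mulRight K A

theorem adOp_apply (A B : E) : adOp K A B = A * B - B * A := rfl

/-- All factors `A` are moved to the right of `B` by `A X = [A, X] + X A`; Pascal's rule produces
the binomial coefficients. -/
theorem polar_eq_sum_choose (A B : E) (n : ℕ) :
    polar A B n = ∑ p ∈ Finset.range n, n.choose (p + 1) •
      (((adOp K A) ^ p) B * A ^ (n - 1 - p)) := by
  induction n with
  | zero => simp [polar]
  | succ n ih =>
    have key : ∀ p, A * ((adOp K A) ^ p) B
        = ((adOp K A) ^ (p + 1)) B + ((adOp K A) ^ p) B * A := by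
      intro p
      rw [pow_succ', Module.End.mul_apply, adOp_apply]
      abel
    have h1 : A * polar A B n = (∑ p ∈ Finset.range n, n.choose (p + 1) •
          (((adOp K A) ^ (p + 1)) B * A ^ (n - (p + 1))))
        + ∑ p ∈ Finset.range n, n.choose (p + 1) • (((adOp K A) ^ p) B * A ^ (n - p)) := by
      rw [ih, Finset.mul_sum, ← Finset.sum_add_distrib]
      refine Finset.sum_congr rfl fun p hp => ?_
      have hp := Finset.mem_range.1 hp
      rw [mul_smul_comm, ← mul_assoc, key, add_mul, smul_add, mul_assoc, ← pow_succ',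
        show n - 1 - p + 1 = n - p by omega, show n - 1 - p = n - (p + 1) by omega]
    have h2 : ∑ p ∈ Finset.range (n + 1), n.choose p • (((adOp K A) ^ p) B * A ^ (n - p))
        = (∑ p ∈ Finset.range n, n.choose (p + 1) •
          (((adOp K A) ^ (p + 1)) B * A ^ (n - (p + 1)))) + B * A ^ n := by
      rw [Finset.sum_range_succ']
      simp
    have h3 : ∑ p ∈ Finset.range (n + 1), n.choose (p + 1) • (((adOp K A) ^ p) B * A ^ (n - p))
        = ∑ p ∈ Finset.range n, n.choose (p + 1) • (((adOp K A) ^ p) B * A ^ (n - p)) := by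
      rw [Finset.sum_range_succ, Nat.choose_eq_zero_of_lt (Nat.lt_succ_self n), zero_smul, add_zero]
    simp only [Nat.choose_succ_succ n, add_smul, Finset.sum_add_distrib, Nat.add_sub_cancel]
    rw [h2, h3, polar, h1]
    abel

/-- Left and right multiplication by `A` commute and both have vanishing `N`-th power. -/
theorem adOp_pow_eq_zero {A : E} {N : ℕ} (hA : A ^ N = 0) : (adOp K A) ^ (N + N) = 0 := by
  rw [adOp, sub_eq_add_neg]
  have hc : Commute (LinearMap.mulLeft K A : Module.End K E) (-LinearMap.mulRight K A) :=
    (LinearMap.commute_mulLeft_right (R := K) A A).neg_right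
  refine hc.add_pow_eq_zero_of_add_le_succ_of_pow_eq_zero (m := N) (n := N) ?_ ?_ (by omega)
  · rw [LinearMap.pow_mulLeft, hA]; simp
  · rw [neg_pow (LinearMap.mulRight K A : Module.End K E), LinearMap.pow_mulRight, hA]; simp

/-- The series `e^z`. -/
noncomputable def expS (K : Type*) [Field K] : PowerSeries K :=
  PowerSeries.mk fun n => (n.factorial : K)⁻¹

/-- The series `(e^z - 1) / z`. -/
noncomputable def phiS (K : Type*) [Field K] : PowerSeries K :=
  PowerSeries.mk fun n => ((n + 1).factorial : K)⁻¹

theorem phiS_mul_X : phiS K * PowerSeries.X = expS K - 1 := by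
  ext n
  cases n with
  | zero => simp [expS]
  | succ n => simp [PowerSeries.coeff_succ_mul_X, phiS, expS, PowerSeries.coeff_one]

theorem sum_range_sum_antidiagonal {W : Type*} [AddCommMonoid W] (f : ℕ → ℕ → W) (T : ℕ)
    (h : ∀ p q, T ≤ p + q → f p q = 0) :
    ∑ n ∈ Finset.range T, ∑ x ∈ Finset.HasAntidiagonal.antidiagonal n, f x.1 x.2
      = ∑ p ∈ Finset.range T, ∑ q ∈ Finset.range T, f p q := by
  rw [← Finset.sum_product', ← Finset.sum_filter_of_ne (p := fun x : ℕ × ℕ => x.1 + x.2 < T)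
      (fun x _ hx => by by_contra h'; exact hx (h _ _ (by omega))),
    ← Finset.sum_fiberwise_of_maps_to (t := Finset.range T) (g := fun x : ℕ × ℕ => x.1 + x.2)
      (fun x hx => by simpa using (Finset.mem_filter.1 hx).2)]
  refine Finset.sum_congr rfl fun n hn => Finset.sum_congr ?_ fun _ _ => rfl
  ext x
  simp only [Finset.HasAntidiagonal.mem_antidiagonal, Finset.mem_filter, Finset.mem_product,
    Finset.mem_range] at hn ⊢
  omega

/-- Duhamel's formula `φ(ad_A)(B) e^A`. By `polar_eq_sum_choose` it is a Cauchy product, because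
`C(n+1, p+1)/(n+1)! = 1/(p+1)! · 1/(n-p)!`. -/
theorem linEval_expS [CharZero K] {A : E} (hA : IsNilpotent A) (B : E) :
    linEval A B (expS K) = nilEval (adOp K A) (phiS K) B * nilEval A (expS K) := by
  obtain ⟨N, hN⟩ := hA
  -- `ad_A^{2N} = 0` and `A^N = 0`, so terms with `p + q ≥ 3N` vanish and the square of indices may
  -- be replaced by a triangle.
  have hT1 : A ^ (N + N + N) = 0 := pow_eq_zero_of_le (by omega) hN
  have hT2 : (adOp K A) ^ (N + N + N) = 0 :=
    pow_eq_zero_of_le (by omega) (adOp_pow_eq_zero hN)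
  rw [nilEval_eq_sum hT1, nilEval_eq_sum hT2,
    linEval_eq_sum hN (by omega : N + N ≤ N + N + N + 1), LinearMap.sum_apply,
    Finset.sum_mul_sum, Finset.sum_range_succ']
  have h0 : ∀ p q, N + N + N ≤ p + q →
      (coeff p (phiS K) • (adOp K A) ^ p) B * (coeff q (expS K) • A ^ q) = 0 := by
    intro p q h
    rcases le_or_gt N q with hq | hq
    · rw [pow_eq_zero_of_le hq hN, smul_zero, mul_zero]
    · rw [pow_eq_zero_of_le (by omega : N + N ≤ p) (adOp_pow_eq_zero hN)]; simp
  rw [← sum_range_sum_antidiagonal _ _ h0]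
  simp only [polar, smul_zero, add_zero]
  refine Finset.sum_congr rfl fun n _ => ?_
  have := polar_eq_sum_choose (K := K) A B (n + 1)
  rw [polar] at this
  rw [this, Finset.Nat.sum_antidiagonal_eq_sum_range_succ
    (fun p q => (coeff p (phiS K) • (adOp K A) ^ p) B * (coeff q (expS K) • A ^ q)),
    Finset.smul_sum]
  refine Finset.sum_congr rfl fun p hp => ?_
  have hp : p ≤ n := by simpa [Nat.lt_succ_iff] using hp
  rw [Nat.add_sub_cancel, ← Nat.cast_smul_eq_nsmul K, smul_smul, LinearMap.smul_apply,
    smul_mul_smul_comm]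
  congr 1
  simp only [expS, phiS, PowerSeries.coeff_mk]
  have h := Nat.choose_mul_factorial_mul_factorial (Nat.succ_le_succ hp)
  rw [Nat.succ_sub_succ] at h
  have h' : ((n + 1).choose (p + 1) : K) * (p + 1).factorial * (n - p).factorial
      = (n + 1).factorial := by exact_mod_cast h
  have := Nat.factorial_ne_zero
  have e1 : ((n + 1).factorial : K) ≠ 0 := by exact_mod_cast this _
  have e2 : ((p + 1).factorial : K) ≠ 0 := by exact_mod_cast this _
  have e3 : ((n - p).factorial : K) ≠ 0 := by exact_mod_cast this _
  field_simp
  linear_combination h'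

end NilEval

/-! ### The coefficients of the transferred operations -/

section Coefficients

open PowerSeries (coeff)

variable {K : Type*} [Field K]

/-- The operator `p ↦ ∫₀ᵗ p - t ∫₀¹ p` on polynomials. -/
noncomputable def homotopyPoly (K : Type*) [Field K] : K[X] →ₗ[K] K[X] :=
  primPoly K - LinearMap.toSpanSingleton K K[X] Polynomial.X ∘ₗ
    (Polynomial.aeval (1 : K)).toLinearMap ∘ₗ primPoly K

/-- The number `∫₀¹ kⁿ(t) dt`, for the operator `k = homotopyPoly`. -/
noncomputable def coneCoeff (K : Type*) [Field K] (n : ℕ) : K :=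
  Polynomial.aeval (1 : K) (primPoly (K := K) K ((homotopyPoly K)^[n] Polynomial.X))

/-- The series `1 + ∑ (-1)ⁿ cₙ zⁿ⁺¹` with `cₙ = coneCoeff K n`. -/
noncomputable def coneSeries (K : Type*) [Field K] : PowerSeries K :=
  PowerSeries.mk fun n => Nat.casesOn n 1 fun n => (-1) ^ n * coneCoeff K n

theorem primPoly_monomial {R : Type*} [CommRing R] [Algebra K R] (n : ℕ) (a : R) :
    primPoly (K := K) R (Polynomial.monomial n a)
      = ((n + 1 : K)⁻¹) • Polynomial.monomial (n + 1) a := by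
  simp [primPoly, Polynomial.lsum_apply, Polynomial.sum_monomial_index]

theorem eval_zero_primPoly {R : Type*} [CommRing R] [Algebra K R] (p : R[X]) :
    (primPoly (K := K) R p).eval 0 = 0 := by
  induction p using Polynomial.induction_on' with
  | add p q hp hq => simp [hp, hq]
  | monomial n a => simp [primPoly_monomial]

variable [CharZero K]

theorem derivative_primPoly {R : Type*} [CommRing R] [Algebra K R] (p : R[X]) :
    Polynomial.derivative (primPoly (K := K) R p) = p := by
  induction p using Polynomial.induction_on' with
  | add p q hp hq => simp [hp, hq]
  | monomial n a =>
    have h : ((n : K) + 1) ≠ 0 := by exact_mod_cast Nat.succ_ne_zero n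
    have h2 : a * ((n : R) + 1) = ((n : K) + 1) • a := by
      rw [Algebra.smul_def, map_add, map_natCast, map_one, mul_comm]
    rw [primPoly_monomial, Polynomial.derivative_smul, Polynomial.derivative_monomial]
    simp only [Nat.cast_add, Nat.cast_one, Nat.add_sub_cancel, h2]
    rw [← Polynomial.smul_monomial, smul_smul, inv_mul_cancel₀ h, one_smul]

/-- The polynomial `∑_{i + j = n} bᵢ (-1)ʲ tʲ⁺¹ / (j + 1)!`. -/
noncomputable def conePoly (K : Type*) [Field K] (n : ℕ) : K[X] :=
  ∑ j ∈ Finset.range (n + 1), Polynomial.monomial (j + 1)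
    (coeff (n - j) (coneSeries K) * ((-1) ^ j * ((j + 1).factorial : K)⁻¹))

/-- This is the recursion obeyed by iterates of the negative of `p ↦ ∫₀ᵗ p - t ∫₀¹ p`: the
derivative of the image of `p` is `p` minus a constant. -/
theorem derivative_conePoly_succ (n : ℕ) : Polynomial.derivative (conePoly K (n + 1))
    = Polynomial.C (coeff (n + 1) (coneSeries K)) - conePoly K n := by
  have hf : ∀ j : ℕ, ((j + 1).factorial : K)⁻¹ * ((j + 1 : ℕ) : K) = (j.factorial : K)⁻¹ := by
    intro j
    have e1 : ((j + 1 : ℕ) : K) ≠ 0 := by exact_mod_cast Nat.succ_ne_zero j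
    rw [Nat.factorial_succ, Nat.cast_mul, mul_inv, mul_comm, ← mul_assoc, mul_inv_cancel₀ e1,
      one_mul]
  rw [conePoly, map_sum, Finset.sum_range_succ', sub_eq_neg_add, conePoly,
    ← Finset.sum_neg_distrib]
  congr 1
  · refine Finset.sum_congr rfl fun j _ => ?_
    rw [Polynomial.derivative_monomial, ← map_neg, Nat.add_sub_cancel]
    congr 1
    rw [show n + 1 - (j + 1) = n - j by omega, mul_assoc, mul_assoc, hf, pow_succ]
    ring
  · rw [Polynomial.derivative_monomial]
    simp

theorem eq_of_derivative_eq {p q : K[X]} (h : Polynomial.derivative p = Polynomial.derivative q)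
    (h0 : p.eval 0 = q.eval 0) : p = q := by
  rw [← sub_eq_zero]
  have := Polynomial.eq_C_of_derivative_eq_zero (p := p - q) (by simp [h])
  rw [this, Polynomial.coeff_zero_eq_eval_zero]
  simp [h0]

/-- Both sides vanish at `t = 0`, and their derivatives agree because the coefficient of index `n +
1` of `coneSeries` is by definition the integral over `[0, 1]` of the polynomial of index `n`. -/
theorem homotopyPoly_iterate (n : ℕ) :
    (-1 : K) ^ n • (homotopyPoly K)^[n] Polynomial.X = conePoly K n := by
  induction n with
  | zero => simp [conePoly, coneSeries, Polynomial.monomial_one_one_eq_X]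
  | succ n ih =>
    have hk : (-1 : K) ^ (n + 1) • (homotopyPoly K)^[n + 1] Polynomial.X
        = -homotopyPoly K (conePoly K n) := by
      rw [← ih, Function.iterate_succ_apply', map_smul, pow_succ]
      simp
    have hc : coeff (n + 1) (coneSeries K)
        = Polynomial.aeval (1 : K) (primPoly (K := K) K (conePoly K n)) := by
      rw [← ih, map_smul, map_smul]
      simp [coneSeries, coneCoeff]
    rw [hk]
    refine eq_of_derivative_eq ?_ ?_
    · rw [derivative_conePoly_succ, hc]
      simp only [homotopyPoly, LinearMap.sub_apply, LinearMap.comp_apply, map_neg, map_sub,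
        derivative_primPoly, LinearMap.toSpanSingleton_apply, Polynomial.derivative_smul,
        Polynomial.derivative_X, AlgHom.toLinearMap_apply]
      rw [Polynomial.smul_eq_C_mul, mul_one]
      ring
    · simp only [homotopyPoly, LinearMap.sub_apply, LinearMap.comp_apply,
        LinearMap.toSpanSingleton_apply, Polynomial.eval_neg, Polynomial.eval_sub,
        eval_zero_primPoly, conePoly, Polynomial.eval_finsetSum]
      simp

/-- The operator `homotopyPoly` takes values in polynomials vanishing at `1`. This condition
determines the coefficients of `coneSeries` recursively. -/
theorem eval_one_conePoly (n : ℕ) : (conePoly K n).eval 1 = if n = 0 then 1 else 0 := by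
  cases n with
  | zero => simp [← homotopyPoly_iterate]
  | succ n =>
    rw [← homotopyPoly_iterate, Function.iterate_succ_apply']
    simp [homotopyPoly]

theorem expS_eq : expS K = PowerSeries.exp K := by
  ext n
  simp [expS, PowerSeries.coeff_exp]

/-- The value at `1` of `conePoly K n` is the `n`-th coefficient of `f(z) φ(-z)`, so `f(z) =
1/φ(-z)`; moreover `φ(-z) e^z = φ(z)`. Thus `f(z) = z e^z/(e^z - 1)`, a generating function of
Bernoulli numbers. -/
theorem coneSeries_mul_phiS : coneSeries K * phiS K = expS K := by
  have h1 : coneSeries K * PowerSeries.evalNegHom (phiS K) = 1 := by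
    ext n
    rw [mul_comm, PowerSeries.coeff_mul, Finset.Nat.sum_antidiagonal_eq_sum_range_succ
      (fun i j => coeff i (PowerSeries.evalNegHom (phiS K)) * coeff j (coneSeries K)),
      PowerSeries.coeff_one, ← eval_one_conePoly, conePoly, Polynomial.eval_finsetSum]
    refine Finset.sum_congr rfl fun j _ => ?_
    simp [PowerSeries.evalNegHom, PowerSeries.coeff_rescale, phiS]
    ring
  have h2 : PowerSeries.evalNegHom (phiS K) * expS K = phiS K := by
    have hX : (PowerSeries.X : PowerSeries K) ≠ 0 := PowerSeries.X_ne_zero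
    refine mul_right_cancel₀ hX ?_
    have h3 := congrArg PowerSeries.evalNegHom (phiS_mul_X (K := K))
    rw [map_mul, PowerSeries.evalNegHom_X, map_sub, map_one] at h3
    have h4 := PowerSeries.exp_mul_exp_neg_eq_one (A := K)
    rw [← expS_eq] at h4
    rw [phiS_mul_X]
    linear_combination -h4 - expS K * h3
  rw [← h2, ← mul_assoc, h1, one_mul]

/-- The inverse `z / (e^z - 1)` of the series `(e^z - 1) / z`. -/
noncomputable def phiInv (K : Type*) [Field K] : PowerSeries K := (phiS K)⁻¹

theorem phiInv_mul_phiS : phiInv K * phiS K = 1 :=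
  PowerSeries.inv_mul_cancel _ (by simp [phiS, ← PowerSeries.coeff_zero_eq_constantCoeff_apply])

theorem phiS_mul_phiInv : phiS K * phiInv K = 1 := by rw [mul_comm, phiInv_mul_phiS]

theorem X_pow_succ_dvd_of_derivative {f : PowerSeries K} {n : ℕ}
    (h : PowerSeries.X ^ n ∣ PowerSeries.derivative K f) (h0 : coeff 0 f = 0) :
    PowerSeries.X ^ (n + 1) ∣ f := by
  rw [PowerSeries.X_pow_dvd_iff] at h ⊢
  intro m hm
  cases m with
  | zero => exact h0
  | succ m =>
    have := h m (by omega)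
    rw [PowerSeries.coeff_derivative] at this
    exact (mul_eq_zero.1 this).resolve_right (by exact_mod_cast Nat.succ_ne_zero m)

/-- The partial sums of `ψ(w) = 1 - ∑_{n ≥ 1} (1 - w)ⁿ / (n (n + 1))` at `w = e^z`. -/
noncomputable def psiTrunc (K : Type*) [Field K] (T : ℕ) : PowerSeries K :=
  1 - ∑ k ∈ Finset.range T, ((((k + 1 : ℕ) * (k + 2 : ℕ) : K))⁻¹) • (1 - expS K) ^ (k + 1)

/-- Formally `ψ(w) = w log w/(w - 1)` at `w = e^z` is `z e^z/(e^z - 1)`. This links Poincaré's form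
of the Baker-Campbell-Hausdorff product to the series of the cone. To avoid composing power series,
the truncation is compared by differentiating. In the proof `w` stands for `1 - e^z`. -/
theorem coeff_psiTrunc {T n : ℕ} (hn : n ≤ T) :
    coeff n (psiTrunc K T) = coeff n (coneSeries K) := by
  set w : PowerSeries K := 1 - expS K with hw
  have hw' : PowerSeries.derivative K w = w - 1 := by
    have : PowerSeries.derivative K (expS K) = expS K := by
      rw [expS_eq]; exact PowerSeries.derivative_exp K
    simp [hw, this]
  have hXw : (PowerSeries.X : PowerSeries K) ∣ w :=
    ⟨-phiS K, by linear_combination hw + phiS_mul_X (K := K)⟩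
  have hm0 : ∀ g : PowerSeries K, coeff 0 (w * g) = 0 := fun g => by
    rw [PowerSeries.coeff_mul]; simp [hw, expS]
  have dpow : ∀ k : ℕ, PowerSeries.derivative K (w ^ (k + 1))
      = ((k + 1 : ℕ) : K) • (w ^ k * (w - 1)) := by
    intro k
    rw [Derivation.leibniz_pow, hw', Nat.add_sub_cancel, smul_eq_mul, ← Nat.cast_smul_eq_nsmul K]
  have ne : ∀ k : ℕ, ((k + 1 : ℕ) : K) ≠ 0 := fun k => by exact_mod_cast Nat.succ_ne_zero k
  -- The truncation of `-log(1 - w) = -log(e^z) = -z`; hence `S + X` vanishes to order `T + 1`.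
  set S := ∑ k ∈ Finset.range T, (((k + 1 : ℕ) : K)⁻¹) • w ^ (k + 1) with hS
  have hS' : PowerSeries.derivative K S = w ^ T - 1 := by
    rw [hS, map_sum, ← geom_sum_mul, Finset.sum_mul]
    refine Finset.sum_congr rfl fun k _ => ?_
    rw [Derivation.map_smul, dpow, smul_smul, inv_mul_cancel₀ (ne k), one_smul]
  have hSX : PowerSeries.X ^ (T + 1) ∣ S + PowerSeries.X := by
    refine X_pow_succ_dvd_of_derivative ?_ ?_
    · rw [map_add, hS', PowerSeries.derivative_X, sub_add_cancel]
      exact pow_dvd_pow_of_dvd hXw T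
    · have : ∀ k, coeff 0 (w ^ (k + 1)) = 0 := fun k => by
        rw [pow_succ', hm0]
      rw [map_add, hS, map_sum, PowerSeries.coeff_zero_X, add_zero]
      exact Finset.sum_eq_zero fun k _ => by rw [PowerSeries.coeff_smul, this, smul_zero]
  -- The identity `(e^z - 1) ψ = z e^z` up to order `T + 2`. Its derivative is a multiple of `S +
  -- X`, since `1/((k+1)(k+2))` times the exponent `k + 2` is the coefficient in `S`.
  have hF : PowerSeries.X ^ (T + 1 + 1) ∣ w * psiTrunc K T + PowerSeries.X * expS K := by
    refine X_pow_succ_dvd_of_derivative ?_ ?_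
    · have : PowerSeries.derivative K (w * psiTrunc K T + PowerSeries.X * expS K)
          = (w - 1) * (-(S + PowerSeries.X)) := by
        have h2 : PowerSeries.derivative K (expS K) = 1 - w := by
          rw [← sub_eq_zero, hw] at hw'
          rw [← sub_eq_zero, hw]
          simp only [map_sub, Derivation.map_one_eq_zero] at hw'
          linear_combination -hw'
        have h3 : PowerSeries.derivative K (w * psiTrunc K T) = (w - 1) * (1 - S) := by
          rw [psiTrunc, mul_sub, mul_one, map_sub, hw', Finset.mul_sum, map_sum, mul_sub, mul_one,
            hS, Finset.mul_sum]
          congr 1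
          refine Finset.sum_congr rfl fun k _ => ?_
          rw [mul_smul_comm, ← pow_succ', Derivation.map_smul, dpow, smul_smul, mul_smul_comm,
            mul_comm (w - 1)]
          congr 1
          have e1 := ne k
          have e2 : ((k + 2 : ℕ) : K) ≠ 0 := ne (k + 1)
          rw [mul_inv, mul_assoc, show k + 1 + 1 = k + 2 from rfl, inv_mul_cancel₀ e2, mul_one]
        rw [map_add, h3, Derivation.leibniz, PowerSeries.derivative_X, h2]
        simp only [smul_eq_mul, mul_one]
        linear_combination -hw
      rw [this]
      exact Dvd.dvd.mul_left (hSX.neg_right) _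
    · rw [map_add, hm0, mul_comm, PowerSeries.coeff_zero_mul_X, add_zero]
  have h1 : PowerSeries.X ^ (T + 1) ∣ phiS K * psiTrunc K T - expS K := by
    obtain ⟨r, hr⟩ := hF
    refine ⟨-r, mul_left_cancel₀ (PowerSeries.X_ne_zero (R := K)) ?_⟩
    linear_combination psiTrunc K T * hw + psiTrunc K T * phiS_mul_X (K := K) - hr
  have h2 : PowerSeries.X ^ (T + 1) ∣ psiTrunc K T - coneSeries K := by
    have e : psiTrunc K T - coneSeries K
        = phiInv K * (phiS K * psiTrunc K T - expS K) := by
      linear_combination (coneSeries K - psiTrunc K T) * phiInv_mul_phiS (K := K)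
        - phiInv K * coneSeries_mul_phiS (K := K)
    rw [e]
    exact h1.mul_left _
  rw [PowerSeries.X_pow_dvd_iff] at h2
  have := h2 n (by omega)
  rwa [map_sub, sub_eq_zero] at this

end Coefficients

/-! ### Differential graded Lie algebras with extended scalars -/

section ExtSubspace

variable {K : Type*} [Field K] {R : Type*} [CommRing R] [Algebra K R]
  {V : Type*} [AddCommGroup V] [Module K V]

theorem tmul_mem_ext {I : Ideal R} {W : Submodule K V} {a : R} (ha : a ∈ I) {x : V} (hx : x ∈ W) :
    a ⊗ₜ[K] x ∈ ext I W := Submodule.subset_span ⟨a, ha, x, hx, rfl⟩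

/-- Scalars can be absorbed into the ideal factor, so sums of pure tensors suffice and no case for
scalar multiples is needed. -/
theorem ext_induction {I : Ideal R} {W : Submodule K V} {p : ∀ z : R ⊗[K] V, z ∈ ext I W → Prop}
    (h0 : p 0 (Submodule.zero_mem _))
    (hadd : ∀ x y hx hy, p x hx → p y hy → p (x + y) (Submodule.add_mem _ hx hy))
    (ht : ∀ a (ha : a ∈ I) x (hx : x ∈ W), p (a ⊗ₜ[K] x) (tmul_mem_ext ha hx))
    {z : R ⊗[K] V} (hz : z ∈ ext I W) : p z hz := by
  have hz' := hz
  rw [ext, Submodule.mem_span_iff_exists_finset_subset] at hz'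
  obtain ⟨f, t, ht', -, rfl⟩ := hz'
  suffices h : ∃ h, p (∑ a ∈ t, f a • a) h from h.2
  refine Finset.sum_induction _ (fun z => ∃ h, p z h) ?_ ⟨_, h0⟩ fun y hy => ?_
  · rintro x y ⟨hx, hx'⟩ ⟨hy, hy'⟩
    exact ⟨_, hadd x y hx hy hx' hy'⟩
  obtain ⟨a, ha, x, hx, rfl⟩ := ht' hy
  rw [TensorProduct.smul_tmul']
  exact ⟨_, ht _ (by rw [Algebra.smul_def]; exact I.mul_mem_left _ ha) x hx⟩

theorem ext_le_top {I : Ideal R} {W : Submodule K V} : ext I W ≤ ext I (⊤ : Submodule K V) :=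
  ext_mono le_rfl le_top

theorem smul_mem_ext_self {I : Ideal R} {W : Submodule K V} (r : R) {z : R ⊗[K] V}
    (hz : z ∈ ext I W) : r • z ∈ ext I W := by
  have := smul_mem_ext (I := ⊤) (r := r) trivial hz
  rwa [Ideal.top_mul] at this

theorem rTensor_mem_ext {S : Type*} [CommRing S] [Algebra K S] (f : R →ₗ[K] S) {I : Ideal R}
    {J : Ideal S} (h : ∀ a ∈ I, f a ∈ J) {W : Submodule K V} {z : R ⊗[K] V} (hz : z ∈ ext I W) :
    LinearMap.rTensor V f z ∈ ext J W := by
  induction hz using ext_induction with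
  | h0 => simp
  | hadd x y _ _ hx hy => rw [map_add]; exact Submodule.add_mem _ hx hy
  | ht a ha x hx => exact tmul_mem_ext (h a ha) hx

end ExtSubspace

/-! ### Calculus on polynomial paths. -/

section PolynomialPaths

variable {K : Type*} [Field K] {R : Type*} [CommRing R] [Algebra K R]
  {V : Type*} [AddCommGroup V] [Module K V]

theorem deriv_mem {I : Ideal R} {W : Submodule K V} {z : R[X] ⊗[K] V}
    (hz : z ∈ ext (I.map (Polynomial.C : R →+* R[X])) W) :
    deriv R V z ∈ ext (I.map (Polynomial.C : R →+* R[X])) W := by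
  refine rTensor_mem_ext _ (fun a ha => ?_) hz
  rw [Ideal.mem_map_C_iff] at ha ⊢
  intro n
  simpa [Polynomial.coeff_derivative] using I.mul_mem_right _ (ha (n + 1))

theorem prim_mem {I : Ideal R} {W : Submodule K V} {z : R[X] ⊗[K] V}
    (hz : z ∈ ext (I.map (Polynomial.C : R →+* R[X])) W) :
    prim R V z ∈ ext (I.map (Polynomial.C : R →+* R[X])) W := by
  refine rTensor_mem_ext _ (fun a ha => ?_) hz
  rw [Ideal.mem_map_C_iff] at ha
  rw [primPoly, Polynomial.lsum_apply, Polynomial.sum]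
  refine Ideal.sum_mem _ fun n _ => ?_
  rw [LinearMap.smul_apply, LinearMap.restrictScalars_apply, Algebra.smul_def]
  refine Ideal.mul_mem_left _ _ ?_
  rw [Ideal.mem_map_C_iff]
  intro m
  rw [Polynomial.coeff_monomial]
  split_ifs
  · exact ha n
  · exact I.zero_mem

theorem evalAt_mem {I : Ideal R} {W : Submodule K V} (r : R) {z : R[X] ⊗[K] V}
    (hz : z ∈ ext (I.map (Polynomial.C : R →+* R[X])) W) : evalAt R V r z ∈ ext I W := by
  refine push_mem_ext _ (fun a ha => ?_) hz
  rw [Ideal.mem_map_C_iff] at ha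
  change Polynomial.aeval r a ∈ I
  rw [Polynomial.aeval_eq_sum_range]
  exact Ideal.sum_mem _ fun n _ => I.mul_mem_right _ (ha n)

theorem evalAt_const (r : R) (z : R ⊗[K] V) : evalAt R V r (const R V z) = z := by
  induction z with
  | zero => simp
  | add x y hx hy => simp only [map_add, hx, hy]
  | tmul s x => simp [evalAt, const, push_tmul]

theorem deriv_const (z : R ⊗[K] V) : deriv R V (const R V z) = 0 := by
  induction z with
  | zero => simp
  | add x y hx hy => simp only [map_add, hx, hy, add_zero]
  | tmul s x => simp [deriv, const, push_tmul]

theorem evalAt_smul (r : R) (p : R[X]) (z : R[X] ⊗[K] V) :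
    evalAt R V r (p • z) = p.eval r • evalAt R V r z := by
  rw [evalAt, push_smul]
  simp

theorem deriv_smul (p : R[X]) (z : R[X] ⊗[K] V) :
    deriv R V (p • z) = Polynomial.derivative p • z + p • deriv R V z := by
  induction z with
  | zero => simp
  | add x y hx hy => simp only [map_add, smul_add, hx, hy]; abel
  | tmul s x =>
    simp [deriv, TensorProduct.smul_tmul', TensorProduct.add_tmul]

theorem evalAt_zero_prim (z : R[X] ⊗[K] V) : evalAt R V 0 (prim R V z) = 0 := by
  induction z with
  | zero => simp
  | add x y hx hy => simp only [map_add, hx, hy, add_zero]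
  | tmul s x =>
    change Polynomial.aeval (0 : R) (primPoly (K := K) R s) ⊗ₜ[K] x = 0
    rw [Polynomial.coe_aeval_eq_eval, eval_zero_primPoly, TensorProduct.zero_tmul]

theorem evalAt_baseChange {V' : Type*} [AddCommGroup V'] [Module K V'] (f : V →ₗ[K] V') (r : R)
    (z : R[X] ⊗[K] V) : evalAt R V' r (f.baseChange R[X] z) = f.baseChange R (evalAt R V r z) :=
  push_baseChange _ _ _

theorem const_baseChange {V' : Type*} [AddCommGroup V'] [Module K V'] (f : V →ₗ[K] V')
    (z : R ⊗[K] V) : f.baseChange R[X] (const R V z) = const R V' (f.baseChange R z) :=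
  (push_baseChange _ _ _).symm

theorem deriv_baseChange {V' : Type*} [AddCommGroup V'] [Module K V'] (f : V →ₗ[K] V')
    (z : R[X] ⊗[K] V) : deriv R V' (f.baseChange R[X] z) = f.baseChange R[X] (deriv R V z) := by
  induction z with
  | zero => simp
  | add x y hx hy => simp only [map_add, hx, hy]
  | tmul s x => simp [deriv]

variable [CharZero K]

theorem deriv_prim (z : R[X] ⊗[K] V) : deriv R V (prim R V z) = z := by
  induction z with
  | zero => simp
  | add x y hx hy => simp only [map_add, hx, hy]
  | tmul s x =>
    change Polynomial.derivative (primPoly (K := K) R s) ⊗ₜ[K] x = _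
    rw [derivative_primPoly]

theorem prim_deriv (z : R[X] ⊗[K] V) :
    prim R V (deriv R V z) = z - const R V (evalAt R V 0 z) := by
  induction z with
  | zero => simp
  | add x y hx hy => simp only [map_add, hx, hy]; abel
  | tmul s x =>
    change primPoly (K := K) R (Polynomial.derivative s) ⊗ₜ[K] x
      = s ⊗ₜ[K] x - Polynomial.C (Polynomial.aeval (0 : R) s) ⊗ₜ[K] x
    rw [← TensorProduct.sub_tmul]
    congr 1
    induction s using Polynomial.induction_on' with
    | add p q hp hq => simp only [map_add, hp, hq]; abel
    | monomial n a =>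
      cases n with
      | zero => simp
      | succ n =>
        have h : ((n : K) + 1) ≠ 0 := by exact_mod_cast Nat.succ_ne_zero n
        have h2 : a * ((n : R) + 1) = ((n : K) + 1) • a := by
          rw [Algebra.smul_def, map_add, map_natCast, map_one, mul_comm]
        rw [Polynomial.derivative_monomial, primPoly_monomial]
        simp only [Nat.cast_add, Nat.cast_one, Nat.add_sub_cancel, h2]
        rw [← Polynomial.smul_monomial, smul_smul, inv_mul_cancel₀ h, one_smul]
        simp [Polynomial.aeval_monomial]

theorem eq_const_of_deriv_eq_zero {z : R[X] ⊗[K] V} (h : deriv R V z = 0) :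
    z = const R V (evalAt R V 0 z) := by
  have := prim_deriv z
  rw [h, map_zero] at this
  exact (sub_eq_zero.1 this.symm)

theorem integral_deriv (z : R[X] ⊗[K] V) :
    integral R V (deriv R V z) = evalAt R V 1 z - evalAt R V 0 z := by
  rw [integral, LinearMap.comp_apply, prim_deriv, map_sub, evalAt_const]

end PolynomialPaths

/-! ### Bracket and differential after extension of scalars. -/

section Brackets

variable {K : Type*} [Field K] {M : Type*} [AddCommGroup M] [Module K M] (𝓜 : DGLA K M)

theorem DGLA.induction_gr {p : M → Prop} (hadd : ∀ x y, p x → p y → p (x + y)) (h0 : p 0)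
    (h : ∀ i, ∀ x ∈ 𝓜.gr i, p x) (x : M) : p x := by
  have hx : x ∈ ⨆ i, 𝓜.gr i := by
    rw [𝓜.isInternal.submodule_iSup_eq_top]; trivial
  exact Submodule.iSup_induction _ (motive := p) hx h h0 hadd

/-- With `x` of degree `0` every Koszul sign is trivial, so the identity is linear in `y` and
extends to inhomogeneous elements. -/
theorem DGLA.jacobi_zero {x : M} (hx : x ∈ 𝓜.gr 0) (y z : M) :
    𝓜.bracket x (𝓜.bracket y z)
      = 𝓜.bracket (𝓜.bracket x y) z + 𝓜.bracket y (𝓜.bracket x z) := by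
  induction y using 𝓜.induction_gr with
  | hadd y y' h h' => simp only [map_add, LinearMap.add_apply, h, h']; abel
  | h0 => simp
  | h j y hy => simpa using 𝓜.jacobi 0 j x hx y hy z

theorem DGLA.skew_zero {x : M} (hx : x ∈ 𝓜.gr 0) (y : M) :
    𝓜.bracket x y = -𝓜.bracket y x := by
  induction y using 𝓜.induction_gr with
  | hadd y y' h h' => simp only [map_add, LinearMap.add_apply, h, h']; abel
  | h0 => simp
  | h j y hy => simpa using 𝓜.bracket_skew 0 j x hx y hy

theorem DGLA.leibniz_zero {x : M} (hx : x ∈ 𝓜.gr 0) (y : M) :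
    𝓜.d (𝓜.bracket x y) = 𝓜.bracket (𝓜.d x) y + 𝓜.bracket x (𝓜.d y) := by
  simpa using 𝓜.leibniz 0 x hx y

theorem DGLA.bracket_comm_of_odd {i j : ℤ} (hij : Odd (i * j)) {x y : M} (hx : x ∈ 𝓜.gr i)
    (hy : y ∈ 𝓜.gr j) : 𝓜.bracket x y = 𝓜.bracket y x := by
  simpa [Int.negOnePow_odd _ hij] using 𝓜.bracket_skew i j x hx y hy

variable {S : Type*} [CommRing S] [Algebra K S]

theorem DGLA.bracketR_tmul (r s : S) (x y : M) :
    𝓜.bracketR S (r ⊗ₜ[K] x) (s ⊗ₜ[K] y) = (r * s) ⊗ₜ[K] 𝓜.bracket x y := by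
  simp [DGLA.bracketR]

theorem DGLA.dR_tmul (r : S) (x : M) : 𝓜.dR S (r ⊗ₜ[K] x) = r ⊗ₜ[K] 𝓜.d x := by
  simp [DGLA.dR]

/-- `ad u` as a `K`-linear endomorphism. -/
noncomputable def DGLA.adR : S ⊗[K] M →ₗ[K] Module.End K (S ⊗[K] M) where
  toFun u := (𝓜.bracketR S u).restrictScalars K
  map_add' u v := by ext; simp
  map_smul' c u := by
    refine LinearMap.ext fun z => ?_
    simp [LinearMap.map_smul_of_tower]

theorem DGLA.adR_apply (u z : S ⊗[K] M) : 𝓜.adR u z = 𝓜.bracketR S u z := rfl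

theorem DGLA.adR_smul (r : S) (u z : S ⊗[K] M) : 𝓜.adR (r • u) z = r • 𝓜.adR u z := by
  simp [adR_apply]

theorem DGLA.adR_smul_right (r : S) (u z : S ⊗[K] M) : 𝓜.adR u (r • z) = r • 𝓜.adR u z := by
  simp [adR_apply]

theorem DGLA.adR_pow_apply (u z : S ⊗[K] M) (n : ℕ) :
    (𝓜.adR u ^ n) z = (𝓜.bracketR S u)^[n] z := by
  rw [Module.End.pow_apply]; rfl

theorem DGLA.adR_jacobi {u : S ⊗[K] M} (hu : u ∈ ext (⊤ : Ideal S) (𝓜.gr 0)) (v z : S ⊗[K] M) :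
    𝓜.adR u (𝓜.adR v z) = 𝓜.adR (𝓜.adR u v) z + 𝓜.adR v (𝓜.adR u z) := by
  induction hu using ext_induction with
  | h0 => simp
  | hadd x y _ _ hx hy => simp only [map_add, LinearMap.add_apply, hx, hy]; abel
  | ht a _ x hx =>
    induction v with
    | zero => simp
    | add v v' h h' => simp only [map_add, LinearMap.add_apply, h, h']; abel
    | tmul r v =>
      induction z with
      | zero => simp
      | add z z' h h' => simp only [map_add, h, h']; abel
      | tmul s z =>
        simp only [adR_apply, bracketR_tmul, 𝓜.jacobi_zero hx, TensorProduct.tmul_add]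
        rw [mul_assoc, mul_left_comm]

theorem DGLA.adR_skew {u : S ⊗[K] M} (hu : u ∈ ext (⊤ : Ideal S) (𝓜.gr 0)) (v : S ⊗[K] M) :
    𝓜.adR u v = -𝓜.adR v u := by
  induction hu using ext_induction with
  | h0 => simp
  | hadd x y _ _ hx hy => simp only [map_add, LinearMap.add_apply, hx, hy]; abel
  | ht a _ x hx =>
    induction v with
    | zero => simp
    | add v v' h h' => simp only [map_add, LinearMap.add_apply, h, h']; abel
    | tmul r v =>
      simp only [adR_apply, bracketR_tmul, 𝓜.skew_zero hx v, TensorProduct.tmul_neg]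
      rw [mul_comm]

theorem DGLA.adR_self [CharZero K] {u : S ⊗[K] M} (hu : u ∈ ext (⊤ : Ideal S) (𝓜.gr 0)) :
    𝓜.adR u u = 0 := by
  have h := 𝓜.adR_skew hu u
  have : (2 : K) • 𝓜.adR u u = 0 := by
    rw [two_smul]; nth_rewrite 1 [h]; simp
  exact (smul_eq_zero.1 this).resolve_left two_ne_zero

theorem DGLA.adR_comm_of_odd {i j : ℤ} (hij : Odd (i * j)) {u v : S ⊗[K] M}
    (hu : u ∈ ext (⊤ : Ideal S) (𝓜.gr i)) (hv : v ∈ ext (⊤ : Ideal S) (𝓜.gr j)) :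
    𝓜.adR u v = 𝓜.adR v u := by
  induction hu using ext_induction with
  | h0 => simp
  | hadd x y _ _ hx hy => simp only [map_add, LinearMap.add_apply, hx, hy]
  | ht a _ x hx =>
    induction hv using ext_induction with
    | h0 => simp
    | hadd v v' _ _ h h' => simp only [map_add, LinearMap.add_apply, h, h']
    | ht r _ v hv =>
      simp only [adR_apply, bracketR_tmul, 𝓜.bracket_comm_of_odd hij hx hv]
      rw [mul_comm]

theorem DGLA.dR_adR {u : S ⊗[K] M} (hu : u ∈ ext (⊤ : Ideal S) (𝓜.gr 0)) (v : S ⊗[K] M) :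
    𝓜.dR S (𝓜.adR u v) = 𝓜.adR (𝓜.dR S u) v + 𝓜.adR u (𝓜.dR S v) := by
  induction hu using ext_induction with
  | h0 => simp
  | hadd x y _ _ hx hy => simp only [map_add, LinearMap.add_apply, hx, hy]; abel
  | ht a _ x hx =>
    induction v with
    | zero => simp
    | add v v' h h' => simp only [map_add, h, h']; abel
    | tmul r v =>
      simp only [adR_apply, bracketR_tmul, dR_tmul, 𝓜.leibniz_zero hx, TensorProduct.tmul_add]

theorem DGLA.dR_dR (z : S ⊗[K] M) : 𝓜.dR S (𝓜.dR S z) = 0 := by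
  induction z with
  | zero => simp
  | add v v' h h' => simp only [map_add, h, h', add_zero]
  | tmul r v => simp [dR_tmul, 𝓜.d_d]

theorem DGLA.adR_mem {I J : Ideal S} {i j k : ℤ} (hk : i + j = k) {u v : S ⊗[K] M}
    (hu : u ∈ ext I (𝓜.gr i)) (hv : v ∈ ext J (𝓜.gr j)) :
    𝓜.adR u v ∈ ext (I * J) (𝓜.gr k) := by
  subst hk
  induction hu using ext_induction with
  | h0 => simp
  | hadd x y _ _ hx hy => rw [map_add, LinearMap.add_apply]; exact Submodule.add_mem _ hx hy
  | ht a ha x hx =>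
    induction hv using ext_induction with
    | h0 => simp
    | hadd v v' _ _ h h' => rw [map_add]; exact Submodule.add_mem _ h h'
    | ht r hr v hv =>
      rw [adR_apply, bracketR_tmul]
      exact tmul_mem_ext (Ideal.mul_mem_mul ha hr) (𝓜.bracket_mem _ _ _ hx _ hv)

theorem DGLA.dR_mem {I : Ideal S} {i j : ℤ} (hj : i + 1 = j) {u : S ⊗[K] M}
    (hu : u ∈ ext I (𝓜.gr i)) : 𝓜.dR S u ∈ ext I (𝓜.gr j) := by
  subst hj
  exact baseChange_mem_ext _ (𝓜.d_mem i) hu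

theorem DGLA.adR_pow_eq_zero {I : Ideal S} {N : ℕ} (hI : I ^ N = ⊥) {u : S ⊗[K] M}
    (hu : u ∈ ext I (⊤ : Submodule K M)) : 𝓜.adR u ^ N = 0 := by
  refine LinearMap.ext fun z => ?_
  rw [adR_pow_apply, ad_iterate_eq_zero 𝓜 hI hu z le_rfl]
  rfl

theorem DGLA.adR_isNilpotent {I : Ideal S} (hI : IsNilpotent I) {u : S ⊗[K] M}
    (hu : u ∈ ext I (⊤ : Submodule K M)) : IsNilpotent (𝓜.adR u) := by
  obtain ⟨N, hN⟩ := hI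
  exact ⟨N, 𝓜.adR_pow_eq_zero hN hu⟩

theorem DGLA.Hom.map_adR {L : Type*} [AddCommGroup L] [Module K L] {𝓛 : DGLA K L} {𝓜 : DGLA K M}
    (χ : DGLA.Hom 𝓛 𝓜) (u v : S ⊗[K] L) : χ.toLin.baseChange S (𝓛.adR u v)
      = 𝓜.adR (χ.toLin.baseChange S u) (χ.toLin.baseChange S v) := by
  induction u with
  | zero => simp
  | add u u' h h' => simp only [map_add, LinearMap.add_apply, h, h']
  | tmul r u =>
    induction v with
    | zero => simp
    | add u u' h h' => simp only [map_add, h, h']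
    | tmul s v => simp [DGLA.adR_apply, DGLA.bracketR_tmul, χ.map_bracket]

theorem DGLA.Hom.map_dR {L : Type*} [AddCommGroup L] [Module K L] {𝓛 : DGLA K L} {𝓜 : DGLA K M}
    (χ : DGLA.Hom 𝓛 𝓜) (u : S ⊗[K] L) :
    χ.toLin.baseChange S (𝓛.dR S u) = 𝓜.dR S (χ.toLin.baseChange S u) := by
  induction u with
  | zero => simp
  | add u u' h h' => simp only [map_add, h, h']
  | tmul r u => simp [DGLA.dR_tmul, χ.map_d]

theorem rTensor_derivation_adR (D : Derivation K S S) (u v : S ⊗[K] M) :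
    LinearMap.rTensor M (D : S →ₗ[K] S) (𝓜.adR u v)
      = 𝓜.adR (LinearMap.rTensor M (D : S →ₗ[K] S) u) v
        + 𝓜.adR u (LinearMap.rTensor M (D : S →ₗ[K] S) v) := by
  induction u with
  | zero => simp
  | add u u' h h' => simp only [map_add, LinearMap.add_apply, h, h']; abel
  | tmul r u =>
    induction v with
    | zero => simp
    | add u u' h h' => simp only [map_add, h, h']; abel
    | tmul s v =>
      simp only [DGLA.adR_apply, DGLA.bracketR_tmul, LinearMap.rTensor_tmul]
      simp only [Derivation.coeFn_coe, Derivation.leibniz, smul_eq_mul]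
      rw [← TensorProduct.add_tmul, add_comm, mul_comm s]

theorem deriv_adR {R : Type*} [CommRing R] [Algebra K R] (u v : R[X] ⊗[K] M) :
    deriv R M (𝓜.adR u v) = 𝓜.adR (deriv R M u) v + 𝓜.adR u (deriv R M v) := by
  induction u with
  | zero => simp
  | add u u' h h' => simp only [map_add, LinearMap.add_apply, h, h']; abel
  | tmul r u =>
    induction v with
    | zero => simp
    | add u u' h h' => simp only [map_add, h, h']; abel
    | tmul s v =>
      simp only [DGLA.adR_apply, DGLA.bracketR_tmul, deriv, LinearMap.rTensor_tmul,
        LinearMap.restrictScalars_apply, Polynomial.derivative_mul, TensorProduct.add_tmul]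

end Brackets

/-! ### Exponentials of adjoint operators -/

section Apply

variable {K : Type*} [Field K] {V : Type*} [AddCommGroup V] [Module K V]

theorem nilEval_apply {A : Module.End K V} {N : ℕ} (hA : A ^ N = 0) (f : PowerSeries K) (z : V) :
    nilEval A f z = ∑ n ∈ Finset.range N, PowerSeries.coeff n f • (A ^ n) z := by
  simp [nilEval_eq_sum hA, LinearMap.sum_apply]

theorem finsum_eq_nilEval {A : Module.End K V} (hA : IsNilpotent A) (f : PowerSeries K) (z : V) :
    ∑ᶠ n, PowerSeries.coeff n f • (A ^ n) z = nilEval A f z := by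
  obtain ⟨N, hN⟩ := hA
  rw [nilEval_apply hN]
  refine finsum_eq_sum_of_support_subset _ fun n hn => ?_
  by_contra h'
  exact hn (by simp only [pow_eq_zero_of_le (by simpa using h' : N ≤ n) hN, LinearMap.zero_apply,
    smul_zero])

theorem nilEval_mul_apply {A : Module.End K V} (hA : IsNilpotent A) (f g : PowerSeries K) (z : V) :
    nilEval A (f * g) z = nilEval A f (nilEval A g z) :=
  LinearMap.congr_fun (nilEval_mul (E := Module.End K V) hA f g) z

theorem nilEval_smul_apply {A : Module.End K V} (hA : IsNilpotent A) (c : K) (f : PowerSeries K)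
    (z : V) : nilEval A (c • f) z = c • nilEval A f z :=
  LinearMap.congr_fun (nilEval_smul (E := Module.End K V) hA c f) z

theorem nilEval_mem {A : Module.End K V} (hA : IsNilpotent A) (f : PowerSeries K)
    {W : Submodule K V} (hW : ∀ z ∈ W, A z ∈ W) {z : V} (hz : z ∈ W) : nilEval A f z ∈ W := by
  obtain ⟨N, hN⟩ := hA
  rw [nilEval_apply hN]
  refine Submodule.sum_mem _ fun n hn => Submodule.smul_mem _ _ ?_
  clear hn
  induction n with
  | zero => exact hz
  | succ n ih => rw [pow_succ']; exact hW _ ih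

/-- A linear map which intertwines two nilpotent operators intertwines their power series. -/
theorem nilEval_intertwine {V' : Type*} [AddCommGroup V'] [Module K V'] {A : Module.End K V}
    {A' : Module.End K V'} (hA : IsNilpotent A) (hA' : IsNilpotent A') (g : V →ₗ[K] V')
    {P : V → Prop} (hP : ∀ z, P z → P (A z)) (h : ∀ z, P z → g (A z) = A' (g z))
    (f : PowerSeries K) {z : V} (hz : P z) : g (nilEval A f z) = nilEval A' f (g z) := by
  obtain ⟨N, hN⟩ := hA
  obtain ⟨N', hN'⟩ := hA'
  rw [nilEval_apply (pow_eq_zero_of_le (Nat.le_add_right N N') hN),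
    nilEval_apply (pow_eq_zero_of_le (Nat.le_add_left N' N) hN'), map_sum]
  refine Finset.sum_congr rfl fun n hn => ?_
  clear hn
  have key : P ((A ^ n) z) ∧ g ((A ^ n) z) = (A' ^ n) (g z) := by
    induction n with
    | zero => exact ⟨hz, rfl⟩
    | succ n ih =>
      rw [pow_succ', pow_succ']
      exact ⟨hP _ ih.1, by simp only [Module.End.mul_apply, h _ ih.1, ih.2]⟩
  rw [map_smul, key.2]

theorem nilEval_apply_of_apply_eq_zero {A : Module.End K V} {f : PowerSeries K}
    (hA : IsNilpotent A) {z : V} (hz : A z = 0) :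
    nilEval A f z = PowerSeries.coeff 0 f • z := by
  obtain ⟨N, hN⟩ := hA
  rw [nilEval_apply (pow_eq_zero_of_le (Nat.le_succ N) hN), Finset.sum_range_succ']
  simp [pow_succ, hz]

theorem adOp_isNilpotent {E : Type*} [Ring E] [Algebra K E] {A : E} (hA : IsNilpotent A) :
    IsNilpotent (adOp K A) := by
  obtain ⟨N, hN⟩ := hA
  exact ⟨_, adOp_pow_eq_zero hN⟩

/-- By Duhamel's formula the commutator `[B, e^A]` is `-φ(ad_A)([A, B]) e^A`, and `φ(z) z = e^z -
1`. -/
theorem conj_expS [CharZero K] {E : Type*} [Ring E] [Algebra K E] {A : E} (hA : IsNilpotent A)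
    (B : E) : nilEval A (expS K) * B = nilEval (adOp K A) (expS K) B * nilEval A (expS K) := by
  have h := commutator_nilEval hA B (expS K)
  have hn := adOp_isNilpotent (K := K) hA
  have e : B * A - A * B = -adOp K A B := by rw [adOp_apply]; abel
  have h2 : nilEval (adOp K A) (phiS K) (adOp K A B) = nilEval (adOp K A) (expS K) B - B := by
    have := congrArg (fun T : Module.End K E => T B) (nilEval_mul hn (phiS K) PowerSeries.X)
    rw [nilEval_X, phiS_mul_X, nilEval_sub hn, nilEval_one] at this
    exact this.symm
  rw [linEval_expS hA, e, map_neg, h2] at h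
  rw [eq_sub_of_add_eq h.symm]
  noncomm_ring

theorem nilEval_neg_mul_expS [CharZero K] {E : Type*} [Ring E] [Algebra K E] {A : E}
    (hA : IsNilpotent A) : nilEval (-A) (expS K) * nilEval A (expS K) = 1 := by
  have h : nilEval (-A) (expS K) = nilEval A (PowerSeries.evalNegHom (expS K)) := by
    refine finsum_congr fun n => ?_
    rw [PowerSeries.evalNegHom, PowerSeries.coeff_rescale, neg_pow A, ← smul_smul, smul_comm]
    congr 1
    rcases Nat.even_or_odd n with h | h
    · simp [h.neg_one_pow]
    · simp [h.neg_one_pow]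
  rw [h, ← nilEval_mul hA, expS_eq, mul_comm, PowerSeries.exp_mul_exp_neg_eq_one, nilEval_one]

/-- Here `g` plays the role of a representation, in which `A` acts by commutators as `B` does on
`V`. The predicate `P` restricts to the degrees in which this commutation relation is available. -/
theorem nilEval_adOp_intertwine {E : Type*} [Ring E] [Algebra K E] {A : E} (hA : IsNilpotent A)
    {B : Module.End K V} (hB : IsNilpotent B) (g : V →ₗ[K] E) {P : V → Prop}
    (hP : ∀ z, P z → P (B z)) (h : ∀ z, P z → A * g z - g z * A = g (B z)) (f : PowerSeries K)
    {v : V} (hv : P v) : nilEval (adOp K A) f (g v) = g (nilEval B f v) :=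
  (nilEval_intertwine hB (adOp_isNilpotent hA) g hP (fun z hz => (h z hz).symm) f hv).symm

/-- `e^A v = (e^{ad_A} v) e^A`. -/
theorem exp_mul_eq [CharZero K] {E : Type*} [Ring E] [Algebra K E] {A : E} (hA : IsNilpotent A)
    {B : Module.End K V} (hB : IsNilpotent B) (g : V →ₗ[K] E) {P : V → Prop}
    (hP : ∀ z, P z → P (B z)) (h : ∀ z, P z → A * g z - g z * A = g (B z)) {v : V} (hv : P v) :
    nilEval A (expS K) * g v = g (nilEval B (expS K) v) * nilEval A (expS K) := by
  rw [conj_expS hA, nilEval_adOp_intertwine hA hB g hP h _ hv]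

/-- Duhamel's formula for the linear part of `e^{A + g(v)}`. -/
theorem linEval_exp_eq [CharZero K] {E : Type*} [Ring E] [Algebra K E] {A : E}
    (hA : IsNilpotent A) {B : Module.End K V} (hB : IsNilpotent B) (g : V →ₗ[K] E) {P : V → Prop}
    (hP : ∀ z, P z → P (B z)) (h : ∀ z, P z → A * g z - g z * A = g (B z)) {v : V} (hv : P v) :
    linEval A (g v) (expS K) = g (nilEval B (phiS K) v) * nilEval A (expS K) := by
  rw [linEval_expS hA, nilEval_adOp_intertwine hA hB g hP h _ hv]

end Apply

/-! ### The affine representation attached to a derivation. -/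

section AffineRepresentation

variable {K : Type*} [Field K] {M : Type*} [AddCommGroup M] [Module K M] (𝓜 : DGLA K M)
  {S : Type*} [CommRing S] [Algebra K S]

/-- Linear maps which satisfy the Leibniz rule for brackets with elements of degree zero. -/
def DGLA.IsDer (δ : S ⊗[K] M →ₗ[K] S ⊗[K] M) : Prop :=
  ∀ u ∈ ext (⊤ : Ideal S) (𝓜.gr 0), ∀ z, δ (𝓜.adR u z) = 𝓜.adR (δ u) z + 𝓜.adR u (δ z)

variable (δ : S ⊗[K] M →ₗ[K] S ⊗[K] M)

/-- The operator `(z, c) ↦ ([u, z] - c δ(u), 0)`: the adjoint action of `u` after adjunction of an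
element `δ` with `[δ, z] = δ(z)`. -/
noncomputable def DGLA.affine (u : S ⊗[K] M) : Module.End K ((S ⊗[K] M) × K) :=
  (𝓜.adR u ∘ₗ LinearMap.fst K _ _
    - LinearMap.toSpanSingleton K _ (δ u) ∘ₗ LinearMap.snd K _ _).prod 0

theorem DGLA.affine_apply (u : S ⊗[K] M) (x : (S ⊗[K] M) × K) :
    𝓜.affine δ u x = (𝓜.adR u x.1 - x.2 • δ u, 0) := rfl

theorem DGLA.affine_neg (u : S ⊗[K] M) : 𝓜.affine δ (-u) = -𝓜.affine δ u := by
  refine LinearMap.ext fun x => ?_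
  simp only [affine_apply, map_neg, LinearMap.neg_apply, smul_neg, Prod.neg_mk, neg_zero]
  congr 1
  abel

theorem DGLA.affine_pow_succ (u : S ⊗[K] M) (n : ℕ) (x : (S ⊗[K] M) × K) :
    (𝓜.affine δ u ^ (n + 1)) x
      = ((𝓜.adR u ^ (n + 1)) x.1 - x.2 • (𝓜.adR u ^ n) (δ u), 0) := by
  induction n with
  | zero => simp [affine_apply]
  | succ n ih =>
    rw [pow_succ', Module.End.mul_apply, ih, affine_apply]
    rw [pow_succ' _ (n + 1), Module.End.mul_apply, pow_succ' _ n, Module.End.mul_apply]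
    simp

theorem DGLA.affine_isNilpotent {u : S ⊗[K] M} (hu : IsNilpotent (𝓜.adR u)) :
    IsNilpotent (𝓜.affine δ u) := by
  obtain ⟨N, hN⟩ := hu
  refine ⟨N + 1, LinearMap.ext fun x => ?_⟩
  rw [affine_pow_succ, hN, pow_succ, hN]
  simp

/-- The logarithmic derivative `δ(e^u) e^{-u} = ∑ ad_u^n δ(u) / (n + 1)!`. -/
noncomputable def DGLA.logDer (u : S ⊗[K] M) : S ⊗[K] M := nilEval (𝓜.adR u) (phiS K) (δ u)

/-- The coefficient of `exp` at `n + 1` is that of `φ` at `n`, which produces the logarithmic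
derivative. Scalar component `0` gives the adjoint action, scalar `1` with `δ = d` the gauge action,
and the vector `(0, 1)` the logarithmic derivative alone. -/
theorem DGLA.exp_affine {u : S ⊗[K] M} (hu : IsNilpotent (𝓜.adR u)) (x : (S ⊗[K] M) × K) :
    nilEval (𝓜.affine δ u) (expS K) x
      = (nilEval (𝓜.adR u) (expS K) x.1 - x.2 • 𝓜.logDer δ u, x.2) := by
  obtain ⟨N, hN⟩ := hu
  have hN' : 𝓜.adR u ^ (N + 1) = 0 := pow_eq_zero_of_le (Nat.le_succ N) hN
  have hN2 : 𝓜.affine δ u ^ (N + 1) = 0 := by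
    refine LinearMap.ext fun x => ?_
    rw [affine_pow_succ, hN, hN']
    simp
  rw [nilEval_apply hN2, logDer, nilEval_apply hN', nilEval_apply hN, Finset.sum_range_succ',
    Finset.sum_range_succ' (fun n => PowerSeries.coeff n (expS K) • (𝓜.adR u ^ n) x.1)]
  have : ∀ n : ℕ, PowerSeries.coeff (n + 1) (expS K) = PowerSeries.coeff n (phiS K) := fun n => by
    simp [expS, phiS]
  simp only [affine_pow_succ, this, pow_zero, Module.End.one_apply]
  refine Prod.ext ?_ ?_
  · simp only [Prod.fst_add, Prod.fst_sum, Prod.smul_fst, smul_sub, Finset.sum_sub_distrib,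
      Finset.smul_sum]
    simp only [smul_comm x.2, expS, PowerSeries.coeff_mk]
    simp only [Nat.factorial_zero, Nat.cast_one, inv_one, one_smul]
    abel
  · simp [Prod.snd_sum, expS]

variable {δ}

/-- In degree zero the affine operators form a Lie algebra representation: the Jacobi identity
handles the linear part, the derivation property the translation part. -/
theorem DGLA.affine_commutator (hδ : 𝓜.IsDer δ) {u : S ⊗[K] M}
    (hu : u ∈ ext (⊤ : Ideal S) (𝓜.gr 0)) (v : S ⊗[K] M)
    (hv : v ∈ ext (⊤ : Ideal S) (𝓜.gr 0)) :
    𝓜.affine δ u * 𝓜.affine δ v - 𝓜.affine δ v * 𝓜.affine δ u = 𝓜.affine δ (𝓜.adR u v) := by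
  refine LinearMap.ext fun x => ?_
  rw [LinearMap.sub_apply, Module.End.mul_apply, Module.End.mul_apply]
  simp only [affine_apply, Prod.mk_sub_mk, zero_smul, sub_zero]
  congr 1
  rw [map_sub, map_sub, 𝓜.adR_jacobi hu, hδ u hu, map_smul, map_smul, 𝓜.adR_skew hv (δ u)]
  simp only [smul_add, smul_neg]
  abel

theorem DGLA.adR_mem_gr_zero {u v : S ⊗[K] M}
    (hu : u ∈ ext (⊤ : Ideal S) (𝓜.gr 0)) (hv : v ∈ ext (⊤ : Ideal S) (𝓜.gr 0)) :
    𝓜.adR u v ∈ ext (⊤ : Ideal S) (𝓜.gr 0) :=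
  ext_mono le_top le_rfl (𝓜.adR_mem (add_zero 0) hu hv)

/-- `affine` as a linear map. -/
noncomputable def DGLA.affineHom (δ : S ⊗[K] M →ₗ[K] S ⊗[K] M) :
    S ⊗[K] M →ₗ[K] Module.End K ((S ⊗[K] M) × K) where
  toFun := 𝓜.affine δ
  map_add' u v := by
    refine LinearMap.ext fun x => Prod.ext ?_ ?_
    · simp only [affine_apply, map_add, LinearMap.add_apply, Prod.fst_add, smul_add]; abel
    · simp [affine_apply]
  map_smul' c u := by
    refine LinearMap.ext fun x => Prod.ext ?_ ?_
    · simp only [affine_apply, map_smul, LinearMap.smul_apply, Prod.smul_fst, smul_sub,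
        smul_comm c, RingHom.id_apply]
    · simp [affine_apply]

variable [CharZero K]

/-- `e^u v = (e^{ad_u} v) e^u` in the affine representation. -/
theorem DGLA.exp_affine_mul (hδ : 𝓜.IsDer δ) {u : S ⊗[K] M}
    (hu : u ∈ ext (⊤ : Ideal S) (𝓜.gr 0)) (hn : IsNilpotent (𝓜.adR u))
    {v : S ⊗[K] M} (hv : v ∈ ext (⊤ : Ideal S) (𝓜.gr 0)) (x : (S ⊗[K] M) × K) :
    nilEval (𝓜.affine δ u) (expS K) (𝓜.affine δ v x)
      = 𝓜.affine δ (nilEval (𝓜.adR u) (expS K) v) (nilEval (𝓜.affine δ u) (expS K) x) := by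
  exact LinearMap.congr_fun (exp_mul_eq (E := Module.End K ((S ⊗[K] M) × K))
    (𝓜.affine_isNilpotent δ hn) hn (𝓜.affineHom δ)
    (P := fun v => v ∈ ext (⊤ : Ideal S) (𝓜.gr 0)) (fun _ => 𝓜.adR_mem_gr_zero hu)
    (𝓜.affine_commutator hδ hu) hv) x

theorem DGLA.exp_affine_neg {u : S ⊗[K] M} (hn : IsNilpotent (𝓜.adR u)) (x : (S ⊗[K] M) × K) :
    nilEval (𝓜.affine δ (-u)) (expS K) (nilEval (𝓜.affine δ u) (expS K) x) = x := by
  rw [affine_neg]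
  exact LinearMap.congr_fun (nilEval_neg_mul_expS (E := Module.End K ((S ⊗[K] M) × K))
    (𝓜.affine_isNilpotent δ hn)) x

/-- Duhamel's formula: the derivative of `e^u x` is `∂(e^u) e^{-u} e^u x + e^u ∂x`. -/
theorem DGLA.derivation_exp_affine (hδ : 𝓜.IsDer δ) {D : S ⊗[K] M →ₗ[K] S ⊗[K] M}
    (hD : 𝓜.IsDer D) (hcomm : ∀ z, D (δ z) = δ (D z)) {u : S ⊗[K] M}
    (hu : u ∈ ext (⊤ : Ideal S) (𝓜.gr 0)) (hDu : D u ∈ ext (⊤ : Ideal S) (𝓜.gr 0))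
    (hn : IsNilpotent (𝓜.adR u)) (x : (S ⊗[K] M) × K) :
    D.prodMap (0 : K →ₗ[K] K) (nilEval (𝓜.affine δ u) (expS K) x)
      = 𝓜.affine δ (𝓜.logDer D u) (nilEval (𝓜.affine δ u) (expS K) x)
        + nilEval (𝓜.affine δ u) (expS K) (D.prodMap (0 : K →ₗ[K] K) x) := by
  have hA := 𝓜.affine_isNilpotent δ hn
  let D' : Module.End K ((S ⊗[K] M) × K) := D.prodMap (0 : K →ₗ[K] K)
  -- `D`, extended by zero on the scalar, acts on affine operators through `D u`, since `D` is a
  -- derivation commuting with `δ`. Duhamel's formula then applies in the direction `D u`.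
  have hc : D' * 𝓜.affine δ u - 𝓜.affine δ u * D' = 𝓜.affine δ (D u) := by
    refine LinearMap.ext fun x => ?_
    rw [LinearMap.sub_apply, Module.End.mul_apply, Module.End.mul_apply]
    refine Prod.ext ?_ ?_
    · simp only [D', affine_apply, LinearMap.prodMap_apply, map_sub, map_smul, hD u hu, hcomm,
        Prod.fst_sub, LinearMap.zero_apply, zero_smul]
      abel
    · simp [D', affine_apply]
  have := commutator_nilEval hA D' (expS K)
  have h2 := linEval_exp_eq (E := Module.End K ((S ⊗[K] M) × K)) hA hn (𝓜.affineHom δ)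
    (P := fun v => v ∈ ext (⊤ : Ideal S) (𝓜.gr 0)) (fun _ => 𝓜.adR_mem_gr_zero hu)
    (𝓜.affine_commutator hδ hu) hDu
  rw [hc] at this
  erw [h2] at this
  rw [add_comm]
  exact LinearMap.congr_fun this x

end AffineRepresentation

/-! ### The gauge action as an affine exponential. -/

section GaugeExp

variable {K : Type*} [Field K] {M : Type*} [AddCommGroup M] [Module K M] (𝓜 : DGLA K M)
  {S : Type*} [CommRing S] [Algebra K S]

/-- The differential as a `K`-linear map. -/
noncomputable def DGLA.dK : S ⊗[K] M →ₗ[K] S ⊗[K] M := (𝓜.dR S).restrictScalars K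

theorem DGLA.dK_apply (z : S ⊗[K] M) : 𝓜.dK z = 𝓜.dR S z := rfl

theorem DGLA.isDer_dR : 𝓜.IsDer (𝓜.dK : S ⊗[K] M →ₗ[K] S ⊗[K] M) :=
  fun _ hu z => 𝓜.dR_adR hu z

theorem DGLA.isDer_zero : 𝓜.IsDer (0 : S ⊗[K] M →ₗ[K] S ⊗[K] M) := fun _ _ _ => by simp

theorem DGLA.isDer_deriv {R : Type*} [CommRing R] [Algebra K R] : 𝓜.IsDer (deriv (K := K) R M) :=
  fun _ _ _ => deriv_adR 𝓜 _ _

theorem expAd_eq {u : S ⊗[K] M} (hu : IsNilpotent (𝓜.adR u)) (z : S ⊗[K] M) :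
    expAd 𝓜 S u z = nilEval (𝓜.adR u) (expS K) z := by
  rw [← finsum_eq_nilEval hu]
  exact finsum_congr fun n => by rw [𝓜.adR_pow_apply]; simp [expS]

/-- From `φ(z) z = e^z - 1` one gets `φ(ad_u)[u, y] = e^{ad_u} y - y`, so the gauge action is the
affine exponential for `δ = d` at `(y, 1)`. -/
theorem gauge_eq {u : S ⊗[K] M} (hu : IsNilpotent (𝓜.adR u)) (y : S ⊗[K] M) :
    gauge 𝓜 S u y = nilEval (𝓜.adR u) (expS K) y - 𝓜.logDer 𝓜.dK u := by
  have h1 : gauge 𝓜 S u y = y + nilEval (𝓜.adR u) (phiS K) (𝓜.adR u y - 𝓜.dK u) := by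
    rw [← finsum_eq_nilEval hu, gauge]
    congr 1
    exact finsum_congr fun n => by
      rw [𝓜.adR_pow_apply]; simp [phiS, DGLA.adR_apply, DGLA.dK_apply]
  have h2 := LinearMap.congr_fun (nilEval_mul (E := Module.End K (S ⊗[K] M)) hu (phiS K)
    PowerSeries.X) y
  rw [nilEval_X, phiS_mul_X, nilEval_sub hu, nilEval_one] at h2
  rw [h1, map_sub, DGLA.logDer]
  simp only [LinearMap.sub_apply, Module.End.one_apply, Module.End.mul_apply] at h2
  rw [← h2]
  abel

end GaugeExp

/-! ### Differential equations with nilpotent coefficients -/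

section Contraction

variable {K : Type*} [Field K] {W : Type*} [AddCommGroup W] [Module K W]

/-- The contraction principle for a finite filtration: the iterates from `0` become stationary after
`N` steps. -/
theorem exists_fixedPoint (F : ℕ → Submodule K W) {N : ℕ} (hN : F N = ⊥) (h0 : F 0 = ⊤)
    (P : Submodule K W) (f : W → W) (hP : ∀ u ∈ P, f u ∈ P)
    (hc : ∀ k, ∀ u ∈ P, ∀ v ∈ P, u - v ∈ F k → f u - f v ∈ F (k + 1)) : ∃ u ∈ P, f u = u := by
  have hm : ∀ n, f^[n] 0 ∈ P := fun n => by
    induction n with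
    | zero => exact P.zero_mem
    | succ n ih => rw [Function.iterate_succ_apply']; exact hP _ ih
  have hd : ∀ n, f^[n + 1] 0 - f^[n] 0 ∈ F n := fun n => by
    induction n with
    | zero => rw [h0]; trivial
    | succ n ih =>
      simpa only [Function.iterate_succ_apply'] using hc n _ (hm (n + 1)) _ (hm n) ih
  have h := hd N
  rw [hN, Submodule.mem_bot, Function.iterate_succ_apply', sub_eq_zero] at h
  exact ⟨_, hm N, h⟩

theorem fixedPoint_unique (F : ℕ → Submodule K W) {N : ℕ} (hN : F N = ⊥) (h0 : F 0 = ⊤)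
    (P : Submodule K W) (f : W → W)
    (hc : ∀ k, ∀ u ∈ P, ∀ v ∈ P, u - v ∈ F k → f u - f v ∈ F (k + 1)) {u v : W} (hu : u ∈ P)
    (hv : v ∈ P) (hfu : f u = u) (hfv : f v = v) : u = v := by
  have : ∀ k, u - v ∈ F k := fun k => by
    induction k with
    | zero => rw [h0]; trivial
    | succ k ih => have := hc k u hu v hv ih; rwa [hfu, hfv] at this
  have h := this N
  rwa [hN, Submodule.mem_bot, sub_eq_zero] at h

end Contraction

/-! ### The filtration by powers of a nilpotent ideal. -/

section Filtration

variable {K : Type*} [Field K] {M : Type*} [AddCommGroup M] [Module K M] (𝓜 : DGLA K M)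
  {S : Type*} [CommRing S] [Algebra K S] {J : Ideal S}

theorem ext_pow_eq_bot {V : Type*} [AddCommGroup V] [Module K V] {N : ℕ} (hJ : J ^ N = ⊥)
    (W : Submodule K V) : ext (J ^ N) W = ⊥ := by
  rw [Submodule.eq_bot_iff]
  exact fun z hz => eq_zero_of_mem_ext hJ le_rfl hz

theorem ext_pow_zero {V : Type*} [AddCommGroup V] [Module K V] :
    ext (J ^ 0) (⊤ : Submodule K V) = ⊤ := by
  rw [eq_top_iff]
  intro z _
  simpa using mem_ext_one z

theorem adR_pow_sub_mem {k i : ℕ} {u v z : S ⊗[K] M} (hv : v ∈ ext J (⊤ : Submodule K M))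
    (hu : u ∈ ext J (⊤ : Submodule K M)) (huv : u - v ∈ ext (J ^ k) (⊤ : Submodule K M))
    (hz : z ∈ ext (J ^ i) (⊤ : Submodule K M)) (n : ℕ) :
    (𝓜.adR u ^ n) z - (𝓜.adR v ^ n) z ∈ ext (J ^ (k + i)) (⊤ : Submodule K M) := by
  have hun : ∀ n, (𝓜.adR u ^ n) z ∈ ext (J ^ i) (⊤ : Submodule K M) := fun n => by
    induction n with
    | zero => exact hz
    | succ n ih =>
      rw [pow_succ', Module.End.mul_apply]
      exact ext_mono (Ideal.pow_le_pow_right (Nat.le_succ i)) le_rfl (ad_raise 𝓜 hu i _ ih)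
  induction n with
  | zero => simp
  | succ n ih =>
    have : (𝓜.adR u ^ (n + 1)) z - (𝓜.adR v ^ (n + 1)) z
        = 𝓜.adR (u - v) ((𝓜.adR u ^ n) z)
          + 𝓜.adR v ((𝓜.adR u ^ n) z - (𝓜.adR v ^ n) z) := by
      rw [pow_succ', pow_succ', Module.End.mul_apply, Module.End.mul_apply]
      simp only [map_sub, LinearMap.sub_apply]
      abel
    rw [this]
    refine Submodule.add_mem _ ?_ ?_
    · rw [pow_add]; exact bracketR_mem 𝓜 huv (hun n)
    · exact ext_mono (Ideal.pow_le_pow_right (Nat.le_succ _)) le_rfl (ad_raise 𝓜 hv _ _ ih)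

theorem nilEval_adR_sub_mem (hJ : IsNilpotent J) {k i : ℕ} {u v z : S ⊗[K] M}
    (hu : u ∈ ext J (⊤ : Submodule K M)) (hv : v ∈ ext J (⊤ : Submodule K M))
    (huv : u - v ∈ ext (J ^ k) (⊤ : Submodule K M))
    (hz : z ∈ ext (J ^ i) (⊤ : Submodule K M)) (f : PowerSeries K) :
    nilEval (𝓜.adR u) f z - nilEval (𝓜.adR v) f z ∈ ext (J ^ (k + i)) (⊤ : Submodule K M) := by
  obtain ⟨N, hN⟩ := hJ
  rw [nilEval_apply (𝓜.adR_pow_eq_zero hN hu), nilEval_apply (𝓜.adR_pow_eq_zero hN hv),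
    ← Finset.sum_sub_distrib]
  refine Submodule.sum_mem _ fun n _ => ?_
  rw [← smul_sub]
  exact Submodule.smul_mem _ _ (adR_pow_sub_mem 𝓜 hv hu huv hz n)

theorem nilEval_adR_mem {I : Ideal S} {j : ℤ} {u z : S ⊗[K] M} (hn : IsNilpotent (𝓜.adR u))
    (hu : u ∈ ext (⊤ : Ideal S) (𝓜.gr 0)) (hz : z ∈ ext I (𝓜.gr j)) (f : PowerSeries K) :
    nilEval (𝓜.adR u) f z ∈ ext I (𝓜.gr j) := by
  refine nilEval_mem hn f (fun z hz => ?_) hz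
  have := 𝓜.adR_mem (zero_add j) hu hz
  rwa [Ideal.top_mul] at this

/-- `φ - 1` is divisible by `z`, and `ad_v` raises the filtration by one. -/
theorem phiS_sub_one_mem (hJ : IsNilpotent J) {k : ℕ} {v z : S ⊗[K] M}
    (hv : v ∈ ext J (⊤ : Submodule K M)) (hz : z ∈ ext (J ^ k) (⊤ : Submodule K M)) :
    nilEval (𝓜.adR v) (phiS K) z - z ∈ ext (J ^ (k + 1)) (⊤ : Submodule K M) := by
  have hn := 𝓜.adR_isNilpotent hJ hv
  obtain ⟨g, hg⟩ : ∃ g : PowerSeries K, phiS K = 1 + PowerSeries.X * g := by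
    refine ⟨PowerSeries.mk fun n => PowerSeries.coeff (n + 1) (phiS K), ?_⟩
    ext n
    cases n with
    | zero => simp [phiS]
    | succ n => simp [PowerSeries.coeff_succ_X_mul, PowerSeries.coeff_one]
  rw [hg, nilEval_add hn, nilEval_one, nilEval_mul hn, nilEval_X, LinearMap.add_apply,
    Module.End.one_apply, add_sub_cancel_left, Module.End.mul_apply]
  refine ad_raise 𝓜 hv _ _ (nilEval_mem hn _ (fun z hz => ?_) hz)
  exact ext_mono (Ideal.pow_le_pow_right (Nat.le_succ _)) le_rfl (ad_raise 𝓜 hv _ _ hz)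

end Filtration

/-! ### The differential equation `φ(ad_{D u}) u' = w(u)` for paths. -/

section ODE

variable {K : Type*} [Field K] {M : Type*} [AddCommGroup M] [Module K M]
  (𝓜 : DGLA K M) {R : Type*} [CommRing R] [Algebra K R] {I : Ideal R}

/-- `I[t]`. -/
noncomputable abbrev polyIdeal (I : Ideal R) : Ideal R[X] := I.map (Polynomial.C : R →+* R[X])

theorem polyIdeal_isNilpotent (hI : IsNilpotent I) : IsNilpotent (polyIdeal I) := by
  obtain ⟨N, hN⟩ := hI
  exact ⟨N, map_C_pow_eq_bot hN⟩

theorem polyIdeal_pow (k : ℕ) : polyIdeal I ^ k = polyIdeal (I ^ k) := (Ideal.map_pow _ _ _).symm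

theorem deriv_pow_mem {k : ℕ} {z : R[X] ⊗[K] M}
    (hz : z ∈ ext (polyIdeal I ^ k) (⊤ : Submodule K M)) :
    deriv R M z ∈ ext (polyIdeal I ^ k) (⊤ : Submodule K M) := by
  rw [polyIdeal_pow] at *
  exact deriv_mem hz

theorem prim_pow_mem {k : ℕ} {z : R[X] ⊗[K] M}
    (hz : z ∈ ext (polyIdeal I ^ k) (⊤ : Submodule K M)) :
    prim R M z ∈ ext (polyIdeal I ^ k) (⊤ : Submodule K M) := by
  rw [polyIdeal_pow] at *
  exact prim_mem hz

/-- The right hand side of the integral form of `φ(ad (D u)) u' = w(u)`, `u(0) = u₀`. -/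
noncomputable def odeMap (D : R[X] ⊗[K] M →ₗ[K] R[X] ⊗[K] M) (w : R[X] ⊗[K] M → R[X] ⊗[K] M)
    (u₀ : R ⊗[K] M) (u : R[X] ⊗[K] M) : R[X] ⊗[K] M :=
  const R M u₀ + prim R M (w u - (nilEval (𝓜.adR (D u)) (phiS K) (deriv R M u) - deriv R M u))

/-- Writing `φ(ad_{D u}) u' = u' + (φ - 1)(ad_{D u}) u'` isolates `u'`; integrating turns the
equation into a fixed point problem whose error terms gain one filtration step. -/
theorem odeMap_eq_self_iff [CharZero K] {D : R[X] ⊗[K] M →ₗ[K] R[X] ⊗[K] M}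
    {w : R[X] ⊗[K] M → R[X] ⊗[K] M} {u₀ : R ⊗[K] M} {u : R[X] ⊗[K] M} : odeMap 𝓜 D w u₀ u = u ↔
      evalAt R M 0 u = u₀ ∧ nilEval (𝓜.adR (D u)) (phiS K) (deriv R M u) = w u := by
  constructor
  · intro h
    constructor
    · rw [← h, odeMap, map_add, evalAt_const, evalAt_zero_prim, add_zero]
    · have := congrArg (deriv R M) h
      rw [odeMap, map_add, deriv_const, deriv_prim, zero_add, sub_sub_eq_add_sub,
        sub_eq_iff_eq_add, add_comm, add_right_inj] at this
      exact this.symm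
  · rintro ⟨h0, h⟩
    rw [odeMap, h, sub_sub_cancel, prim_deriv, h0, add_sub_cancel]

/-- The conditions on `D`, `w` under which the differential equation is solvable. -/
structure DGLA.IsODE (I : Ideal R) (j : ℤ) (D : R[X] ⊗[K] M →ₗ[K] R[X] ⊗[K] M)
    (w : R[X] ⊗[K] M → R[X] ⊗[K] M) : Prop where
  D_mem : ∀ k, ∀ z ∈ ext (polyIdeal I ^ k) (⊤ : Submodule K M),
    D z ∈ ext (polyIdeal I ^ k) (⊤ : Submodule K M)
  D_gr : ∀ z ∈ ext (polyIdeal I) (𝓜.gr j), D z ∈ ext (polyIdeal I) (𝓜.gr 0)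
  w_gr : ∀ z ∈ ext (polyIdeal I) (𝓜.gr j), w z ∈ ext (polyIdeal I) (𝓜.gr j)
  w_sub : ∀ k, ∀ u ∈ ext (polyIdeal I) (𝓜.gr j), ∀ v ∈ ext (polyIdeal I) (𝓜.gr j),
    u - v ∈ ext (polyIdeal I ^ k) (⊤ : Submodule K M) →
    w u - w v ∈ ext (polyIdeal I ^ (k + 1)) (⊤ : Submodule K M)

variable {𝓜}

theorem DGLA.IsODE.odeMap_mem (hI : IsNilpotent I) {j : ℤ} {D : R[X] ⊗[K] M →ₗ[K] R[X] ⊗[K] M}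
    {w : R[X] ⊗[K] M → R[X] ⊗[K] M} (h : 𝓜.IsODE I j D w) {u₀ : R ⊗[K] M}
    (hu₀ : u₀ ∈ ext I (𝓜.gr j)) {u : R[X] ⊗[K] M} (hu : u ∈ ext (polyIdeal I) (𝓜.gr j)) :
    odeMap 𝓜 D w u₀ u ∈ ext (polyIdeal I) (𝓜.gr j) := by
  have hDu := h.D_gr u hu
  have hn := 𝓜.adR_isNilpotent (polyIdeal_isNilpotent hI) (ext_le_top hDu)
  refine Submodule.add_mem _ (const_mem hu₀) (prim_mem (Submodule.sub_mem _ (h.w_gr u hu)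
    (Submodule.sub_mem _ ?_ (deriv_mem hu))))
  exact nilEval_adR_mem 𝓜 hn (ext_mono le_top le_rfl hDu) (deriv_mem hu) _

theorem DGLA.IsODE.odeMap_sub (hI : IsNilpotent I) {j : ℤ} {D : R[X] ⊗[K] M →ₗ[K] R[X] ⊗[K] M}
    {w : R[X] ⊗[K] M → R[X] ⊗[K] M} (h : 𝓜.IsODE I j D w) {u₀ : R ⊗[K] M} (k : ℕ)
    {u v : R[X] ⊗[K] M} (hu : u ∈ ext (polyIdeal I) (𝓜.gr j))
    (hv : v ∈ ext (polyIdeal I) (𝓜.gr j))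
    (huv : u - v ∈ ext (polyIdeal I ^ k) (⊤ : Submodule K M)) :
    odeMap 𝓜 D w u₀ u - odeMap 𝓜 D w u₀ v ∈ ext (polyIdeal I ^ (k + 1)) (⊤ : Submodule K M) := by
  have hJ := polyIdeal_isNilpotent hI
  -- Three contributions, each gaining one step: the right hand sides by hypothesis, the change of
  -- operator because `u'` lies in the ideal, and the change of argument because of `φ - 1`.
  have e : odeMap 𝓜 D w u₀ u - odeMap 𝓜 D w u₀ v = prim R M ((w u - w v)
      - ((nilEval (𝓜.adR (D u)) (phiS K) (deriv R M u)
          - nilEval (𝓜.adR (D v)) (phiS K) (deriv R M u))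
        + (nilEval (𝓜.adR (D v)) (phiS K) (deriv R M (u - v)) - deriv R M (u - v)))) := by
    simp only [odeMap, map_sub, map_add]
    abel
  rw [e]
  refine prim_pow_mem (Submodule.sub_mem _ ?_ (Submodule.add_mem _ ?_ ?_))
  · exact h.w_sub k u hu v hv huv
  · refine nilEval_adR_sub_mem 𝓜 hJ (ext_le_top (h.D_gr u hu)) (ext_le_top (h.D_gr v hv)) ?_ ?_ _
    · rw [← map_sub]; exact h.D_mem k _ huv
    · rw [pow_one]; exact ext_le_top (deriv_mem hu)
  · exact phiS_sub_one_mem 𝓜 hJ (ext_le_top (h.D_gr v hv)) (deriv_pow_mem huv)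

theorem DGLA.IsODE.exists_solution [CharZero K] (hI : IsNilpotent I) {j : ℤ}
    {D : R[X] ⊗[K] M →ₗ[K] R[X] ⊗[K] M} {w : R[X] ⊗[K] M → R[X] ⊗[K] M}
    (h : 𝓜.IsODE I j D w) {u₀ : R ⊗[K] M} (hu₀ : u₀ ∈ ext I (𝓜.gr j)) :
    ∃ u ∈ ext (polyIdeal I) (𝓜.gr j), evalAt R M 0 u = u₀ ∧
      nilEval (𝓜.adR (D u)) (phiS K) (deriv R M u) = w u := by
  obtain ⟨N, hN⟩ := polyIdeal_isNilpotent hI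
  obtain ⟨u, hu, hfu⟩ := exists_fixedPoint
    (fun k => ext (polyIdeal I ^ k) (⊤ : Submodule K M)) (ext_pow_eq_bot hN _) ext_pow_zero
    (ext (polyIdeal I) (𝓜.gr j)) (odeMap 𝓜 D w u₀) (fun u hu => h.odeMap_mem hI hu₀ hu)
    (fun k u hu v hv huv => h.odeMap_sub hI k hu hv huv)
  exact ⟨u, hu, (odeMap_eq_self_iff 𝓜).1 hfu⟩

theorem DGLA.IsODE.unique [CharZero K] (hI : IsNilpotent I) {j : ℤ}
    {D : R[X] ⊗[K] M →ₗ[K] R[X] ⊗[K] M} {w : R[X] ⊗[K] M → R[X] ⊗[K] M}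
    (h : 𝓜.IsODE I j D w) {u v : R[X] ⊗[K] M} (hu : u ∈ ext (polyIdeal I) (𝓜.gr j))
    (hv : v ∈ ext (polyIdeal I) (𝓜.gr j)) (h0 : evalAt R M 0 u = evalAt R M 0 v)
    (hwu : nilEval (𝓜.adR (D u)) (phiS K) (deriv R M u) = w u)
    (hwv : nilEval (𝓜.adR (D v)) (phiS K) (deriv R M v) = w v) : u = v := by
  obtain ⟨N, hN⟩ := polyIdeal_isNilpotent hI
  exact fixedPoint_unique
    (fun k => ext (polyIdeal I ^ k) (⊤ : Submodule K M)) (ext_pow_eq_bot hN _) ext_pow_zero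
    (ext (polyIdeal I) (𝓜.gr j)) (odeMap 𝓜 D w (evalAt R M 0 v))
    (fun k u hu v hv huv => h.odeMap_sub hI k hu hv huv) hu hv
    ((odeMap_eq_self_iff 𝓜).2 ⟨h0, hwu⟩) ((odeMap_eq_self_iff 𝓜).2 ⟨rfl, hwv⟩)

/-- Covers the equation `(e^u)' = e^u c + c' e^u` for exponentials, written with logarithmic
derivatives. -/
theorem DGLA.isODE_id (hI : IsNilpotent I) {c c' : R[X] ⊗[K] M}
    (hc : c ∈ ext (polyIdeal I) (𝓜.gr 0)) (hc' : c' ∈ ext (polyIdeal I) (𝓜.gr 0)) :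
    𝓜.IsODE I 0 LinearMap.id (fun u => nilEval (𝓜.adR u) (expS K) c + c') where
  D_mem _ _ hz := hz
  D_gr _ hz := hz
  w_gr z hz := Submodule.add_mem _ (nilEval_adR_mem 𝓜
    (𝓜.adR_isNilpotent (polyIdeal_isNilpotent hI) (ext_le_top hz)) (ext_mono le_top le_rfl hz) hc _)
    hc'
  w_sub k u hu v hv huv := by
    rw [add_sub_add_right_eq_sub]
    exact nilEval_adR_sub_mem 𝓜 (polyIdeal_isNilpotent hI) (ext_le_top hu) (ext_le_top hv) huv
      (by rw [pow_one]; exact ext_le_top hc) _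

/-- Solving in degree `-1` rather than `0` produces a path of exact elements `du` whose logarithmic
derivative is the exact element `dc`. -/
theorem DGLA.isODE_dK {c : R[X] ⊗[K] M} (hc : c ∈ ext (polyIdeal I) (𝓜.gr (-1))) :
    𝓜.IsODE I (-1) 𝓜.dK (fun _ => c) where
  D_mem _ _ hz := baseChange_mem_ext _ (fun _ _ => Submodule.mem_top) hz
  D_gr _ hz := 𝓜.dR_mem (by norm_num) hz
  w_gr _ _ := hc
  w_sub _ _ _ _ _ _ := by rw [sub_self]; exact Submodule.zero_mem _

/-- The integral equation `z = ∫₀ᵗ [a, z]` improves the filtration degree of `z` indefinitely. -/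
theorem eq_zero_of_deriv_eq_adR [CharZero K] (hI : IsNilpotent I) {a z : R[X] ⊗[K] M}
    (ha : a ∈ ext (polyIdeal I) (⊤ : Submodule K M)) (h : deriv R M z = 𝓜.adR a z)
    (h0 : evalAt R M 0 z = 0) : z = 0 := by
  have hz : z = prim R M (𝓜.adR a z) := by rw [← h, prim_deriv, h0, map_zero, sub_zero]
  have : ∀ k, z ∈ ext (polyIdeal I ^ k) (⊤ : Submodule K M) := fun k => by
    induction k with
    | zero => rw [ext_pow_zero]; trivial
    | succ k ih =>
      rw [hz]
      exact prim_pow_mem (ad_raise 𝓜 ha k z ih)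
  obtain ⟨N, hN⟩ := polyIdeal_isNilpotent hI
  exact eq_zero_of_mem_ext hN le_rfl (this N)

end ODE

/-! ### The Baker-Campbell-Hausdorff product -/

section Coeffwise

variable {K : Type*} [Field K] {R : Type*} [CommRing R] [Algebra K R]

/-- The coefficientwise action of a linear map on polynomials. -/
noncomputable def coeffwise (D : R →ₗ[K] R) : R[X] →ₗ[K] R[X] :=
  Polynomial.lsum fun n => (Polynomial.monomial (R := R) n).restrictScalars K ∘ₗ D

theorem coeffwise_monomial (D : R →ₗ[K] R) (n : ℕ) (a : R) :
    coeffwise D (Polynomial.monomial n a) = Polynomial.monomial n (D a) := by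
  simp [coeffwise, Polynomial.lsum_apply, Polynomial.sum_monomial_index]

/-- The coefficientwise extension of a derivation to polynomials. -/
noncomputable def coeffwiseDerivation (D : Derivation K R R) : Derivation K R[X] R[X] :=
  Derivation.mk' (coeffwise (D : R →ₗ[K] R)) fun p q => by
    induction p using Polynomial.induction_on' with
    | add p p' h h' => simp only [add_mul, map_add, h, h', add_smul, smul_add]; abel
    | monomial n a =>
      induction q using Polynomial.induction_on' with
      | add q q' h h' => simp only [mul_add, map_add, h, h', add_smul, smul_add]; abel
      | monomial m b =>
        simp only [Polynomial.monomial_mul_monomial, coeffwise_monomial, Derivation.coeFn_coe,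
          Derivation.leibniz, smul_eq_mul, map_add]
        rw [add_comm m n]

theorem coeffwiseDerivation_monomial (D : Derivation K R R) (n : ℕ) (a : R) :
    coeffwiseDerivation D (Polynomial.monomial n a) = Polynomial.monomial n (D a) :=
  coeffwise_monomial _ _ _

theorem derivative_coeffwiseDerivation (D : Derivation K R R) (p : R[X]) :
    Polynomial.derivative (coeffwiseDerivation D p)
      = coeffwiseDerivation D (Polynomial.derivative p) := by
  induction p using Polynomial.induction_on' with
  | add p q hp hq => simp only [map_add, hp, hq]
  | monomial n a =>
    rw [coeffwiseDerivation_monomial, Polynomial.derivative_monomial,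
      Polynomial.derivative_monomial, coeffwiseDerivation_monomial]
    simp [mul_comm]

/-- The derivation does not touch the path variable, so it commutes with evaluation only at points
it annihilates; `0` and `1` are the ones needed. -/
theorem eval_coeffwiseDerivation (D : Derivation K R R) {r : R} (hr : D r = 0) (p : R[X]) :
    (coeffwiseDerivation D p).eval r = D (p.eval r) := by
  induction p using Polynomial.induction_on' with
  | add p q hp hq => simp only [map_add, Polynomial.eval_add, hp, hq]
  | monomial n a =>
    rw [coeffwiseDerivation_monomial, Polynomial.eval_monomial, Polynomial.eval_monomial,
      Derivation.leibniz, Derivation.leibniz_pow, hr]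
    simp [mul_comm]

end Coeffwise

section BCH

variable {K : Type*} [Field K] {M : Type*} [AddCommGroup M] [Module K M]
  (𝓜 : DGLA K M) {R : Type*} [CommRing R] [Algebra K R] {I : Ideal R}

/-- `δt` extends the derivation `δ` to paths. -/
structure DGLA.IsLift (δ : R ⊗[K] M →ₗ[K] R ⊗[K] M) (δt : R[X] ⊗[K] M →ₗ[K] R[X] ⊗[K] M) :
    Prop where
  isDer : 𝓜.IsDer δt
  deriv_comm : ∀ z, deriv R M (δt z) = δt (deriv R M z)
  evalAt_zero : ∀ z, evalAt R M 0 (δt z) = δ (evalAt R M 0 z)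
  evalAt_one : ∀ z, evalAt R M 1 (δt z) = δ (evalAt R M 1 z)

theorem DGLA.isLift_zero : 𝓜.IsLift (0 : R ⊗[K] M →ₗ[K] R ⊗[K] M) 0 where
  isDer := 𝓜.isDer_zero
  deriv_comm z := by simp
  evalAt_zero z := by simp
  evalAt_one z := by simp

theorem DGLA.isLift_dK : 𝓜.IsLift (𝓜.dK : R ⊗[K] M →ₗ[K] R ⊗[K] M) 𝓜.dK where
  isDer := 𝓜.isDer_dR
  deriv_comm z := deriv_baseChange _ z
  evalAt_zero z := evalAt_baseChange _ _ z
  evalAt_one z := evalAt_baseChange _ _ z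

/-- Intended for `R` itself a polynomial ring and `D = d/dt`: the path defining the product runs in
a second variable, and `D` acts on its coefficients. -/
theorem DGLA.isLift_rTensor (D : Derivation K R R) :
    𝓜.IsLift (LinearMap.rTensor M (D : R →ₗ[K] R))
      (LinearMap.rTensor M (coeffwiseDerivation D : R[X] →ₗ[K] R[X])) where
  isDer _ _ _ := rTensor_derivation_adR 𝓜 _ _ _
  deriv_comm z := by
    induction z with
    | zero => simp
    | add x y hx hy => simp only [map_add, hx, hy]
    | tmul s x => simp [deriv, derivative_coeffwiseDerivation]
  evalAt_zero z := by
    induction z with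
    | zero => simp
    | add x y hx hy => simp only [map_add, hx, hy]
    | tmul s x =>
      change Polynomial.eval 0 (coeffwiseDerivation D s) ⊗ₜ[K] x = D (Polynomial.eval 0 s) ⊗ₜ[K] x
      rw [eval_coeffwiseDerivation D (map_zero D)]
  evalAt_one z := by
    induction z with
    | zero => simp
    | add x y hx hy => simp only [map_add, hx, hy]
    | tmul s x =>
      change Polynomial.eval 1 (coeffwiseDerivation D s) ⊗ₜ[K] x = D (Polynomial.eval 1 s) ⊗ₜ[K] x
      rw [eval_coeffwiseDerivation D D.map_one_eq_zero]

theorem evalAt_exp_affine {r : R} {δ : R ⊗[K] M →ₗ[K] R ⊗[K] M}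
    {δt : R[X] ⊗[K] M →ₗ[K] R[X] ⊗[K] M} (h : ∀ z, evalAt R M r (δt z) = δ (evalAt R M r z))
    {u : R[X] ⊗[K] M} (hu : IsNilpotent (𝓜.adR u)) (hu' : IsNilpotent (𝓜.adR (evalAt R M r u)))
    (x : (R[X] ⊗[K] M) × K) :
    (evalAt R M r).prodMap LinearMap.id (nilEval (𝓜.affine δt u) (expS K) x)
      = nilEval (𝓜.affine δ (evalAt R M r u)) (expS K) (evalAt R M r x.1, x.2) :=
  nilEval_intertwine (𝓜.affine_isNilpotent δt hu) (𝓜.affine_isNilpotent δ hu')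
    ((evalAt R M r).prodMap LinearMap.id) (P := fun _ => True) (fun _ _ => trivial)
    (fun z _ => by
      simp only [DGLA.affine_apply, LinearMap.prodMap_apply, map_sub, map_smul, h, LinearMap.id_apply]
      rw [DGLA.adR_apply, evalAt, bracketR_push]
      rfl) _ trivial

theorem nilEval_affine_zero {S : Type*} [CommRing S] [Algebra K S]
    (δ : S ⊗[K] M →ₗ[K] S ⊗[K] M) (x : (S ⊗[K] M) × K) :
    nilEval (𝓜.affine δ 0) (expS K) x = x := by
  have h : 𝓜.affine δ (0 : S ⊗[K] M) = 0 := by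
    refine LinearMap.ext fun x => ?_
    simp [DGLA.affine_apply]
  rw [h, nilEval_apply_of_apply_eq_zero ⟨1, by simp⟩ (by simp)]
  simp [expS]

theorem nilEval_adR_zero {S : Type*} [CommRing S] [Algebra K S] (f : PowerSeries K)
    (z : S ⊗[K] M) : nilEval (𝓜.adR 0) f z = PowerSeries.coeff 0 f • z := by
  rw [map_zero, nilEval_apply_of_apply_eq_zero ⟨1, by simp⟩ (by simp)]

theorem nilEval_adR_smul {S : Type*} [CommRing S] [Algebra K S] {u : S ⊗[K] M}
    (hu : IsNilpotent (𝓜.adR u)) (f : PowerSeries K) (r : S) (z : S ⊗[K] M) :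
    nilEval (𝓜.adR u) f (r • z) = r • nilEval (𝓜.adR u) f z :=
  (nilEval_intertwine hu hu ((LinearMap.lsmul S (S ⊗[K] M) r).restrictScalars K) (P := fun _ => True)
    (fun _ _ => trivial) (fun z _ => (𝓜.adR_smul_right r u z).symm) f trivial).symm

theorem push_nilEval_adR {S T : Type*} [CommRing S] [Algebra K S] [CommRing T] [Algebra K T]
    (φ : S →ₐ[K] T) {u : S ⊗[K] M} (hu : IsNilpotent (𝓜.adR u))
    (hu' : IsNilpotent (𝓜.adR (push φ M u))) (f : PowerSeries K) (z : S ⊗[K] M) :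
    push φ M (nilEval (𝓜.adR u) f z) = nilEval (𝓜.adR (push φ M u)) f (push φ M z) :=
  nilEval_intertwine hu hu' (push φ M) (P := fun _ => True) (fun _ _ => trivial)
    (fun z _ => bracketR_push φ 𝓜 u z) f trivial

theorem evalAt_nilEval_adR {r : R} {u : R[X] ⊗[K] M} (hu : IsNilpotent (𝓜.adR u))
    (hu' : IsNilpotent (𝓜.adR (evalAt R M r u))) (f : PowerSeries K) (z : R[X] ⊗[K] M) :
    evalAt R M r (nilEval (𝓜.adR u) f z) = nilEval (𝓜.adR (evalAt R M r u)) f (evalAt R M r z) :=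
  push_nilEval_adR 𝓜 _ hu hu' f z

theorem X_smul_const_mem {W : Submodule K M} {b : R ⊗[K] M} (hb : b ∈ ext I W) :
    (Polynomial.X : R[X]) • const R M b ∈ ext (polyIdeal I) W :=
  smul_mem_ext_self _ (const_mem hb)

theorem deriv_X_smul_const (b : R ⊗[K] M) :
    deriv R M ((Polynomial.X : R[X]) • const R M b) = const R M b := by
  rw [deriv_smul, deriv_const, Polynomial.derivative_X, one_smul, smul_zero, add_zero]

variable [CharZero K]

/-- Since `[t b, b] = 0`, only the constant term of `φ` contributes. -/
theorem logDer_X_smul_const (hI : IsNilpotent I) {b : R ⊗[K] M} (hb : b ∈ ext I (𝓜.gr 0)) :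
    𝓜.logDer (deriv R M) ((Polynomial.X : R[X]) • const R M b) = const R M b := by
  have hn := 𝓜.adR_isNilpotent (polyIdeal_isNilpotent hI) (ext_le_top (X_smul_const_mem hb))
  rw [DGLA.logDer, deriv_X_smul_const, nilEval_apply_of_apply_eq_zero hn]
  · simp [phiS]
  · rw [𝓜.adR_smul, 𝓜.adR_self (ext_mono le_top le_rfl (const_mem hb)), smul_zero]

theorem nilEval_adR_neg_expS {S : Type*} [CommRing S] [Algebra K S] {u : S ⊗[K] M}
    (hu : IsNilpotent (𝓜.adR u)) (z : S ⊗[K] M) :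
    nilEval (𝓜.adR (-u)) (expS K) (nilEval (𝓜.adR u) (expS K) z) = z := by
  rw [map_neg]
  exact LinearMap.congr_fun (nilEval_neg_mul_expS (E := Module.End K (S ⊗[K] M)) hu) z

variable {𝓜}

/-- `e^{c(t)} e^{-t b}` is constant if `c' = b` in the logarithmic sense. -/
theorem deriv_exp_affine_path (hI : IsNilpotent I) {b : R ⊗[K] M} (hb : b ∈ ext I (𝓜.gr 0))
    {c : R[X] ⊗[K] M} (hc : c ∈ ext (polyIdeal I) (𝓜.gr 0))
    (hcb : 𝓜.logDer (deriv R M) c = nilEval (𝓜.adR c) (expS K) (const R M b))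
    {δ : R ⊗[K] M →ₗ[K] R ⊗[K] M} {δt : R[X] ⊗[K] M →ₗ[K] R[X] ⊗[K] M} (h : 𝓜.IsLift δ δt)
    (x : (R ⊗[K] M) × K) :
    deriv R M (nilEval (𝓜.affine δt c) (expS K)
      (nilEval (𝓜.affine δt (-((Polynomial.X : R[X]) • const R M b))) (expS K)
        (const R M x.1, x.2))).1 = 0 := by
  have hJ := polyIdeal_isNilpotent hI
  set d := -((Polynomial.X : R[X]) • const R M b) with hd
  have hd' : d = (Polynomial.X : R[X]) • const R M (-b) := by rw [hd, map_neg, smul_neg]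
  have hb' : -b ∈ ext I (𝓜.gr 0) := Submodule.neg_mem _ hb
  have hdm : d ∈ ext (polyIdeal I) (𝓜.gr 0) := by rw [hd']; exact X_smul_const_mem hb'
  have hdl : 𝓜.logDer (deriv R M) d = -const R M b := by
    rw [hd', logDer_X_smul_const 𝓜 hI hb', map_neg]
  have hbm : const R M b ∈ ext (polyIdeal I) (𝓜.gr 0) := const_mem hb
  have up : ∀ {z : R[X] ⊗[K] M}, z ∈ ext (polyIdeal I) (𝓜.gr 0) →
      z ∈ ext (⊤ : Ideal R[X]) (𝓜.gr 0) := fun hz => ext_mono le_top le_rfl hz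
  have hnc := 𝓜.adR_isNilpotent hJ (ext_le_top hc)
  have hnd := 𝓜.adR_isNilpotent hJ (ext_le_top hdm)
  have h1 := 𝓜.derivation_exp_affine h.isDer 𝓜.isDer_deriv h.deriv_comm (up hdm)
    (up (deriv_mem hdm)) hnd (const R M x.1, x.2)
  have h2 := 𝓜.derivation_exp_affine h.isDer 𝓜.isDer_deriv h.deriv_comm (up hc)
    (up (deriv_mem hc)) hnc (nilEval (𝓜.affine δt d) (expS K) (const R M x.1, x.2))
  have h3 : (deriv R M).prodMap (0 : K →ₗ[K] K) (const R M x.1, x.2) = 0 :=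
    Prod.ext (deriv_const _) rfl
  rw [h3, map_zero, add_zero, hdl, 𝓜.affine_neg δt (const R M b), LinearMap.neg_apply] at h1
  -- The two terms of the product rule are `(e^{ad_c} b) e^c e^{-t b}` and `-e^c b e^{-t b}`; they
  -- cancel because `e^c b = (e^{ad_c} b) e^c`.
  rw [h1, hcb, map_neg, 𝓜.exp_affine_mul h.isDer (up hc) hnc (up hbm), add_neg_cancel] at h2
  exact congrArg Prod.fst h2

/-- The path `t ↦ a • t b`. -/
theorem exists_bch_path (hI : IsNilpotent I) {a b : R ⊗[K] M} (ha : a ∈ ext I (𝓜.gr 0))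
    (hb : b ∈ ext I (𝓜.gr 0)) : ∃ c ∈ ext (polyIdeal I) (𝓜.gr 0), evalAt R M 0 c = a ∧
      evalAt R M 1 c = bch 𝓜 R a b ∧
      𝓜.logDer (deriv R M) c = nilEval (𝓜.adR c) (expS K) (const R M b) := by
  have hJ := polyIdeal_isNilpotent hI
  -- The path solves `(e^c)' = e^c b`, `c(0) = a`, the equation of `e^a e^{t b}`. It remains to
  -- identify `c(1)` with Poincaré's integral.
  obtain ⟨c, hc, h0, hcb⟩ := (DGLA.isODE_id hI (const_mem hb)
    (Submodule.zero_mem _)).exists_solution hI ha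
  rw [add_zero, LinearMap.id_apply] at hcb
  change 𝓜.logDer (deriv R M) c = _ at hcb
  refine ⟨c, hc, h0, ?_, hcb⟩
  have hnc := 𝓜.adR_isNilpotent hJ (ext_le_top hc)
  have hXb := X_smul_const_mem hb
  have hnb := 𝓜.adR_isNilpotent hJ (ext_le_top hXb)
  have hnb' := 𝓜.adR_isNilpotent hJ (ext_le_top (Submodule.neg_mem _ hXb))
  have hna := 𝓜.adR_isNilpotent hI (ext_le_top ha)
  have hnca := 𝓜.adR_isNilpotent hJ (ext_le_top (const_mem ha))
  -- `e^{ad_c} e^{-t ad_b}` is constant in `t` on constant vectors, with value `e^{ad_a}` at `t =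
  -- 0`. The next claim extends this to all polynomial vectors by linearity over `R[X]`.
  have e1 : ∀ z, nilEval (𝓜.adR c) (expS K)
      (nilEval (𝓜.adR (-((Polynomial.X : R[X]) • const R M b))) (expS K) (const R M z))
        = const R M (nilEval (𝓜.adR a) (expS K) z) := by
    intro z
    have h := eq_const_of_deriv_eq_zero
      (deriv_exp_affine_path hI hb hc hcb 𝓜.isLift_zero (z, 0))
    simp only [𝓜.exp_affine _ hnc, 𝓜.exp_affine _ hnb', zero_smul, sub_zero] at h
    rw [h]
    congr 1
    have hn0 : IsNilpotent (𝓜.adR (evalAt R M 0 c)) := by rwa [h0]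
    have hnb0 : evalAt R M 0 (-((Polynomial.X : R[X]) • const R M b)) = 0 := by
      rw [map_neg, evalAt_smul]; simp
    have hnX : IsNilpotent (𝓜.adR (evalAt R M 0 (-((Polynomial.X : R[X]) • const R M b)))) := by
      rw [hnb0, map_zero]; exact IsNilpotent.zero
    rw [evalAt_nilEval_adR 𝓜 hnc hn0, evalAt_nilEval_adR 𝓜 hnb' hnX, hnb0, h0, evalAt_const,
      nilEval_adR_zero]
    simp [expS]
  have e2 : ∀ z, nilEval (𝓜.adR c) (expS K)
      (nilEval (𝓜.adR (-((Polynomial.X : R[X]) • const R M b))) (expS K) z)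
        = nilEval (𝓜.adR (const R M a)) (expS K) z := by
    intro z
    induction z with
    | zero => simp
    | add x y hx hy => simp only [map_add, hx, hy]
    | tmul p m =>
      have : p ⊗ₜ[K] m = p • const R M (1 ⊗ₜ[K] m) := by
        rw [const, push_tmul, map_one, TensorProduct.smul_tmul', smul_eq_mul, mul_one]
      rw [this, nilEval_adR_smul 𝓜 hnb', nilEval_adR_smul 𝓜 hnc, nilEval_adR_smul 𝓜 hnca, e1]
      congr 1
      exact push_nilEval_adR 𝓜 _ hna hnca _ _
  -- `e^{ad_a} e^{t ad_b} = e^{ad_c}`, so the integrand becomes a power series in the single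
  -- operator `ad_c`.
  have e3 : ∀ z, bchU 𝓜 R a b z = nilEval (𝓜.adR c) (1 - expS K) z := by
    intro z
    rw [bchU, expAd_eq 𝓜 hnb, expAd_eq 𝓜 hnca, ← e2, nilEval_adR_neg_expS 𝓜 hnb,
      nilEval_sub hnc, nilEval_one]
    rfl
  have e4 : ∀ n z, (bchU 𝓜 R a b)^[n] z = nilEval (𝓜.adR c) ((1 - expS K) ^ n) z := by
    intro n z
    induction n with
    | zero => rw [pow_zero, nilEval_one]; rfl
    | succ n ih => rw [Function.iterate_succ_apply', e3, ih, pow_succ', nilEval_mul hnc]; rfl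
  obtain ⟨N, hN⟩ := hI
  have hcN := 𝓜.adR_pow_eq_zero (map_C_pow_eq_bot hN) (ext_le_top hc)
  have e5 : ∑ᶠ n : ℕ, (((n + 1 : ℕ) * (n + 2 : ℕ) : K))⁻¹ •
      (bchU 𝓜 R a b)^[n + 1] (const R M b) = ∑ n ∈ Finset.range N,
        (((n + 1 : ℕ) * (n + 2 : ℕ) : K))⁻¹ • (bchU 𝓜 R a b)^[n + 1] (const R M b) := by
    refine finsum_eq_sum_of_support_subset _ fun n hn => ?_
    by_contra h'
    have hNn : N ≤ n := by simpa using h'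
    refine hn ?_
    have h2 := iterate_mem _ (bchU_mem 𝓜 hN (ext_le_top ha) (ext_le_top hb)) (const R M b) 0
      (by simpa using mem_ext_one _) (n + 1)
    simp only [eq_zero_of_mem_ext (map_C_pow_eq_bot hN) (by omega : N ≤ 0 + (n + 1)) h2, smul_zero]
  have e6 : const R M b - ∑ n ∈ Finset.range N,
        (((n + 1 : ℕ) * (n + 2 : ℕ) : K))⁻¹ • (bchU 𝓜 R a b)^[n + 1] (const R M b)
      = nilEval (𝓜.adR c) (psiTrunc K N) (const R M b) := by
    rw [psiTrunc, nilEval_sub hnc, nilEval_one, nilEval_sum hnc]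
    simp only [LinearMap.sub_apply, Module.End.one_apply, LinearMap.sum_apply,
      nilEval_smul_apply hnc, e4]
  -- Inverting `φ(ad_c)` in the differential equation gives `c' = f(ad_c) b`. By `coeff_psiTrunc`
  -- the integrand is therefore `c'`, and its integral is `c(1) - a`.
  have e7 : deriv R M c = nilEval (𝓜.adR c) (coneSeries K) (const R M b) := by
    have h := congrArg (fun z => nilEval (𝓜.adR c) (phiInv K) z) hcb
    have h2 : phiInv K * expS K = coneSeries K := by
      rw [← coneSeries_mul_phiS, mul_left_comm, phiInv_mul_phiS, mul_one]
    simp only [DGLA.logDer] at h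
    rw [← nilEval_mul_apply hnc, ← nilEval_mul_apply hnc, phiInv_mul_phiS,
      nilEval_one, h2] at h
    exact h
  rw [bch, e5, e6, nilEval_congr hcN (fun n hn => coeff_psiTrunc hn.le), ← e7, integral_deriv, h0,
    add_sub_cancel]

theorem bch_mem_gr (hI : IsNilpotent I) {a b : R ⊗[K] M} (ha : a ∈ ext I (𝓜.gr 0))
    (hb : b ∈ ext I (𝓜.gr 0)) : bch 𝓜 R a b ∈ ext I (𝓜.gr 0) := by
  obtain ⟨c, hc, -, h1, -⟩ := exists_bch_path hI ha hb
  rw [← h1]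
  exact evalAt_mem _ hc

/-- `e^{a • b} = e^a e^b` in the affine representations. -/
theorem exp_affine_bch (hI : IsNilpotent I) {a b : R ⊗[K] M} (ha : a ∈ ext I (𝓜.gr 0))
    (hb : b ∈ ext I (𝓜.gr 0)) {δ : R ⊗[K] M →ₗ[K] R ⊗[K] M}
    {δt : R[X] ⊗[K] M →ₗ[K] R[X] ⊗[K] M} (h : 𝓜.IsLift δ δt) (x : (R ⊗[K] M) × K) :
    nilEval (𝓜.affine δ (bch 𝓜 R a b)) (expS K) x
      = nilEval (𝓜.affine δ a) (expS K) (nilEval (𝓜.affine δ b) (expS K) x) := by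
  obtain ⟨c, hc, h0, h1, hcb⟩ := exists_bch_path hI ha hb
  have hJ := polyIdeal_isNilpotent hI
  have hnc := 𝓜.adR_isNilpotent hJ (ext_le_top hc)
  have hXb := X_smul_const_mem hb
  have hnX := 𝓜.adR_isNilpotent hJ (ext_le_top (Submodule.neg_mem _ hXb))
  have hnb := 𝓜.adR_isNilpotent hI (ext_le_top hb)
  have hev : ∀ r : R, evalAt R M r (-((Polynomial.X : R[X]) • const R M b)) = -(r • b) := by
    intro r
    rw [map_neg, evalAt_smul, evalAt_const, Polynomial.eval_X]
  -- The path `e^c e^{-t b}` is constant; its values at `1` and `0` are the two sides.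
  have key : ∀ x : (R ⊗[K] M) × K, nilEval (𝓜.affine δ (bch 𝓜 R a b)) (expS K)
      (nilEval (𝓜.affine δ (-b)) (expS K) x) = nilEval (𝓜.affine δ a) (expS K) x := by
    intro x
    set w := nilEval (𝓜.affine δt c) (expS K)
      (nilEval (𝓜.affine δt (-((Polynomial.X : R[X]) • const R M b))) (expS K)
        (const R M x.1, x.2)) with hw
    have hwc := eq_const_of_deriv_eq_zero (deriv_exp_affine_path hI hb hc hcb h x)
    rw [← hw] at hwc
    have ev : ∀ r : R, (∀ z, evalAt R M r (δt z) = δ (evalAt R M r z)) →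
        (evalAt R M r w.1, w.2) = nilEval (𝓜.affine δ (evalAt R M r c)) (expS K)
          (nilEval (𝓜.affine δ (-(r • b))) (expS K) x) := by
      intro r hr
      have hn1 := 𝓜.adR_isNilpotent hI (ext_le_top (evalAt_mem r hc))
      have hn2 : IsNilpotent (𝓜.adR (evalAt R M r (-((Polynomial.X : R[X]) • const R M b)))) :=
        𝓜.adR_isNilpotent hI (ext_le_top (evalAt_mem r (Submodule.neg_mem _ hXb)))
      have h2 := evalAt_exp_affine 𝓜 hr hnc hn1
        (nilEval (𝓜.affine δt (-((Polynomial.X : R[X]) • const R M b))) (expS K)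
          (const R M x.1, x.2))
      have h3 := evalAt_exp_affine 𝓜 hr hnX hn2 (const R M x.1, x.2)
      rw [hev, evalAt_const] at h3
      rw [← hw] at h2
      refine h2.trans ?_
      congr 1
    have hw0 := ev 0 h.evalAt_zero
    have hw1 := ev 1 h.evalAt_one
    rw [one_smul, h1] at hw1
    rw [zero_smul, neg_zero, nilEval_affine_zero, h0] at hw0
    rw [← hw0, ← hw1, hwc, evalAt_const, evalAt_const]
  have := key (nilEval (𝓜.affine δ b) (expS K) x)
  rwa [𝓜.exp_affine_neg hnb] at this

theorem expAd_bch (hI : IsNilpotent I) {a b : R ⊗[K] M} (ha : a ∈ ext I (𝓜.gr 0))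
    (hb : b ∈ ext I (𝓜.gr 0)) (z : R ⊗[K] M) :
    nilEval (𝓜.adR (bch 𝓜 R a b)) (expS K) z
      = nilEval (𝓜.adR a) (expS K) (nilEval (𝓜.adR b) (expS K) z) := by
  have hn := fun {a : R ⊗[K] M} (ha : a ∈ ext I (𝓜.gr 0)) => 𝓜.adR_isNilpotent hI (ext_le_top ha)
  have := congrArg Prod.fst (exp_affine_bch hI ha hb 𝓜.isLift_zero (z, 0))
  simpa only [𝓜.exp_affine _ (hn ha), 𝓜.exp_affine _ (hn hb), 𝓜.exp_affine _
    (hn (bch_mem_gr hI ha hb)), zero_smul, sub_zero] using this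

/-- The case `δ = d` of `exp_affine_bch`, read on vectors with scalar component `1`. -/
theorem gauge_bch (hI : IsNilpotent I) {a b : R ⊗[K] M} (ha : a ∈ ext I (𝓜.gr 0))
    (hb : b ∈ ext I (𝓜.gr 0)) (y : R ⊗[K] M) :
    gauge 𝓜 R (bch 𝓜 R a b) y = gauge 𝓜 R a (gauge 𝓜 R b y) := by
  have hn := fun {a : R ⊗[K] M} (ha : a ∈ ext I (𝓜.gr 0)) => 𝓜.adR_isNilpotent hI (ext_le_top ha)
  have := congrArg Prod.fst (exp_affine_bch hI ha hb 𝓜.isLift_dK (y, 1))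
  simpa only [𝓜.exp_affine _ (hn ha), 𝓜.exp_affine _ (hn hb), 𝓜.exp_affine _
    (hn (bch_mem_gr hI ha hb)), one_smul, gauge_eq 𝓜 (hn ha), gauge_eq 𝓜 (hn hb),
    gauge_eq 𝓜 (hn (bch_mem_gr hI ha hb))] using this

theorem gauge_neg_gauge (hI : IsNilpotent I) {a : R ⊗[K] M} (ha : a ∈ ext I (𝓜.gr 0))
    (y : R ⊗[K] M) : gauge 𝓜 R (-a) (gauge 𝓜 R a y) = y := by
  have hn := 𝓜.adR_isNilpotent hI (ext_le_top ha)
  have hn' := 𝓜.adR_isNilpotent hI (ext_le_top (Submodule.neg_mem _ ha))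
  have := congrArg Prod.fst (𝓜.exp_affine_neg (δ := 𝓜.dK) hn (y, 1))
  simpa only [𝓜.exp_affine _ hn, 𝓜.exp_affine _ hn', one_smul, gauge_eq 𝓜 hn,
    gauge_eq 𝓜 hn'] using this

theorem logDer_neg (δ : R ⊗[K] M →ₗ[K] R ⊗[K] M) (hI : IsNilpotent I) {a : R ⊗[K] M}
    (ha : a ∈ ext I (𝓜.gr 0)) :
    𝓜.logDer δ (-a) = -nilEval (𝓜.adR (-a)) (expS K) (𝓜.logDer δ a) := by
  have hn := 𝓜.adR_isNilpotent hI (ext_le_top ha)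
  have hn' := 𝓜.adR_isNilpotent hI (ext_le_top (Submodule.neg_mem _ ha))
  have := congrArg Prod.fst (𝓜.exp_affine_neg (δ := δ) hn (0, 1))
  simp only [𝓜.exp_affine _ hn, 𝓜.exp_affine _ hn', one_smul, map_zero, zero_sub, map_neg] at this
  simp only [map_neg]
  exact (sub_eq_zero.1 this).symm

/-- The cocycle rule `(e^a e^b)' (e^a e^b)^{-1} = a'-part + e^{ad_a}(b'-part)` is `exp_affine_bch`
for `δ = d/dt` on the vector `(0, 1)`. -/
theorem logDer_deriv_bch {J : Ideal R[X]} (hJ : IsNilpotent J) {a b : R[X] ⊗[K] M}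
    (ha : a ∈ ext J (𝓜.gr 0)) (hb : b ∈ ext J (𝓜.gr 0)) :
    𝓜.logDer (deriv R M) (bch 𝓜 R[X] a b) = 𝓜.logDer (deriv R M) a
      + nilEval (𝓜.adR a) (expS K) (𝓜.logDer (deriv R M) b) := by
  have hn := fun {a : R[X] ⊗[K] M} (ha : a ∈ ext J (𝓜.gr 0)) =>
    𝓜.adR_isNilpotent hJ (ext_le_top ha)
  let D : Derivation K R[X] R[X] := Derivation.mk'
    ((Polynomial.derivative (R := R)).restrictScalars K) fun p q => by
      simp [Polynomial.derivative_mul, mul_comm, add_comm]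
  have hD : LinearMap.rTensor M (D : R[X] →ₗ[K] R[X]) = deriv R M := rfl
  have h := 𝓜.isLift_rTensor D
  rw [hD] at h
  have := congrArg Prod.fst (exp_affine_bch hJ ha hb h (0, 1))
  simp only [𝓜.exp_affine _ (hn ha), 𝓜.exp_affine _ (hn hb), 𝓜.exp_affine _
    (hn (bch_mem_gr hJ ha hb)), one_smul, map_zero, zero_sub, map_neg] at this
  rw [← neg_inj, this]
  abel

/-- The straight path `t b` solves the equation defining the product path from `0`, so uniqueness
applies. -/
theorem bch_zero_left (hI : IsNilpotent I) {b : R ⊗[K] M} (hb : b ∈ ext I (𝓜.gr 0)) :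
    bch 𝓜 R 0 b = b := by
  obtain ⟨c, hc, h0, h1, hcb⟩ := exists_bch_path hI (Submodule.zero_mem _) hb
  have hX := X_smul_const_mem hb
  have : c = (Polynomial.X : R[X]) • const R M b := by
    refine (DGLA.isODE_id hI (const_mem hb) (Submodule.zero_mem _)).unique hI hc hX ?_ ?_ ?_
    · rw [h0, evalAt_smul]; simp
    · rw [add_zero]; exact hcb
    · rw [add_zero]
      refine (logDer_X_smul_const 𝓜 hI hb).trans ?_
      rw [nilEval_apply_of_apply_eq_zero
        (𝓜.adR_isNilpotent (polyIdeal_isNilpotent hI) (ext_le_top hX))]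
      · simp [expS]
      · rw [𝓜.adR_smul, 𝓜.adR_self (ext_mono le_top le_rfl (const_mem hb)), smul_zero]
  rw [← h1, this, evalAt_smul, evalAt_const]
  simp

end BCH

/-! ### Multilinear maps with extended scalars -/

section Mbc

variable {K : Type*} [Field K] {R : Type*} [CommRing R] [Algebra K R]
  {V : Type*} [AddCommGroup V] [Module K V]

/-- A basis of `V` over the field gives an `R`-basis of `R ⊗ V` consisting of vectors `1 ⊗ v`. -/
theorem multilinear_ext_tmul {n : ℕ} {W : Type*} [AddCommGroup W] [Module R W]
    {f g : MultilinearMap R (fun _ : Fin n => R ⊗[K] V) W}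
    (h : ∀ x : Fin n → V, f (fun i => 1 ⊗ₜ[K] x i) = g fun i => 1 ⊗ₜ[K] x i) : f = g := by
  refine Module.Basis.ext_multilinear (fun _ => (Module.Basis.ofVectorSpace K V).baseChange R)
    fun v => ?_
  simpa using h fun i => Module.Basis.ofVectorSpace K V (v i)

theorem mbc_one_tmul (n : ℕ) (f : MultilinearMap K (fun _ : Fin n => V) V) (x : Fin n → V) :
    mbc R n f (fun i => 1 ⊗ₜ[K] x i) = 1 ⊗ₜ[K] f x := by
  rw [mbc_tmul, Finset.prod_const_one]

theorem mbc_compLinearMap (n : ℕ) (f : MultilinearMap K (fun _ : Fin n => V) V)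
    (g : Fin n → V →ₗ[K] V) (x : Fin n → R ⊗[K] V) :
    mbc R n (f.compLinearMap g) x = mbc R n f fun i => (g i).baseChange R (x i) := by
  have : mbc R n (f.compLinearMap g)
      = (mbc R n f).compLinearMap fun i => (g i).baseChange R := by
    refine multilinear_ext_tmul fun x => ?_
    rw [mbc_one_tmul]
    simp [mbc_one_tmul]
  rw [this]
  rfl

theorem mbc_domDomCongr (n : ℕ) (f : MultilinearMap K (fun _ : Fin n => V) V)
    (σ : Equiv.Perm (Fin n)) (x : Fin n → R ⊗[K] V) :
    mbc R n (f.domDomCongr σ) x = mbc R n f fun i => x (σ i) := by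
  have : mbc R n (f.domDomCongr σ) = (mbc R n f).domDomCongr σ := by
    refine multilinear_ext_tmul fun x => ?_
    rw [mbc_one_tmul]
    simp [mbc_one_tmul]
  rw [this]
  rfl

theorem mbc_graft (n : ℕ) (B : V →ₗ[K] V →ₗ[K] V) (T : MultilinearMap K (fun _ : Fin n => V) V)
    (x : Fin (n + 1) → R ⊗[K] V) : mbc R (n + 1) (graft B T) x
      = LinearMap.BilinMap.baseChange R B (x 0) (mbc R n T (Fin.tail x)) := by
  rw [mbc_succ_tmul]
  generalize x 0 = z
  induction z with
  | zero => simp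
  | add y z hy hz => simp only [map_add, add_apply, LinearMap.add_apply, hy, hz]
  | tmul r v =>
    rw [LinearMap.liftBaseChange_tmul]
    have : mbc R n ((graft B T).curryLeft v) = ((B v).baseChange R).compMultilinearMap (mbc R n T) := by
      refine multilinear_ext_tmul fun x => ?_
      rw [mbc_one_tmul]
      simp [mbc_one_tmul, graft]
    rw [smul_apply, LinearMap.comp_apply, this, LinearMap.compMultilinearMap_apply]
    generalize mbc R n T (Fin.tail x) = w
    induction w with
    | zero => simp
    | add y z hy hz => simp only [map_add, smul_add, hy, hz]
    | tmul s u => simp [TensorProduct.smul_tmul']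

theorem mbc_ofSubsingleton (f : V →ₗ[K] V) (x : Fin 1 → R ⊗[K] V) :
    mbc R 1 (f.compMultilinearMap (MultilinearMap.ofSubsingleton K V V (0 : Fin 1) LinearMap.id)) x
      = f.baseChange R (x 0) := by
  have : mbc R 1 (f.compMultilinearMap
      (MultilinearMap.ofSubsingleton K V V (0 : Fin 1) LinearMap.id))
      = MultilinearMap.ofSubsingleton R (R ⊗[K] V) (R ⊗[K] V) (0 : Fin 1) (f.baseChange R) := by
    refine multilinear_ext_tmul fun x => ?_
    rw [mbc_one_tmul]
    simp
  rw [this]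
  rfl

end Mbc

/-! ### Degree signs after extension of scalars. -/

section Sign

variable {K : Type*} [Field K] {M : Type*} [AddCommGroup M] [Module K M] (𝓜 : DGLA K M)

theorem DGLA.sign_of_mem {i : ℤ} {x : M} (hx : x ∈ 𝓜.gr i) :
    𝓜.sign x = ((i.negOnePow : ℤ) : K) • x := degreeScale_of_mem _ _ _ hx

theorem DGLA.sign_sign (x : M) : 𝓜.sign (𝓜.sign x) = x := by
  induction x using 𝓜.induction_gr with
  | hadd x y hx hy => simp only [map_add, hx, hy]
  | h0 => simp
  | h i x hx =>
    rw [𝓜.sign_of_mem hx, map_smul, 𝓜.sign_of_mem hx, smul_smul]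
    rcases Int.even_or_odd i with h | h
    · simp [Int.negOnePow_even _ h]
    · simp [Int.negOnePow_odd _ h]

theorem baseChange_degreeScale {S : Type*} [CommRing S] [Algebra K S]
    {gr : ℤ → Submodule K M} (h : DirectSum.IsInternal gr) (c : ℤ → K) {i : ℤ} {J : Ideal S}
    {z : S ⊗[K] M} (hz : z ∈ ext J (gr i)) : (degreeScale gr h c).baseChange S z = c i • z := by
  induction hz using ext_induction with
  | h0 => simp
  | hadd x y _ _ hx hy => simp only [map_add, smul_add, hx, hy]
  | ht a _ x hx => simp [degreeScale_of_mem gr h c hx]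

end Sign

/-! ### The transferred operations -/

section ConeOperations

variable {K : Type*} [Field K] {L : Type*} [AddCommGroup L] [Module K L]
  {M : Type*} [AddCommGroup M] [Module K M] {𝓛 : DGLA K L} {𝓜 : DGLA K M} (χ : DGLA.Hom 𝓛 𝓜)

/-- The map `(l, m), (l', m') ↦ (0, -[± m, χ(l')] + [χ(l), m'])`. -/
noncomputable def coneB₀ : L × M →ₗ[K] L × M →ₗ[K] L × M :=
  (-(𝓜.bracket.compl₁₂ (𝓜.sign ∘ₗ LinearMap.snd K L M) (χ.toLin ∘ₗ LinearMap.fst K L M))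
    + 𝓜.bracket.compl₁₂ (χ.toLin ∘ₗ LinearMap.fst K L M) (LinearMap.snd K L M)).compr₂
      (LinearMap.inr K L M)

theorem coneB₀_apply (v w : L × M) : coneB₀ χ v w
    = (0, -𝓜.bracket (𝓜.sign v.2) (χ.toLin w.1) + 𝓜.bracket (χ.toLin v.1) w.2) := rfl

/-- The map `(l, m), (l', m') ↦ (0, -[± m, m'])`. -/
noncomputable def coneB (L : Type*) [AddCommGroup L] [Module K L] (𝓜 : DGLA K M) :
    L × M →ₗ[K] L × M →ₗ[K] L × M :=
  (-(𝓜.bracket.compl₁₂ (𝓜.sign ∘ₗ LinearMap.snd K L M) (LinearMap.snd K L M))).compr₂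
      (LinearMap.inr K L M)

theorem coneB_apply (v w : L × M) : coneB L 𝓜 v w = (0, -𝓜.bracket (𝓜.sign v.2) w.2) := rfl

/-- The map `(l, m), (l', m') ↦ ([± l, l'], 0)`. -/
noncomputable def coneBL (𝓛 : DGLA K L) (M : Type*) [AddCommGroup M] [Module K M] :
    L × M →ₗ[K] L × M →ₗ[K] L × M :=
  (𝓛.bracket.compl₁₂ (𝓛.sign ∘ₗ LinearMap.fst K L M) (LinearMap.fst K L M)).compr₂
      (LinearMap.inl K L M)

theorem coneBL_apply (v w : L × M) : coneBL 𝓛 M v w = (𝓛.bracket (𝓛.sign v.1) w.1, 0) := rfl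

/-- The identity as a multilinear map in one variable. -/
noncomputable def idMulti (K V : Type*) [Field K] [AddCommGroup V] [Module K V] :
    MultilinearMap K (fun _ : Fin 1 => V) V :=
  LinearMap.id.compMultilinearMap (MultilinearMap.ofSubsingleton K V V (0 : Fin 1) LinearMap.id)

/-- Nested brackets. -/
noncomputable def nest : (n : ℕ) → MultilinearMap K (fun _ : Fin (n + 2) => L × M) (L × M)
  | 0 => graft (coneB₀ χ) (idMulti K (L × M))
  | n + 1 => graft (coneB L 𝓜) (nest n)

/-- The summands of the transferred operations. -/
noncomputable def coneTree (n : ℕ) : MultilinearMap K (fun _ : Fin (n + 2) => L × M) (L × M) :=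
  graft ((q₂ 𝓛 𝓜 ∘ₗ coneι χ).compr₂ (coneπ K L M)) (comb χ n)

/-- Only the `dt`-part enters the homotopy and the `M`-component of `π`. It is a pure tensor with
polynomial factor `t`, which starts the separation of the variable from the brackets. -/
theorem q₂_snd_snd_ι (v w : L × M) : (q₂ 𝓛 𝓜 (coneι χ v) (coneι χ w)).2.2
    = Polynomial.X ⊗ₜ[K] (coneB₀ χ v w).2 := by
  change 𝓜.bracketR K[X] (-(𝓜.sign.baseChange K[X] (1 ⊗ₜ[K] v.2)))
      (Polynomial.X ⊗ₜ[K] χ.toLin w.1)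
    + 𝓜.bracketR K[X] (𝓜.sign.baseChange K[X] (𝓜.sign.baseChange K[X]
      (Polynomial.X ⊗ₜ[K] χ.toLin v.1))) (1 ⊗ₜ[K] w.2) = _
  rw [coneB₀_apply, map_neg, LinearMap.neg_apply]
  simp only [LinearMap.baseChange_tmul, DGLA.bracketR_tmul, 𝓜.sign_sign, one_mul, mul_one,
    TensorProduct.tmul_add, TensorProduct.tmul_neg]

/-- Against an element without `dt`-part only the term `dt m` of `ι v` contributes, and it is
constant in `t`; so the polynomial factor is unchanged. -/
theorem q₂_snd_snd_poly (v w : L × M) (p : K[X]) :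
    (q₂ 𝓛 𝓜 (coneι χ v) (0, (p ⊗ₜ[K] w.2, 0))).2.2 = p ⊗ₜ[K] (coneB L 𝓜 v w).2 := by
  change 𝓜.bracketR K[X] (-(𝓜.sign.baseChange K[X] (1 ⊗ₜ[K] v.2))) (p ⊗ₜ[K] w.2)
    + 𝓜.bracketR K[X] (𝓜.sign.baseChange K[X] (𝓜.sign.baseChange K[X]
      (Polynomial.X ⊗ₜ[K] χ.toLin v.1))) 0 = _
  rw [coneB_apply, map_neg, LinearMap.neg_apply]
  simp only [LinearMap.baseChange_tmul, DGLA.bracketR_tmul, map_zero, one_mul, add_zero,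
    TensorProduct.tmul_neg]

theorem integralM_tmul (p : K[X]) (m : M) :
    integralM K M (p ⊗ₜ[K] m) = Polynomial.aeval (1 : K) (primPoly (K := K) K p) • m := by
  simp only [integralM, integral, prim, evalAt, LinearMap.comp_apply, LinearMap.rTensor_tmul,
    push_tmul]
  rfl

theorem coneK_of_snd_snd {z : LMtdt K L M} {p : K[X]} {m : M} (h : z.2.2 = p ⊗ₜ[K] m) :
    coneK K L M z = (0, (homotopyPoly K p ⊗ₜ[K] m, 0)) := by
  change ((0 : L), (prim K M z.2.2 - Polynomial.X ⊗ₜ[K] integralM K M z.2.2,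
    (0 : K[X] ⊗[K] M))) = _
  rw [h, integralM_tmul, ← TensorProduct.smul_tmul]
  simp only [prim, LinearMap.rTensor_tmul, ← TensorProduct.sub_tmul]
  rfl

/-- Each level contributes one application of `homotopyPoly` and one bracket, starting from the
polynomial `t` at the innermost bracket. -/
theorem comb_succ (n : ℕ) (v : Fin (n + 2) → L × M) : comb χ (n + 1) v
    = (0, (((homotopyPoly K)^[n + 1] Polynomial.X) ⊗ₜ[K] (nest χ n v).2, 0)) := by
  induction n with
  | zero => exact coneK_of_snd_snd (q₂_snd_snd_ι χ _ _)
  | succ n ih =>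
    have h : comb χ (n + 1 + 1) v = coneK K L M (q₂ 𝓛 𝓜 (coneι χ (v 0))
      (comb χ (n + 1) (Fin.tail v))) := rfl
    rw [h, ih, coneK_of_snd_snd (q₂_snd_snd_poly χ _ _ _),
      ← Function.iterate_succ_apply' (homotopyPoly K)]
    rfl

theorem coneπ_of_snd_snd {z : LMtdt K L M} {p : K[X]} {m : M} (h : z.2.2 = p ⊗ₜ[K] m) :
    coneπ K L M z = (z.1, Polynomial.aeval (1 : K) (primPoly (K := K) K p) • m) := by
  change (z.1, integralM K M z.2.2) = _
  rw [h, integralM_tmul]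

theorem coneTree_zero : coneTree χ 0
    = coneCoeff K 0 • nest χ 0 + graft (coneBL 𝓛 M) (idMulti K (L × M)) := by
  refine MultilinearMap.ext fun v => ?_
  have h : coneTree χ 0 v = coneπ K L M (q₂ 𝓛 𝓜 (coneι χ (v 0)) (coneι χ (v 1))) := rfl
  rw [h, coneπ_of_snd_snd (q₂_snd_snd_ι χ _ _)]
  refine Prod.ext ?_ ?_
  · have : (nest χ 0 v).1 = 0 := rfl
    change _ = coneCoeff K 0 • (nest χ 0 v).1 + _
    rw [this, smul_zero]
    exact (zero_add _).symm
  · change _ = coneCoeff K 0 • (nest χ 0 v).2 + 0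
    rw [add_zero]
    rfl

theorem nest_fst (n : ℕ) (v : Fin (n + 2) → L × M) : (nest χ n v).1 = 0 := by
  cases n <;> rfl

/-- The homotopy kills the component in `L`, so the bracket of `L` survives only in the binary
operation, treated in `coneTree_zero`. -/
theorem coneTree_succ (n : ℕ) : coneTree χ (n + 1) = coneCoeff K (n + 1) • nest χ (n + 1) := by
  refine MultilinearMap.ext fun v => ?_
  have h : coneTree χ (n + 1) v = coneπ K L M (q₂ 𝓛 𝓜 (coneι χ (v 0))
    (comb χ (n + 1) (Fin.tail v))) := rfl
  rw [h, comb_succ, coneπ_of_snd_snd (q₂_snd_snd_poly χ _ _ _)]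
  refine Prod.ext ?_ rfl
  change 𝓛.bracket _ 0 = coneCoeff K (n + 1) • (nest χ (n + 1) v).1
  rw [nest_fst, smul_zero, map_zero]

theorem coneQ_succ_succ (n : ℕ) : coneQ χ (n + 2)
    = (2⁻¹ : K) • ∑ p : Fin (n + 2) → ZMod 2, ∑ σ : Equiv.Perm (Fin (n + 2)),
      koszulSign p σ • ((coneTree χ n).domDomCongr σ).compLinearMap
        fun i => coneParity 𝓛 𝓜 (p i) := rfl

variable {R : Type*} [CommRing R] [Algebra K R]

/-- The operations at vectors of given parity, of which at most one is odd. -/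
theorem mbc_coneQ (n : ℕ) (x : Fin (n + 2) → R ⊗[K] (L × M)) (p : Fin (n + 2) → ZMod 2)
    (hx : ∀ i q, (coneParity 𝓛 𝓜 q).baseChange R (x i) = if q = p i then x i else 0)
    (hp : ∀ i j, p i = 1 → p j = 1 → i = j) : mbc R (n + 2) (coneQ χ (n + 2)) x
      = (2⁻¹ : K) • ∑ σ : Equiv.Perm (Fin (n + 2)),
        mbc R (n + 2) (coneTree χ n) fun i => x (σ i) := by
  -- A sign needs two distinct odd entries.
  have hk : ∀ σ, koszulSign p σ = 1 := by
    intro σ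
    refine Finset.prod_eq_one fun i _ => Finset.prod_eq_one fun j _ => if_neg ?_
    rintro ⟨hij, -, h1, h2⟩
    exact hij.ne (σ.injective (hp _ _ h1 h2))
  rw [coneQ_succ_succ, map_smul, map_sum, smul_apply, sum_apply,
    Finset.sum_eq_single p]
  · congr 1
    rw [map_sum, sum_apply]
    refine Finset.sum_congr rfl fun σ _ => ?_
    rw [hk, one_smul, mbc_compLinearMap, mbc_domDomCongr]
    simp only [hx, if_true]
  · intro q _ hq
    obtain ⟨i, hi⟩ := Function.ne_iff.1 hq
    rw [map_sum, sum_apply]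
    refine Finset.sum_eq_zero fun σ _ => ?_
    rw [map_zsmul, smul_apply, mbc_compLinearMap]
    rw [MultilinearMap.map_coord_zero _ i, smul_zero]
    rw [hx, if_neg hi]
  · intro h
    exact absurd (Finset.mem_univ p) h

end ConeOperations

/-! ### Components of the transferred operations with extended scalars. -/

section ConeMaurerCartan

variable {K : Type*} [Field K] {L : Type*} [AddCommGroup L] [Module K L]
  {M : Type*} [AddCommGroup M] [Module K M] {𝓛 : DGLA K L} {𝓜 : DGLA K M} (χ : DGLA.Hom 𝓛 𝓜)
  {R : Type*} [CommRing R] [Algebra K R]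

/-- The first component of an element of `R ⊗ (L × M)`. -/
noncomputable abbrev fstR : R ⊗[K] (L × M) →ₗ[R] R ⊗[K] L := (LinearMap.fst K L M).baseChange R

/-- The second component of an element of `R ⊗ (L × M)`. -/
noncomputable abbrev sndR : R ⊗[K] (L × M) →ₗ[R] R ⊗[K] M := (LinearMap.snd K L M).baseChange R

theorem tensorProd_ext {z w : R ⊗[K] (L × M)} (h1 : fstR z = fstR w) (h2 : sndR z = sndR w) :
    z = w := by
  have key : ∀ z : R ⊗[K] (L × M), (LinearMap.inl K L M).baseChange R (fstR z)
      + (LinearMap.inr K L M).baseChange R (sndR z) = z := by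
    intro z
    induction z with
    | zero => simp
    | add x y hx hy =>
      rw [map_add, map_add, map_add, map_add]
      conv_rhs => rw [← hx, ← hy]
      abel
    | tmul r x => simp [← TensorProduct.tmul_add]
  rw [← key z, ← key w, h1, h2]

theorem sndR_coneB₀ (z w : R ⊗[K] (L × M)) :
    sndR (LinearMap.BilinMap.baseChange R (coneB₀ χ) z w)
      = -𝓜.adR (𝓜.sign.baseChange R (sndR z)) (χ.toLin.baseChange R (fstR w))
        + 𝓜.adR (χ.toLin.baseChange R (fstR z)) (sndR w) := by
  induction z with
  | zero => simp
  | add x y hx hy => simp only [map_add, LinearMap.add_apply, hx, hy, neg_add]; abel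
  | tmul r x =>
    induction w with
    | zero => simp
    | add x y hx hy => simp only [map_add, hx, hy, neg_add]; abel
    | tmul s y =>
      simp [coneB₀_apply, DGLA.adR_apply, DGLA.bracketR_tmul, TensorProduct.tmul_add,
        TensorProduct.tmul_neg]

theorem sndR_coneB (z w : R ⊗[K] (L × M)) :
    sndR (LinearMap.BilinMap.baseChange R (coneB L 𝓜) z w)
      = -𝓜.adR (𝓜.sign.baseChange R (sndR z)) (sndR w) := by
  induction z with
  | zero => simp
  | add x y hx hy => simp only [map_add, LinearMap.add_apply, hx, hy, neg_add]
  | tmul r x =>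
    induction w with
    | zero => simp
    | add x y hx hy => simp only [map_add, hx, hy, neg_add]
    | tmul s y =>
      simp [coneB_apply, DGLA.adR_apply, DGLA.bracketR_tmul, TensorProduct.tmul_neg]

theorem fstR_coneBL (z w : R ⊗[K] (L × M)) :
    fstR (LinearMap.BilinMap.baseChange R (coneBL 𝓛 M) z w)
      = 𝓛.adR (𝓛.sign.baseChange R (fstR z)) (fstR w) := by
  induction z with
  | zero => simp
  | add x y hx hy => simp only [map_add, LinearMap.add_apply, hx, hy]
  | tmul r x =>
    induction w with
    | zero => simp
    | add x y hx hy => simp only [map_add, hx, hy]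
    | tmul s y => simp [coneBL_apply, DGLA.adR_apply, DGLA.bracketR_tmul]

theorem sndR_coneBL (z w : R ⊗[K] (L × M)) :
    sndR (LinearMap.BilinMap.baseChange R (coneBL 𝓛 M) z w) = 0 := by
  induction z with
  | zero => simp
  | add x y hx hy => simp only [map_add, LinearMap.add_apply, hx, hy, add_zero]
  | tmul r x =>
    induction w with
    | zero => simp
    | add x y hx hy => simp only [map_add, hx, hy, add_zero]
    | tmul s y => simp [coneBL_apply]

theorem fstR_nest (n : ℕ) (x : Fin (n + 2) → R ⊗[K] (L × M)) :
    fstR (mbc R (n + 2) (nest χ n) x) = 0 := by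
  have : ((LinearMap.fst K L M).baseChange R).compMultilinearMap (mbc R (n + 2) (nest χ n))
      = 0 := by
    refine multilinear_ext_tmul fun x => ?_
    rw [LinearMap.compMultilinearMap_apply, mbc_one_tmul]
    simp [nest_fst]
  exact DFunLike.congr_fun this x

theorem mbc_idMulti (x : Fin 1 → R ⊗[K] (L × M)) : mbc R 1 (idMulti K (L × M)) x = x 0 := by
  rw [idMulti, mbc_ofSubsingleton]
  simp

theorem sndR_nest_zero (x : Fin 2 → R ⊗[K] (L × M)) : sndR (mbc R 2 (nest χ 0) x)
    = -𝓜.adR (𝓜.sign.baseChange R (sndR (x 0))) (χ.toLin.baseChange R (fstR (x 1)))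
        + 𝓜.adR (χ.toLin.baseChange R (fstR (x 0))) (sndR (x 1)) := by
  rw [nest, mbc_graft, mbc_idMulti, sndR_coneB₀]
  rfl

theorem sndR_nest_succ (n : ℕ) (x : Fin (n + 3) → R ⊗[K] (L × M)) :
    sndR (mbc R (n + 3) (nest χ (n + 1)) x) = -𝓜.adR (𝓜.sign.baseChange R (sndR (x 0)))
      (sndR (mbc R (n + 2) (nest χ n) (Fin.tail x))) := by
  rw [nest, mbc_graft, sndR_coneB]

/-! The values at `γ = (l, m)` of degree one, and the derivatives in the direction of an element
`y = (a, b)` of degree zero. -/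

section Values

variable {J : Ideal R} {γ y : R ⊗[K] (L × M)}

theorem fstR_mem {i : ℤ} (hγ : γ ∈ ext J (coneGr 𝓛 𝓜 i)) : fstR γ ∈ ext J (𝓛.gr i) :=
  baseChange_mem_ext _ (fun _ hx => (Submodule.mem_prod.1 hx).1) hγ

theorem sndR_mem {i j : ℤ} (hj : i - 1 = j) (hγ : γ ∈ ext J (coneGr 𝓛 𝓜 i)) :
    sndR γ ∈ ext J (𝓜.gr j) := by
  subst hj
  exact baseChange_mem_ext _ (fun _ hx => (Submodule.mem_prod.1 hx).2) hγ

theorem sign_baseChange (𝓜 : DGLA K M) {i : ℤ} {z : R ⊗[K] M} (hz : z ∈ ext J (𝓜.gr i)) :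
    𝓜.sign.baseChange R z = ((i.negOnePow : ℤ) : K) • z :=
  baseChange_degreeScale _ _ hz

/-- The innermost level gives `-[m, χ(l)] + [χ(l), m] = -2[m, χ(l)]`, and each further level applies
`-ad_m`. The factor `2` cancels the `½` of the operations. -/
theorem sndR_nest_const (hγ : γ ∈ ext J (coneGr 𝓛 𝓜 1)) (n : ℕ) :
    sndR (mbc R (n + 2) (nest χ n) fun _ => γ)
      = (2 * (-1) ^ (n + 1) : K) • (𝓜.adR (sndR γ) ^ (n + 1)) (χ.toLin.baseChange R (fstR γ)) := by
  have hm : sndR γ ∈ ext (⊤ : Ideal R) (𝓜.gr 0) := ext_mono le_top le_rfl (sndR_mem (by norm_num) hγ)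
  have hs : 𝓜.sign.baseChange R (sndR γ) = sndR γ := by simp [sign_baseChange 𝓜 hm]
  induction n with
  | zero =>
    rw [sndR_nest_zero, hs, ← neg_eq_iff_eq_neg.2 (𝓜.adR_skew hm _)]
    simp only [zero_add, pow_one]
    module
  | succ n ih =>
    rw [sndR_nest_succ, hs]
    change -(𝓜.adR (sndR γ)) (sndR (mbc R (n + 2) (nest χ n) fun _ => γ)) = _
    rw [ih, map_smul, pow_succ' (𝓜.adR (sndR γ)) (n + 1), Module.End.mul_apply]
    module

theorem update_const_succ {n : ℕ} (j : Fin (n + 1)) (z w : R ⊗[K] (L × M)) :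
    Fin.tail (Function.update (fun _ : Fin (n + 2) => z) j.succ w)
      = Function.update (fun _ => z) j w := by
  rw [Fin.tail_update_succ]
  rfl

/-- The product rule for the preceding formula, up to the signs caused by the odd degree of `b`: the
outer slot contributes `[b, ·]` instead of `-[b, ·]`, and `[χ(l), b] = [b, χ(l)]` doubles the
innermost term. -/
theorem sndR_sum_nest (hγ : γ ∈ ext J (coneGr 𝓛 𝓜 1)) (hy : y ∈ ext J (coneGr 𝓛 𝓜 0)) (n : ℕ) :
    ∑ i, sndR (mbc R (n + 2) (nest χ n) (Function.update (fun _ => γ) i y))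
      = (2 * (-1) ^ n : K) •
        (polar (𝓜.adR (sndR γ)) (𝓜.adR (sndR y)) (n + 1) (χ.toLin.baseChange R (fstR γ))
          - (𝓜.adR (sndR γ) ^ (n + 1)) (χ.toLin.baseChange R (fstR y))) := by
  have hm : sndR γ ∈ ext (⊤ : Ideal R) (𝓜.gr 0) := ext_mono le_top le_rfl (sndR_mem (by norm_num) hγ)
  have hs : 𝓜.sign.baseChange R (sndR γ) = sndR γ := by simp [sign_baseChange 𝓜 hm]
  have hb : sndR y ∈ ext (⊤ : Ideal R) (𝓜.gr (-1)) :=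
    ext_mono le_top le_rfl (sndR_mem (by norm_num) hy)
  have hsb : 𝓜.sign.baseChange R (sndR y) = -sndR y := by
    rw [sign_baseChange 𝓜 hb]
    simp only [Int.negOnePow_neg, Int.negOnePow_one, Units.val_neg, Units.val_one, Int.cast_neg,
      Int.cast_one]
    exact neg_one_smul K (sndR y)
  have hl : χ.toLin.baseChange R (fstR γ) ∈ ext (⊤ : Ideal R) (𝓜.gr 1) :=
    ext_mono le_top le_rfl (baseChange_mem_ext _ (fun x hx => χ.map_mem _ x hx) (fstR_mem hγ))
  induction n with
  | zero =>
    rw [Fin.sum_univ_two, sndR_nest_zero, sndR_nest_zero]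
    simp only [Function.update_self, ne_eq, one_ne_zero, zero_ne_one, not_false_eq_true,
      Function.update_of_ne, hs, hsb, map_neg, LinearMap.neg_apply, neg_neg, zero_add, pow_one,
      pow_zero, mul_one, polar, mul_zero]
    rw [𝓜.adR_comm_of_odd (by decide) hl hb, 𝓜.adR_skew hm (χ.toLin.baseChange R (fstR y)),
      two_smul]
    abel
  | succ n ih =>
    -- Either `y` sits in the outermost slot or further inside; this matches the recursion of
    -- `polar`.
    rw [Fin.sum_univ_succ, sndR_nest_succ, Function.update_self, hsb, Fin.tail_update_zero]
    have h1 : (Fin.tail fun _ : Fin (n + 3) => γ) = fun _ => γ := rfl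
    rw [h1, sndR_nest_const χ hγ]
    have hp : polar (𝓜.adR (sndR γ)) (𝓜.adR (sndR y)) (n + 1 + 1)
        = 𝓜.adR (sndR γ) * polar (𝓜.adR (sndR γ)) (𝓜.adR (sndR y)) (n + 1)
          + 𝓜.adR (sndR y) * 𝓜.adR (sndR γ) ^ (n + 1) := rfl
    have h2 : ∀ i : Fin (n + 2), sndR (mbc R (n + 3) (nest χ (n + 1))
        (Function.update (fun _ => γ) i.succ y))
        = -𝓜.adR (sndR γ) (sndR (mbc R (n + 2) (nest χ n) (Function.update (fun _ => γ) i y))) := by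
      intro i
      rw [sndR_nest_succ, update_const_succ, Function.update_of_ne (Fin.succ_ne_zero i).symm, hs]
    rw [Finset.sum_congr rfl fun i _ => h2 i, Finset.sum_neg_distrib, ← map_sum, ih, hp,
      LinearMap.add_apply, Module.End.mul_apply, Module.End.mul_apply,
      pow_succ' (𝓜.adR (sndR γ)) (n + 1), Module.End.mul_apply, pow_succ (-1 : K) n]
    simp only [map_smul, map_neg, map_sub, LinearMap.neg_apply]
    module

theorem coneParity_baseChange {i : ℤ} (hγ : γ ∈ ext J (coneGr 𝓛 𝓜 i)) (q : ZMod 2) :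
    (coneParity 𝓛 𝓜 q).baseChange R γ = if q = ((i - 1 : ℤ) : ZMod 2) then γ else 0 := by
  rw [coneParity, baseChange_degreeScale _ _ hγ]
  by_cases h : q = ((i - 1 : ℤ) : ZMod 2)
  · rw [if_pos h, if_pos h.symm, one_smul]
  · rw [if_neg h, if_neg (Ne.symm h), zero_smul]

/-- `γ` is even in `C_χ[1]`, so all permutations contribute equally and their number cancels the
factorial. -/
theorem mbc_coneQ_const [CharZero K] (hγ : γ ∈ ext J (coneGr 𝓛 𝓜 1)) (n : ℕ) :
    ((n + 2).factorial : K)⁻¹ • mbc R (n + 2) (coneQ χ (n + 2)) (fun _ => γ)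
      = (2⁻¹ : K) • mbc R (n + 2) (coneTree χ n) fun _ => γ := by
  rw [mbc_coneQ χ n (fun _ => γ) (fun _ => 0) (fun _ q => by
      rw [coneParity_baseChange hγ]; simp) (fun _ _ h => by simp at h),
    Finset.sum_const, Finset.card_univ, Fintype.card_perm, Fintype.card_fin,
    ← Nat.cast_smul_eq_nsmul K, smul_comm,
    inv_smul_smul₀ (Nat.cast_ne_zero.2 (Nat.factorial_ne_zero _))]

/-- With a single odd entry there are still no signs; a permutation only moves the slot of `y`, and
the sum over slots is invariant. -/
theorem sum_mbc_coneQ [CharZero K] (hγ : γ ∈ ext J (coneGr 𝓛 𝓜 1))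
    (hy : y ∈ ext J (coneGr 𝓛 𝓜 0)) (n : ℕ) :
    ((n + 2).factorial : K)⁻¹ •
      ∑ i, mbc R (n + 2) (coneQ χ (n + 2)) (Function.update (fun _ => γ) i y)
      = (2⁻¹ : K) • ∑ i, mbc R (n + 2) (coneTree χ n) (Function.update (fun _ => γ) i y) := by
  have h : ∀ i : Fin (n + 2), mbc R (n + 2) (coneQ χ (n + 2)) (Function.update (fun _ => γ) i y)
      = (2⁻¹ : K) • ∑ σ : Equiv.Perm (Fin (n + 2)),
        mbc R (n + 2) (coneTree χ n) (Function.update (fun _ => γ) (σ.symm i) y) := by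
    intro i
    rw [mbc_coneQ χ n _ (Function.update (fun _ => 0) i 1)]
    · congr 1
      refine Finset.sum_congr rfl fun σ _ => ?_
      congr 1
      exact Function.update_comp_equiv (fun _ => γ) σ i y
    · intro j q
      by_cases hj : j = i
      · subst hj
        rw [Function.update_self, Function.update_self, coneParity_baseChange hy]
        rfl
      · rw [Function.update_of_ne hj, Function.update_of_ne hj, coneParity_baseChange hγ]
        rfl
    · intro j k hj hk
      have key : ∀ j, (Function.update (fun _ => 0) i 1 : Fin (n + 2) → ZMod 2) j = 1 → j = i := by
        intro j hj
        by_contra h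
        rw [Function.update_of_ne h] at hj
        exact zero_ne_one hj
      rw [key j hj, key k hk]
  rw [Finset.sum_congr rfl fun i _ => h i, ← Finset.smul_sum, Finset.sum_comm]
  have h2 : ∀ σ : Equiv.Perm (Fin (n + 2)),
      ∑ i, mbc R (n + 2) (coneTree χ n) (Function.update (fun _ => γ) (σ.symm i) y)
        = ∑ i, mbc R (n + 2) (coneTree χ n) (Function.update (fun _ => γ) i y) := fun σ =>
    Equiv.sum_comp σ.symm fun i => mbc R (n + 2) (coneTree χ n) (Function.update (fun _ => γ) i y)
  rw [Finset.sum_congr rfl fun σ _ => h2 σ, Finset.sum_const, Finset.card_univ, Fintype.card_perm,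
    Fintype.card_fin, ← Nat.cast_smul_eq_nsmul K, smul_comm,
    inv_smul_smul₀ (Nat.cast_ne_zero.2 (Nat.factorial_ne_zero _))]

theorem sndR_coneTree (n : ℕ) (x : Fin (n + 2) → R ⊗[K] (L × M)) :
    sndR (mbc R (n + 2) (coneTree χ n) x) = coneCoeff K n • sndR (mbc R (n + 2) (nest χ n) x) := by
  cases n with
  | zero =>
    rw [coneTree_zero, map_add, map_smul, add_apply, smul_apply, map_add, mbc_graft, sndR_coneBL,
      add_zero]
    exact LinearMap.map_smul_of_tower _ _ _
  | succ n =>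
    rw [coneTree_succ, map_smul, smul_apply]
    exact LinearMap.map_smul_of_tower _ _ _

theorem fstR_coneTree_zero (x : Fin 2 → R ⊗[K] (L × M)) : fstR (mbc R 2 (coneTree χ 0) x)
    = 𝓛.adR (𝓛.sign.baseChange R (fstR (x 0))) (fstR (x 1)) := by
  rw [coneTree_zero, map_add, map_smul, add_apply, smul_apply, map_add, mbc_graft, fstR_coneBL,
    mbc_idMulti, LinearMap.map_smul_of_tower, fstR_nest, smul_zero, zero_add]
  rfl

theorem fstR_coneTree_succ (n : ℕ) (x : Fin (n + 3) → R ⊗[K] (L × M)) :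
    fstR (mbc R (n + 3) (coneTree χ (n + 1)) x) = 0 := by
  rw [coneTree_succ, map_smul, smul_apply, LinearMap.map_smul_of_tower, fstR_nest, smul_zero]

theorem fstR_coneQ_one (x : Fin 1 → R ⊗[K] (L × M)) :
    fstR (mbc R 1 (coneQ χ 1) x) = -𝓛.dR R (fstR (x 0)) := by
  rw [coneQ, mbc_ofSubsingleton]
  generalize x 0 = z
  induction z with
  | zero => simp
  | add x y hx hy => simp only [map_add, hx, hy, neg_add]
  | tmul r x => simp [coneQ₁, DGLA.dR_tmul, TensorProduct.tmul_neg]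

theorem sndR_coneQ_one (x : Fin 1 → R ⊗[K] (L × M)) : sndR (mbc R 1 (coneQ χ 1) x)
    = 𝓜.dR R (sndR (x 0)) - χ.toLin.baseChange R (fstR (x 0)) := by
  rw [coneQ, mbc_ofSubsingleton]
  generalize x 0 = z
  induction z with
  | zero => simp
  | add x y hx hy => simp only [map_add, hx, hy]; abel
  | tmul r x =>
    simp [coneQ₁, DGLA.dR_tmul, TensorProduct.tmul_neg, TensorProduct.tmul_add]
    abel

end Values

end ConeMaurerCartan

/-! ### The Maurer-Cartan equation of the cone and its linearization. -/

section ConeSums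

variable {K : Type*} [Field K] {L : Type*} [AddCommGroup L] [Module K L]
  {M : Type*} [AddCommGroup M] [Module K M] {𝓛 : DGLA K L} {𝓜 : DGLA K M} (χ : DGLA.Hom 𝓛 𝓜)
  {R : Type*} [CommRing R] [Algebra K R] {J : Ideal R} {γ y : R ⊗[K] (L × M)}

/-- The numerical factor is `½ · cₙ · 2(-1)^{n+1}`, the negative of the next coefficient of
`coneSeries`; the unary operation supplies `dm` and the constant term `1`. -/
theorem sndR_mcTerm [CharZero K] (hγ : γ ∈ ext J (coneGr 𝓛 𝓜 1)) (n : ℕ) :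
    sndR (((n + 1).factorial : K)⁻¹ • mbc R (n + 1) (coneQ χ (n + 1)) fun _ => γ)
      = (if n = 0 then 𝓜.dR R (sndR γ) else 0) - PowerSeries.coeff n (coneSeries K) •
        (𝓜.adR (sndR γ) ^ n) (χ.toLin.baseChange R (fstR γ)) := by
  cases n with
  | zero =>
    rw [LinearMap.map_smul_of_tower, sndR_coneQ_one]
    simp [coneSeries]
  | succ n =>
    rw [mbc_coneQ_const χ hγ, LinearMap.map_smul_of_tower, sndR_coneTree, sndR_nest_const χ hγ,
      if_neg (Nat.succ_ne_zero n), smul_smul, smul_smul, zero_sub]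
    have : (2⁻¹ : K) * coneCoeff K n * (2 * (-1) ^ (n + 1))
        = -PowerSeries.coeff (n + 1) (coneSeries K) := by
      simp only [coneSeries, PowerSeries.coeff_mk]
      ring
    rw [this]
    exact neg_smul _ _

theorem fstR_mcTerm_succ_succ [CharZero K] (hγ : γ ∈ ext J (coneGr 𝓛 𝓜 1)) (n : ℕ) :
    fstR (((n + 3).factorial : K)⁻¹ • mbc R (n + 3) (coneQ χ (n + 3)) fun _ => γ) = 0 := by
  rw [mbc_coneQ_const χ hγ, LinearMap.map_smul_of_tower, fstR_coneTree_succ, smul_zero]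

theorem fstR_mcTerm_one [CharZero K] (hγ : γ ∈ ext J (coneGr 𝓛 𝓜 1)) :
    fstR (((2).factorial : K)⁻¹ • mbc R 2 (coneQ χ 2) fun _ => γ)
      = -((2⁻¹ : K) • 𝓛.adR (fstR γ) (fstR γ)) := by
  have hs : 𝓛.sign.baseChange R (fstR γ) = -fstR γ := by
    rw [sign_baseChange 𝓛 (fstR_mem hγ)]
    simp only [Int.negOnePow_one, Units.val_neg, Units.val_one, Int.cast_neg, Int.cast_one]
    exact neg_one_smul K (fstR γ)
  rw [mbc_coneQ_const χ hγ 0, LinearMap.map_smul_of_tower, fstR_coneTree_zero, hs, map_neg,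
    LinearMap.neg_apply]
  module

theorem mcSum_eq_sum {N : ℕ} (hJ : J ^ N = ⊥) (hγ : γ ∈ ext J (coneGr 𝓛 𝓜 1)) :
    (cone χ).mcSum R γ = ∑ n ∈ Finset.range (N + 2),
      ((n + 1).factorial : K)⁻¹ • mbc R (n + 1) (coneQ χ (n + 1)) fun _ => γ := by
  refine finsum_eq_sum_of_support_subset _ fun n hn => ?_
  by_contra h'
  refine hn ?_
  have h2 : N + 2 ≤ n := by simpa using h'
  change _ • mbc R (n + 1) (coneQ χ (n + 1)) _ = _
  rw [eq_zero_of_mem_ext hJ (by omega : N ≤ n + 1)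
    (mbc_mem (n + 1) _ _ fun _ => ext_mono le_rfl le_top hγ), smul_zero]

theorem fstR_mcSum [CharZero K] (hJ : IsNilpotent J) (hγ : γ ∈ ext J (coneGr 𝓛 𝓜 1)) :
    fstR ((cone χ).mcSum R γ)
      = -(𝓛.dR R (fstR γ) + (2⁻¹ : K) • 𝓛.adR (fstR γ) (fstR γ)) := by
  obtain ⟨N, hN⟩ := hJ
  rw [mcSum_eq_sum χ hN hγ, map_sum, Finset.sum_range_succ', Finset.sum_range_succ',
    Finset.sum_eq_zero fun n _ => fstR_mcTerm_succ_succ χ hγ n]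
  rw [zero_add, fstR_mcTerm_one χ hγ, LinearMap.map_smul_of_tower, fstR_coneQ_one]
  simp

theorem sndR_mcSum [CharZero K] (hJ : IsNilpotent J) (hγ : γ ∈ ext J (coneGr 𝓛 𝓜 1)) :
    sndR ((cone χ).mcSum R γ) = 𝓜.dR R (sndR γ)
      - nilEval (𝓜.adR (sndR γ)) (coneSeries K) (χ.toLin.baseChange R (fstR γ)) := by
  obtain ⟨N, hN⟩ := hJ
  have hA : 𝓜.adR (sndR γ) ^ (N + 2) = 0 := pow_eq_zero_of_le (by omega)
    (𝓜.adR_pow_eq_zero hN (ext_le_top (sndR_mem rfl hγ)))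
  rw [mcSum_eq_sum χ hN hγ, map_sum, Finset.sum_congr rfl fun n _ => sndR_mcTerm χ hγ n,
    Finset.sum_sub_distrib, nilEval_apply hA, Finset.sum_ite_eq' _ 0 fun _ => 𝓜.dR R (sndR γ)]
  simp

/-- The terms of the derivative of the Maurer-Cartan equation at `γ` in the direction `y`. -/
noncomputable def linTerm (γ y : R ⊗[K] (L × M)) (n : ℕ) : R ⊗[K] (L × M) :=
  ((n + 1).factorial : K)⁻¹ •
    ∑ i, mbc R (n + 1) (coneQ χ (n + 1)) (Function.update (fun _ => γ) i y)

theorem linTerm_eq_zero {N n : ℕ} (hJ : J ^ N = ⊥) (hn : N ≤ n + 1)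
    (hγ : γ ∈ ext J (coneGr 𝓛 𝓜 1)) (hy : y ∈ ext J (coneGr 𝓛 𝓜 0)) :
    linTerm χ γ y n = 0 := by
  rw [linTerm, Finset.sum_eq_zero, smul_zero]
  intro i _
  refine eq_zero_of_mem_ext hJ hn (mbc_mem (n + 1) _ _ fun j => ?_)
  rcases eq_or_ne j i with rfl | hj
  · rw [Function.update_self]
    exact ext_le_top hy
  · rw [Function.update_of_ne hj]
    exact ext_le_top hγ

theorem sndR_linTerm [CharZero K] (hγ : γ ∈ ext J (coneGr 𝓛 𝓜 1))
    (hy : y ∈ ext J (coneGr 𝓛 𝓜 0)) (n : ℕ) :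
    sndR (linTerm χ γ y n) = (if n = 0 then 𝓜.dR R (sndR y) else 0)
      + (PowerSeries.coeff n (coneSeries K) •
          polar (𝓜.adR (sndR γ)) (𝓜.adR (sndR y)) n (χ.toLin.baseChange R (fstR γ))
        - PowerSeries.coeff n (coneSeries K) •
          (𝓜.adR (sndR γ) ^ n) (χ.toLin.baseChange R (fstR y))) := by
  cases n with
  | zero =>
    rw [linTerm, LinearMap.map_smul_of_tower, Fin.sum_univ_one, sndR_coneQ_one]
    simp [coneSeries, polar]
    abel
  | succ n =>
    rw [linTerm, sum_mbc_coneQ χ hγ hy, LinearMap.map_smul_of_tower, map_sum,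
      Finset.sum_congr rfl fun i _ => sndR_coneTree χ n _, ← Finset.smul_sum,
      sndR_sum_nest χ hγ hy, if_neg (Nat.succ_ne_zero n), smul_smul, smul_smul, zero_add]
    have : (2⁻¹ : K) * coneCoeff K n * (2 * (-1) ^ n)
        = PowerSeries.coeff (n + 1) (coneSeries K) := by
      simp only [coneSeries, PowerSeries.coeff_mk]
      ring
    rw [this]
    exact smul_sub _ _ _

theorem fstR_linTerm_succ_succ [CharZero K] (hγ : γ ∈ ext J (coneGr 𝓛 𝓜 1))
    (hy : y ∈ ext J (coneGr 𝓛 𝓜 0))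
    (n : ℕ) : fstR (linTerm χ γ y (n + 2)) = 0 := by
  rw [linTerm, sum_mbc_coneQ χ hγ hy, LinearMap.map_smul_of_tower, map_sum,
    Finset.sum_eq_zero fun i _ => fstR_coneTree_succ χ n _, smul_zero]

theorem fstR_linTerm_one [CharZero K] (hγ : γ ∈ ext J (coneGr 𝓛 𝓜 1))
    (hy : y ∈ ext J (coneGr 𝓛 𝓜 0)) :
    fstR (linTerm χ γ y 1) = 𝓛.adR (fstR y) (fstR γ) := by
  have ha : fstR y ∈ ext (⊤ : Ideal R) (𝓛.gr 0) := ext_mono le_top le_rfl (fstR_mem hy)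
  have hs : 𝓛.sign.baseChange R (fstR γ) = -fstR γ := by
    rw [sign_baseChange 𝓛 (fstR_mem hγ)]
    simp only [Int.negOnePow_one, Units.val_neg, Units.val_one, Int.cast_neg, Int.cast_one]
    exact neg_one_smul K (fstR γ)
  have hs' : 𝓛.sign.baseChange R (fstR y) = fstR y := by simp [sign_baseChange 𝓛 ha]
  rw [linTerm, sum_mbc_coneQ χ hγ hy 0, LinearMap.map_smul_of_tower, map_sum, Fin.sum_univ_two,
    fstR_coneTree_zero, fstR_coneTree_zero]
  simp only [Function.update_self, ne_eq, one_ne_zero, zero_ne_one, not_false_eq_true,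
    Function.update_of_ne, hs, hs', map_neg, LinearMap.neg_apply]
  rw [← 𝓛.adR_skew ha]
  module

theorem fstR_linTerm_zero : fstR (linTerm χ γ y 0) = -𝓛.dR R (fstR y) := by
  rw [linTerm, LinearMap.map_smul_of_tower, Fin.sum_univ_one, fstR_coneQ_one]
  simp

theorem fstR_sum_linTerm [CharZero K] (hγ : γ ∈ ext J (coneGr 𝓛 𝓜 1))
    (hy : y ∈ ext J (coneGr 𝓛 𝓜 0)) (T : ℕ) :
    fstR (∑ n ∈ Finset.range (T + 2), linTerm χ γ y n)
      = 𝓛.adR (fstR y) (fstR γ) - 𝓛.dR R (fstR y) := by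
  rw [map_sum, Finset.sum_range_succ', Finset.sum_range_succ',
    Finset.sum_eq_zero fun n _ => fstR_linTerm_succ_succ χ hγ hy n, zero_add,
    fstR_linTerm_one χ hγ hy, fstR_linTerm_zero, sub_eq_add_neg]

/-- Apart from the sign due to the odd degree of `b`, this is the linear part of `dm - f(ad_m) χ(l)`
in the direction `(a, b)`. -/
theorem sndR_sum_linTerm [CharZero K] {N T : ℕ} (hJ : J ^ N = ⊥) (hT : N + N ≤ T)
    (hγ : γ ∈ ext J (coneGr 𝓛 𝓜 1)) (hy : y ∈ ext J (coneGr 𝓛 𝓜 0)) :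
    sndR (∑ n ∈ Finset.range (T + 2), linTerm χ γ y n) = 𝓜.dR R (sndR y)
      + (linEval (𝓜.adR (sndR γ)) (𝓜.adR (sndR y)) (coneSeries K) (χ.toLin.baseChange R (fstR γ))
        - nilEval (𝓜.adR (sndR γ)) (coneSeries K) (χ.toLin.baseChange R (fstR y))) := by
  have hA : 𝓜.adR (sndR γ) ^ N = 0 := 𝓜.adR_pow_eq_zero hJ (ext_le_top (sndR_mem rfl hγ))
  rw [map_sum, Finset.sum_congr rfl fun n _ => sndR_linTerm χ hγ hy n, Finset.sum_add_distrib,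
    Finset.sum_sub_distrib, linEval_eq_sum hA (hT.trans (Nat.le_add_right T 2)),
    nilEval_apply (pow_eq_zero_of_le (by omega : N ≤ T + 2) hA),
    Finset.sum_ite_eq' _ 0 fun _ => 𝓜.dR R (sndR y)]
  simp [LinearMap.sum_apply]

end ConeSums

/-! ### The Maurer-Cartan equation for paths in the cone. -/

section ConePaths

variable {K : Type*} [Field K] {L : Type*} [AddCommGroup L] [Module K L]
  {M : Type*} [AddCommGroup M] [Module K M] {𝓛 : DGLA K L} {𝓜 : DGLA K M} (χ : DGLA.Hom 𝓛 𝓜)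
  {R : Type*} [CommRing R] [Algebra K R] {J : Ideal R[X]} {x y : R[X] ⊗[K] (L × M)}

theorem qTdt_cone (hx : x ∈ ext J (coneGr 𝓛 𝓜 1)) (n : ℕ) :
    ((n + 1).factorial : K)⁻¹ • (cone χ).qTdt R (n + 1) (fun _ => (x, y))
      = (((n + 1).factorial : K)⁻¹ • mbc R[X] (n + 1) (coneQ χ (n + 1)) fun _ => x,
        -linTerm χ x y n - if n = 0 then deriv R (L × M) x else 0) := by
  -- `x` has degree `0` in the shifted space, so moving `dt` past it costs no sign and the `dt`-part
  -- is the sum over all positions of `y`.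
  have hs : (cone χ).sign.baseChange R[X] x = x := by
    refine (baseChange_degreeScale (cone χ).isInternal _ hx).trans ?_
    simp
  refine Prod.ext rfl ?_
  change _ • (_ - _) = _
  have h : ∀ i : Fin (n + 1), (fun j => if j < i then (cone χ).sign.baseChange R[X] x
      else if j = i then y else x) = Function.update (fun _ => x) i y := by
    intro i
    funext j
    rw [hs, Function.update_apply]
    split_ifs with h1 h2 <;> first | rfl | exact absurd h2 h1.ne
  simp only [h]
  rw [smul_sub, smul_neg]
  congr 1
  cases n with
  | zero => simp
  | succ n => simp

theorem mcSumTdt_cone {N : ℕ} (hJ : J ^ N = ⊥) (hx : x ∈ ext J (coneGr 𝓛 𝓜 1))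
    (hy : y ∈ ext J (coneGr 𝓛 𝓜 0)) : (cone χ).mcSumTdt R (x, y)
      = ((cone χ).mcSum R[X] x, -(∑ n ∈ Finset.range (N + N + 2), linTerm χ x y n)
        - deriv R (L × M) x) := by
  have h : (cone χ).mcSumTdt R (x, y) = ∑ n ∈ Finset.range (N + N + 2),
      ((n + 1).factorial : K)⁻¹ • (cone χ).qTdt R (n + 1) fun _ => (x, y) := by
    refine finsum_eq_sum_of_support_subset _ fun n hn => ?_
    by_contra h'
    refine hn ?_
    have h2 : N + N + 2 ≤ n := by simpa using h'
    change _ • (cone χ).qTdt R (n + 1) (fun _ => (x, y)) = _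
    rw [qTdt_cone χ hx, linTerm_eq_zero χ hJ (by omega) hx hy, if_neg (by omega),
      eq_zero_of_mem_ext hJ (by omega : N ≤ n + 1)
      (mbc_mem (n + 1) _ _ fun _ => ext_mono le_rfl le_top hx)]
    simp
  rw [h, Finset.sum_congr rfl fun n _ => qTdt_cone χ hx n]
  refine Prod.ext ?_ ?_
  · rw [Prod.fst_sum]
    exact (finsum_eq_sum_of_support_subset _ fun n hn => by
      by_contra h'
      refine hn ?_
      have h2 : N + N + 2 ≤ n := by simpa using h'
      change _ • mbc R[X] (n + 1) (coneQ χ (n + 1)) _ = _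
      rw [eq_zero_of_mem_ext hJ (by omega : N ≤ n + 1)
        (mbc_mem (n + 1) _ _ fun _ => ext_mono le_rfl le_top hx), smul_zero]).symm
  · rw [Prod.snd_sum]
    simp only [Finset.sum_sub_distrib, Finset.sum_neg_distrib]
    rw [Finset.sum_ite_eq' _ 0 fun _ => deriv R (L × M) x]
    simp

end ConePaths

/-! ### Applying `φ(ad_m)` to the equations of the cone. -/

section Flatness

variable {K : Type*} [Field K] {M : Type*} [AddCommGroup M] [Module K M]
  (𝓜 : DGLA K M) {S : Type*} [CommRing S] [Algebra K S] {I : Ideal S}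

/-- The operator `(z, c) ↦ ([b, z] + c db, 0)`. -/
noncomputable def oddAffine :
    S ⊗[K] M →ₗ[K] Module.End K ((S ⊗[K] M) × K) where
  toFun b := (𝓜.adR b ∘ₗ LinearMap.fst K _ _
    + LinearMap.toSpanSingleton K _ (𝓜.dK b) ∘ₗ LinearMap.snd K _ _).prod 0
  map_add' b b' := by
    refine LinearMap.ext fun x => Prod.ext ?_ ?_
    · change 𝓜.adR (b + b') x.1 + x.2 • 𝓜.dK (b + b') = (𝓜.adR b x.1 + x.2 • 𝓜.dK b)
        + (𝓜.adR b' x.1 + x.2 • 𝓜.dK b')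
      rw [map_add, map_add, LinearMap.add_apply, smul_add]
      abel
    · exact (add_zero (0 : K)).symm
  map_smul' c b := by
    refine LinearMap.ext fun x => Prod.ext ?_ ?_
    · change 𝓜.adR (c • b) x.1 + x.2 • 𝓜.dK (c • b) = c • (𝓜.adR b x.1 + x.2 • 𝓜.dK b)
      rw [map_smul, map_smul, LinearMap.smul_apply, smul_add, smul_comm c x.2]
    · exact (smul_zero c).symm

theorem oddAffine_apply (b : S ⊗[K] M) (x : (S ⊗[K] M) × K) :
    oddAffine 𝓜 b x = (𝓜.adR b x.1 + x.2 • 𝓜.dR S b, 0) := rfl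

/-- The translation part is `[m, db] + [b, dm] = d[m, b]`, which uses that `dm` and `b` have odd
degree. The plus sign in `oddAffine` is thus forced. -/
theorem affine_oddAffine_commutator {m b : S ⊗[K] M} (hm : m ∈ ext (⊤ : Ideal S) (𝓜.gr 0))
    (hb : b ∈ ext (⊤ : Ideal S) (𝓜.gr (-1))) :
    𝓜.affine 𝓜.dK m * oddAffine 𝓜 b - oddAffine 𝓜 b * 𝓜.affine 𝓜.dK m
      = oddAffine 𝓜 (𝓜.adR m b) := by
  refine LinearMap.ext fun x => Prod.ext ?_ ?_
  · change (𝓜.adR m (𝓜.adR b x.1 + x.2 • 𝓜.dR S b) - (0 : K) • 𝓜.dR S m)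
      - (𝓜.adR b (𝓜.adR m x.1 - x.2 • 𝓜.dR S m) + (0 : K) • 𝓜.dR S b)
      = 𝓜.adR (𝓜.adR m b) x.1 + x.2 • 𝓜.dR S (𝓜.adR m b)
    rw [zero_smul, zero_smul, map_add, map_sub, map_smul, map_smul, 𝓜.adR_jacobi hm, 𝓜.dR_adR hm,
      𝓜.adR_comm_of_odd (by decide) (𝓜.dR_mem (zero_add 1) hm) hb]
    module
  · exact sub_zero (0 : K)

theorem polar_affine_oddAffine (m b : S ⊗[K] M) (n : ℕ) :
    polar (𝓜.affine 𝓜.dK m) (oddAffine 𝓜 b) (n + 1) (0, 1)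
      = ((𝓜.adR m ^ n) (𝓜.dR S b) - polar (𝓜.adR m) (𝓜.adR b) n (𝓜.dR S m), 0) := by
  induction n with
  | zero => simp [polar, oddAffine_apply]
  | succ n ih =>
    have h : polar (𝓜.affine 𝓜.dK m) (oddAffine 𝓜 b) (n + 1 + 1) (0, 1)
        = 𝓜.affine 𝓜.dK m (polar (𝓜.affine 𝓜.dK m) (oddAffine 𝓜 b) (n + 1) (0, 1))
          + oddAffine 𝓜 b ((𝓜.affine 𝓜.dK m ^ (n + 1)) (0, 1)) := rfl
    have h' : polar (𝓜.adR m) (𝓜.adR b) (n + 1) (𝓜.dR S m)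
        = 𝓜.adR m (polar (𝓜.adR m) (𝓜.adR b) n (𝓜.dR S m))
          + 𝓜.adR b ((𝓜.adR m ^ n) (𝓜.dR S m)) := rfl
    have hp : (𝓜.adR m ^ (n + 1)) (𝓜.dR S b) = 𝓜.adR m ((𝓜.adR m ^ n) (𝓜.dR S b)) := by
      rw [pow_succ']
      rfl
    rw [h, ih, 𝓜.affine_pow_succ, h', hp,
      DGLA.affine_apply, oddAffine_apply]
    refine Prod.ext ?_ (add_zero _)
    change (𝓜.adR m _ - (0 : K) • _) + (𝓜.adR b (_ - (1 : K) • _) + (0 : K) • _) = _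
    rw [zero_smul, zero_smul, one_smul, map_zero, zero_sub, map_neg, 𝓜.dK_apply]
    change 𝓜.adR m (_ - _) - 0 + (_ + 0) = _
    rw [map_sub]
    abel_nf

/-- Duhamel's formula in the affine representation for `δ = d`, with the odd direction `b`, applied
to `(0, 1)`. One side gives `φ(ad_m) db` minus the linear part of `φ(ad_m) dm`; on the other, the
operator of `φ(ad_m) b` acts on `e^m (0, 1) = (-φ(ad_m) dm, 1)`. -/
theorem dR_phiS [CharZero K] (hI : IsNilpotent I) {m b : S ⊗[K] M} (hm : m ∈ ext I (𝓜.gr 0))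
    (hb : b ∈ ext (⊤ : Ideal S) (𝓜.gr (-1))) :
    𝓜.dR S (nilEval (𝓜.adR m) (phiS K) b) = nilEval (𝓜.adR m) (phiS K) (𝓜.dR S b)
      - linEval (𝓜.adR m) (𝓜.adR b) (phiS K) (𝓜.dR S m)
      + 𝓜.adR (nilEval (𝓜.adR m) (phiS K) b) (nilEval (𝓜.adR m) (phiS K) (𝓜.dR S m)) := by
  have hm' : m ∈ ext (⊤ : Ideal S) (𝓜.gr 0) := ext_mono le_top le_rfl hm
  have hn := 𝓜.adR_isNilpotent hI (ext_le_top hm)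
  have h := linEval_exp_eq (E := Module.End K ((S ⊗[K] M) × K)) (𝓜.affine_isNilpotent 𝓜.dK hn) hn
    (oddAffine 𝓜) (P := fun z => z ∈ ext (⊤ : Ideal S) (𝓜.gr (-1)))
    (fun z hz => ext_mono le_top le_rfl (𝓜.adR_mem (by norm_num) hm' hz))
    (fun z hz => affine_oddAffine_commutator 𝓜 hm' hz) hb
  have h1 := congrArg Prod.fst (LinearMap.congr_fun h (0, 1))
  obtain ⟨N, hN⟩ := 𝓜.affine_isNilpotent 𝓜.dK hn
  obtain ⟨N', hN'⟩ := hn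
  have hN2 : 𝓜.affine 𝓜.dK m ^ (N + N') = 0 := pow_eq_zero_of_le (by omega) hN
  have hN'2 : 𝓜.adR m ^ (N + N') = 0 := pow_eq_zero_of_le (by omega) hN'
  have hN'3 : 𝓜.adR m ^ (N + N' + (N + N')) = 0 := pow_eq_zero_of_le (by omega) hN'
  rw [Module.End.mul_apply, 𝓜.exp_affine 𝓜.dK ⟨N', hN'⟩, oddAffine_apply,
    linEval_eq_sum (T := N + N' + (N + N') + 1) hN2 (Nat.le_succ _), LinearMap.sum_apply,
    Finset.sum_range_succ', Prod.fst_add, Prod.fst_sum] at h1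
  have h0 : polar (𝓜.affine 𝓜.dK m) (oddAffine 𝓜 b) 0 = 0 := rfl
  simp only [LinearMap.smul_apply, polar_affine_oddAffine, h0, Prod.smul_fst] at h1
  simp only [smul_sub, Finset.sum_sub_distrib, one_smul, map_zero, zero_sub, map_neg,
    LinearMap.zero_apply, Prod.fst_zero, smul_zero, add_zero] at h1
  have e1 : ∑ n ∈ Finset.range (N + N' + (N + N')), PowerSeries.coeff (n + 1) (expS K) •
      (𝓜.adR m ^ n) (𝓜.dR S b) = nilEval (𝓜.adR m) (phiS K) (𝓜.dR S b) := by
    rw [nilEval_apply hN'3]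
    simp [expS, phiS]
  have e2 : ∑ n ∈ Finset.range (N + N' + (N + N')), PowerSeries.coeff (n + 1) (expS K) •
      polar (𝓜.adR m) (𝓜.adR b) n (𝓜.dR S m)
        = linEval (𝓜.adR m) (𝓜.adR b) (phiS K) (𝓜.dR S m) := by
    rw [linEval_eq_sum hN'2 le_rfl, LinearMap.sum_apply]
    simp [expS, phiS]
  rw [e1, e2, DGLA.logDer, 𝓜.dK_apply] at h1
  rw [h1]
  abel

theorem phiS_coneSeries [CharZero K] {A : Module.End K (S ⊗[K] M)} (hA : IsNilpotent A) (z : S ⊗[K] M) :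
    nilEval A (phiS K) (nilEval A (coneSeries K) z) = nilEval A (expS K) z := by
  rw [← nilEval_mul_apply hA, mul_comm, coneSeries_mul_phiS]

theorem phiInv_phiS [CharZero K] {A : Module.End K (S ⊗[K] M)} (hA : IsNilpotent A) (z : S ⊗[K] M) :
    nilEval A (phiInv K) (nilEval A (phiS K) z) = z := by
  rw [← nilEval_mul_apply hA, phiInv_mul_phiS, nilEval_one]
  rfl

theorem phiS_phiInv [CharZero K] {A : Module.End K (S ⊗[K] M)} (hA : IsNilpotent A) (z : S ⊗[K] M) :
    nilEval A (phiS K) (nilEval A (phiInv K) z) = z := by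
  rw [← nilEval_mul_apply hA, phiS_mul_phiInv, nilEval_one]
  rfl

theorem phiS_injective [CharZero K] {A : Module.End K (S ⊗[K] M)} (hA : IsNilpotent A) {z w : S ⊗[K] M}
    (h : nilEval A (phiS K) z = nilEval A (phiS K) w) : z = w := by
  rw [← phiInv_phiS hA z, h, phiInv_phiS hA]

/-- The Maurer-Cartan equation of the cone is the gauge equation. -/
theorem gauge_eq_zero_iff [CharZero K] (hI : IsNilpotent I) {m : S ⊗[K] M} (hm : m ∈ ext I (𝓜.gr 0))
    (z : S ⊗[K] M) :
    gauge 𝓜 S m z = 0 ↔ nilEval (𝓜.adR m) (coneSeries K) z = 𝓜.dR S m := by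
  have hn := 𝓜.adR_isNilpotent hI (ext_le_top hm)
  rw [gauge_eq 𝓜 hn, ← phiS_coneSeries hn, sub_eq_zero, DGLA.logDer, 𝓜.dK_apply]
  exact ⟨fun h => phiS_injective hn h, fun h => by rw [h]⟩

/-- Linearizing `φ f = exp` at `η`, where `f(ad_m) η = dm`, expresses `φ` times the linear part of
`f` as `[φ(ad_m) b, φ(ad_m) dm]` minus the linear part of `φ` at `dm`. These are the correction
terms of `dR_phiS`, so only an exact term and `e^{ad_m} ζ` remain. -/
theorem phiS_linear_part [CharZero K] (hI : IsNilpotent I) {m b : S ⊗[K] M} (hm : m ∈ ext I (𝓜.gr 0))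
    (hb : b ∈ ext (⊤ : Ideal S) (𝓜.gr (-1))) {η : S ⊗[K] M} (ζ : S ⊗[K] M)
    (hη : nilEval (𝓜.adR m) (coneSeries K) η = 𝓜.dR S m) :
    nilEval (𝓜.adR m) (phiS K) (𝓜.dR S b + (linEval (𝓜.adR m) (𝓜.adR b) (coneSeries K) η
        - nilEval (𝓜.adR m) (coneSeries K) ζ))
      = 𝓜.dR S (nilEval (𝓜.adR m) (phiS K) b) - nilEval (𝓜.adR m) (expS K) ζ := by
  have hm' : m ∈ ext (⊤ : Ideal S) (𝓜.gr 0) := ext_mono le_top le_rfl hm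
  have hn := 𝓜.adR_isNilpotent hI (ext_le_top hm)
  have h1 := LinearMap.congr_fun (linEval_mul (E := Module.End K (S ⊗[K] M)) hn (𝓜.adR b) (phiS K)
    (coneSeries K)) η
  rw [mul_comm (phiS K), coneSeries_mul_phiS, linEval_exp_eq (E := Module.End K (S ⊗[K] M)) hn hn
    𝓜.adR (P := fun _ => True) (fun _ _ => trivial) (fun z _ => by
      refine LinearMap.ext fun x => ?_
      change 𝓜.adR m (𝓜.adR z x) - 𝓜.adR z (𝓜.adR m x) = _
      rw [𝓜.adR_jacobi hm', add_sub_cancel_right]) trivial, LinearMap.add_apply,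
    Module.End.mul_apply, Module.End.mul_apply, Module.End.mul_apply, hη,
    ← phiS_coneSeries hn, hη] at h1
  rw [dR_phiS 𝓜 hI hm hb, map_add, map_sub, phiS_coneSeries hn, h1]
  abel

end Flatness

/-! ### Gauge transformations under morphisms, evaluation and differentiation. -/

section GaugeLemmas

variable {K : Type*} [Field K] {L : Type*} [AddCommGroup L] [Module K L]
  {M : Type*} [AddCommGroup M] [Module K M] {𝓛 : DGLA K L} {𝓜 : DGLA K M} (χ : DGLA.Hom 𝓛 𝓜)
  {S : Type*} [CommRing S] [Algebra K S] {I : Ideal S}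

theorem DGLA.Hom.map_nilEval_adR (hI : IsNilpotent I) {u : S ⊗[K] L}
    (hu : u ∈ ext I (⊤ : Submodule K L)) (f : PowerSeries K) (z : S ⊗[K] L) :
    χ.toLin.baseChange S (nilEval (𝓛.adR u) f z)
      = nilEval (𝓜.adR (χ.toLin.baseChange S u)) f (χ.toLin.baseChange S z) :=
  nilEval_intertwine (𝓛.adR_isNilpotent hI hu) (𝓜.adR_isNilpotent hI
    (baseChange_mem_ext _ (fun _ _ => Submodule.mem_top) hu))
    ((χ.toLin.baseChange S).restrictScalars K) (P := fun _ => True) (fun _ _ => trivial)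
    (fun z _ => χ.map_adR u z) f trivial

theorem DGLA.Hom.map_gauge [CharZero K] (hI : IsNilpotent I) {u : S ⊗[K] L}
    (hu : u ∈ ext I (⊤ : Submodule K L)) (z : S ⊗[K] L) :
    χ.toLin.baseChange S (gauge 𝓛 S u z)
      = gauge 𝓜 S (χ.toLin.baseChange S u) (χ.toLin.baseChange S z) := by
  rw [gauge_eq 𝓛 (𝓛.adR_isNilpotent hI hu), gauge_eq 𝓜 (𝓜.adR_isNilpotent hI
    (baseChange_mem_ext _ (fun _ _ => Submodule.mem_top) hu)), map_sub, χ.map_nilEval_adR hI hu,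
    DGLA.logDer, χ.map_nilEval_adR hI hu, 𝓛.dK_apply, χ.map_dR]
  rfl

theorem DGLA.Hom.map_mem_ext {i : ℤ} {u : S ⊗[K] L} (hu : u ∈ ext I (𝓛.gr i)) :
    χ.toLin.baseChange S u ∈ ext I (𝓜.gr i) :=
  baseChange_mem_ext _ (fun x hx => χ.map_mem _ x hx) hu

theorem gauge_zero_left (𝓜 : DGLA K M) (z : S ⊗[K] M) : gauge 𝓜 S 0 z = z := by
  have : ∀ n : ℕ, ((n + 1).factorial : K)⁻¹ •
      (𝓜.bracketR S 0)^[n] (𝓜.bracketR S 0 z - 𝓜.dR S 0) = 0 := by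
    intro n
    have h : 𝓜.bracketR S 0 z - 𝓜.dR S 0 = 0 := by simp
    rw [h, ← 𝓜.adR_pow_apply, (𝓜.adR (0 : S ⊗[K] M) ^ n).map_zero, smul_zero]
  rw [gauge, finsum_eq_zero_of_forall_eq_zero this, add_zero]

theorem gauge_zero_of_closed (𝓜 : DGLA K M) {u : S ⊗[K] M} (hu : 𝓜.dR S u = 0) :
    gauge 𝓜 S u 0 = 0 := by
  have : ∀ n : ℕ, ((n + 1).factorial : K)⁻¹ •
      (𝓜.bracketR S u)^[n] (𝓜.bracketR S u 0 - 𝓜.dR S u) = 0 := by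
    intro n
    rw [map_zero, hu, sub_zero, ← 𝓜.adR_pow_apply, map_zero, smul_zero]
  rw [gauge, finsum_eq_zero_of_forall_eq_zero this, add_zero]

theorem dR_nilEval_adR_of_closed (𝓜 : DGLA K M) (hI : IsNilpotent I) {u : S ⊗[K] M}
    (hu : u ∈ ext I (𝓜.gr 0)) (hdu : 𝓜.dR S u = 0) (f : PowerSeries K) (z : S ⊗[K] M) :
    𝓜.dR S (nilEval (𝓜.adR u) f z) = nilEval (𝓜.adR u) f (𝓜.dR S z) := by
  have hn := 𝓜.adR_isNilpotent hI (ext_le_top hu)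
  refine nilEval_intertwine hn hn 𝓜.dK (P := fun _ => True) (fun _ _ => trivial) (fun z _ => ?_) f
    trivial
  rw [𝓜.dK_apply, 𝓜.dR_adR (ext_mono le_top le_rfl hu), hdu, map_zero, LinearMap.zero_apply,
    zero_add, 𝓜.dK_apply]

variable {R : Type*} [CommRing R] [Algebra K R] {J : Ideal R}

theorem bch_zero_right (𝓜 : DGLA K M) (a : R ⊗[K] M) : bch 𝓜 R a 0 = a := by
  have hz : bchU 𝓜 R a 0 0 = 0 := by
    have h : ∀ (S : Type _) [CommRing S] [Algebra K S] (u : S ⊗[K] M), expAd 𝓜 S u 0 = 0 := by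
      intro S _ _ u
      refine finsum_eq_zero_of_forall_eq_zero fun n => ?_
      rw [← 𝓜.adR_pow_apply, map_zero, smul_zero]
    rw [bchU, h, h, sub_zero]
  rw [bch, map_zero]
  simp only [Function.iterate_fixed hz, smul_zero, finsum_zero, sub_zero, map_zero, add_zero]

theorem logDer_const (𝓜 : DGLA K M) (z : R ⊗[K] M) : 𝓜.logDer (deriv R M) (const R M z) = 0 := by
  rw [DGLA.logDer, deriv_const, map_zero]

theorem DGLA.Hom.map_logDer (hJ : IsNilpotent J) {u : R[X] ⊗[K] L}
    (hu : u ∈ ext (polyIdeal J) (⊤ : Submodule K L)) :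
    χ.toLin.baseChange R[X] (𝓛.logDer (deriv R L) u)
      = 𝓜.logDer (deriv R M) (χ.toLin.baseChange R[X] u) := by
  rw [DGLA.logDer, DGLA.logDer, χ.map_nilEval_adR (polyIdeal_isNilpotent hJ) hu, deriv_baseChange]

theorem evalAt_gauge (𝓜 : DGLA K M) (hJ : IsNilpotent J) (r : R) {u : R[X] ⊗[K] M}
    (hu : u ∈ ext (polyIdeal J) (⊤ : Submodule K M)) (z : R[X] ⊗[K] M) :
    evalAt R M r (gauge 𝓜 R[X] u z) = gauge 𝓜 R (evalAt R M r u) (evalAt R M r z) := by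
  obtain ⟨N, hN⟩ := polyIdeal_isNilpotent hJ
  exact gauge_push _ 𝓜 hN hu z

theorem const_gauge (𝓜 : DGLA K M) (hJ : IsNilpotent J) {u : R ⊗[K] M}
    (hu : u ∈ ext J (⊤ : Submodule K M)) (z : R ⊗[K] M) :
    const R M (gauge 𝓜 R u z) = gauge 𝓜 R[X] (const R M u) (const R M z) := by
  obtain ⟨N, hN⟩ := hJ
  exact gauge_push _ 𝓜 hN hu z

theorem evalAt_bch (𝓜 : DGLA K M) (hJ : IsNilpotent J) (r : R) {u v : R[X] ⊗[K] M}
    (hu : u ∈ ext (polyIdeal J) (⊤ : Submodule K M))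
    (hv : v ∈ ext (polyIdeal J) (⊤ : Submodule K M)) :
    evalAt R M r (bch 𝓜 R[X] u v) = bch 𝓜 R (evalAt R M r u) (evalAt R M r v) := by
  obtain ⟨N, hN⟩ := polyIdeal_isNilpotent hJ
  exact bch_push _ 𝓜 hN hu hv

theorem evalAt_adR (𝓜 : DGLA K M) (r : R) (u v : R[X] ⊗[K] M) :
    evalAt R M r (𝓜.adR u v) = 𝓜.adR (evalAt R M r u) (evalAt R M r v) :=
  bracketR_push _ 𝓜 u v

theorem evalAt_X_smul_const (r : R) (z : R ⊗[K] M) :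
    evalAt R M r ((Polynomial.X : R[X]) • const R M z) = r • z := by
  rw [evalAt_smul, evalAt_const, Polynomial.eval_X]

/-- Duhamel's formula `DGLA.derivation_exp_affine` for `δ = d` and `D = d/dt`, on the constant
vector `(z, 1)`. -/
theorem deriv_gauge [CharZero K] (𝓜 : DGLA K M) (hJ : IsNilpotent J) {u : R[X] ⊗[K] M}
    (hu : u ∈ ext (polyIdeal J) (𝓜.gr 0)) (z : R ⊗[K] M) :
    deriv R M (gauge 𝓜 R[X] u (const R M z))
      = 𝓜.adR (𝓜.logDer (deriv R M) u) (gauge 𝓜 R[X] u (const R M z))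
        - 𝓜.dR R[X] (𝓜.logDer (deriv R M) u) := by
  have hn := 𝓜.adR_isNilpotent (polyIdeal_isNilpotent hJ) (ext_le_top hu)
  have h := 𝓜.derivation_exp_affine 𝓜.isDer_dR 𝓜.isDer_deriv
    (fun z => deriv_baseChange 𝓜.d z) (ext_mono le_top le_rfl hu)
    (ext_mono le_top le_rfl (deriv_mem hu)) hn (const R M z, 1)
  have hz : (deriv R M).prodMap (0 : K →ₗ[K] K) (const R M z, 1) = 0 :=
    Prod.ext (deriv_const z) rfl
  rw [hz, map_zero (nilEval (𝓜.affine 𝓜.dK u) (expS K)), add_zero, 𝓜.exp_affine _ hn,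
    DGLA.affine_apply] at h
  have h1 := congrArg Prod.fst h
  simp only [one_smul, LinearMap.prodMap_apply] at h1
  rw [gauge_eq 𝓜 hn, ← 𝓜.dK_apply]
  exact h1

/-- The cocycle rule for `e^c e^{m₀} e^{-χ(g)}`: the constant factor contributes nothing, and the
derivative of `e^{-χ(g)}` is moved to the far right of the product, whence the adjoint exponential
of the whole. -/
theorem logDer_deriv_path [CharZero K] (hJ : IsNilpotent J) {c : R[X] ⊗[K] M} {m₀ : R ⊗[K] M}
    {g : R[X] ⊗[K] L} (hc : c ∈ ext (polyIdeal J) (𝓜.gr 0)) (hm₀ : m₀ ∈ ext J (𝓜.gr 0))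
    (hg : g ∈ ext (polyIdeal J) (𝓛.gr 0)) :
    𝓜.logDer (deriv R M) (bch 𝓜 R[X] (bch 𝓜 R[X] c (const R M m₀)) (-(χ.toLin.baseChange R[X] g)))
      = 𝓜.logDer (deriv R M) c - nilEval (𝓜.adR (bch 𝓜 R[X] (bch 𝓜 R[X] c (const R M m₀))
          (-(χ.toLin.baseChange R[X] g)))) (expS K)
            (χ.toLin.baseChange R[X] (𝓛.logDer (deriv R L) g)) := by
  have hI := polyIdeal_isNilpotent hJ
  have hp := bch_mem_gr hI hc (const_mem hm₀)
  have hχg := χ.map_mem_ext hg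
  rw [logDer_deriv_bch hI hp (Submodule.neg_mem _ hχg), logDer_deriv_bch hI hc (const_mem hm₀),
    logDer_const, map_zero, add_zero, logDer_neg _ hI hχg, ← χ.map_logDer hJ (ext_le_top hg),
    expAd_bch hI hp (Submodule.neg_mem _ hχg), sub_eq_add_neg]
  congr 1
  exact map_neg _ _

end GaugeLemmas

/-! ### Homotopies and gauge equivalences. -/

section HomotopyGauge

variable {K : Type*} [Field K] [CharZero K] {L : Type*} [AddCommGroup L] [Module K L]
  {M : Type*} [AddCommGroup M] [Module K M] {𝓛 : DGLA K L} {𝓜 : DGLA K M} (χ : DGLA.Hom 𝓛 𝓜)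
  {R : Type*} [CommRing R] [Algebra K R] {I : Ideal R}

theorem mcSum_eq_zero_iff {S : Type*} [CommRing S] [Algebra K S] {J : Ideal S}
    (hJ : IsNilpotent J) {γ : S ⊗[K] (L × M)} (hγ : γ ∈ ext J (coneGr 𝓛 𝓜 1)) :
    (cone χ).mcSum S γ = 0 ↔
      𝓛.dR S (fstR γ) + (2⁻¹ : K) • 𝓛.adR (fstR γ) (fstR γ) = 0 ∧
      gauge 𝓜 S (sndR γ) (χ.toLin.baseChange S (fstR γ)) = 0 := by
  rw [gauge_eq_zero_iff 𝓜 hJ (sndR_mem rfl hγ)]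
  constructor
  · intro h
    constructor
    · have := fstR_mcSum χ hJ hγ
      rw [h, map_zero] at this
      exact neg_eq_zero.1 this.symm
    · have := sndR_mcSum χ hJ hγ
      rw [h, map_zero] at this
      exact (sub_eq_zero.1 this.symm).symm
  · rintro ⟨h1, h2⟩
    refine tensorProd_ext ?_ ?_
    · rw [fstR_mcSum χ hJ hγ, h1, neg_zero, map_zero]
    · rw [sndR_mcSum χ hJ hγ, h2, sub_self, map_zero]

/-- The Maurer-Cartan equation in the algebra of paths, in terms of logarithmic derivatives. -/
theorem mcSumTdt_eq_zero_iff (hI : IsNilpotent I) {x y : R[X] ⊗[K] (L × M)}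
    (hx : x ∈ ext (polyIdeal I) (coneGr 𝓛 𝓜 1)) (hy : y ∈ ext (polyIdeal I) (coneGr 𝓛 𝓜 0)) :
    (cone χ).mcSumTdt R (x, y) = 0 ↔ (cone χ).mcSum R[X] x = 0 ∧
      deriv R L (fstR x) = 𝓛.dR R[X] (fstR y) - 𝓛.adR (fstR y) (fstR x) ∧
      𝓜.logDer (deriv R M) (sndR x)
        = nilEval (𝓜.adR (sndR x)) (expS K) (χ.toLin.baseChange R[X] (fstR y))
          - 𝓜.dR R[X] (nilEval (𝓜.adR (sndR x)) (phiS K) (sndR y)) := by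
  have hJ := polyIdeal_isNilpotent hI
  have hm : sndR x ∈ ext (polyIdeal I) (𝓜.gr 0) := sndR_mem rfl hx
  have hb : sndR y ∈ ext (⊤ : Ideal R[X]) (𝓜.gr (-1)) :=
    ext_mono le_top le_rfl (sndR_mem rfl hy)
  have hn := 𝓜.adR_isNilpotent hJ (ext_le_top hm)
  obtain ⟨N, hN⟩ := hJ
  rw [mcSumTdt_cone χ hN hx hy, Prod.mk_eq_zero]
  refine and_congr_right fun hmc => ?_
  -- The Maurer-Cartan equation along the path supplies `f(ad_m) χ(l) = dm`, without which the
  -- linearized equation would not simplify.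
  have hη := (gauge_eq_zero_iff 𝓜 ⟨N, hN⟩ hm _).1 ((mcSum_eq_zero_iff χ ⟨N, hN⟩ hx).1 hmc).2
  have h1 := fstR_sum_linTerm χ hx hy (N + N)
  have h2 := sndR_sum_linTerm χ hN le_rfl hx hy
  have h3 := phiS_linear_part 𝓜 ⟨N, hN⟩ hm hb (χ.toLin.baseChange R[X] (fstR y)) hη
  rw [← h2] at h3
  have hd1 : fstR (deriv R (L × M) x) = deriv R L (fstR x) := (deriv_baseChange _ x).symm
  have hd2 : sndR (deriv R (L × M) x) = deriv R M (sndR x) := (deriv_baseChange _ x).symm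
  generalize ∑ n ∈ Finset.range (N + N + 2), linTerm χ x y n = s at h1 h3
  constructor
  · intro h
    have hs : deriv R (L × M) x = -s := (sub_eq_zero.1 h).symm
    constructor
    · rw [← hd1, hs, map_neg, h1]
      abel
    · rw [DGLA.logDer, ← hd2, hs, map_neg, map_neg, h3]
      abel
  · rintro ⟨h4, h5⟩
    rw [sub_eq_zero]
    refine tensorProd_ext ?_ (phiS_injective hn ?_)
    · rw [hd1, h4, map_neg, h1]
      abel
    · rw [DGLA.logDer] at h5
      rw [hd2, h5, map_neg, map_neg, h3]
      abel

/-- The infinitesimal gauge transformations `a`, `b` are integrated to paths `g`, `c` from `0`;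
uniqueness for differential equations then identifies `l` and `m` with the transforms of their
initial values. Here `b` stands for `φ(ad_m)` applied to the `M`-part of the `dt`-component. -/
theorem exists_gauge_of_path (hI : IsNilpotent I) {l a : R[X] ⊗[K] L} {m b : R[X] ⊗[K] M}
    (hm : m ∈ ext (polyIdeal I) (𝓜.gr 0)) (ha : a ∈ ext (polyIdeal I) (𝓛.gr 0))
    (hb : b ∈ ext (polyIdeal I) (𝓜.gr (-1)))
    (hl' : deriv R L l = 𝓛.dR R[X] a - 𝓛.adR a l)
    (hm' : 𝓜.logDer (deriv R M) m = nilEval (𝓜.adR m) (expS K) (χ.toLin.baseChange R[X] a)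
      - 𝓜.dR R[X] b) :
    ∃ a' ∈ ext I (𝓛.gr 0), ∃ b' ∈ ext I (𝓜.gr (-1)),
      evalAt R L 1 l = gauge 𝓛 R a' (evalAt R L 0 l) ∧
      evalAt R M 1 m = bch 𝓜 R (bch 𝓜 R (𝓜.dR R b') (evalAt R M 0 m))
        (-(χ.toLin.baseChange R a')) := by
  have hJ := polyIdeal_isNilpotent hI
  obtain ⟨g, hg, hg0, hg'⟩ := (DGLA.isODE_id (𝓜 := 𝓛) hI (Submodule.zero_mem _)
    (Submodule.neg_mem _ ha)).exists_solution hI (Submodule.zero_mem _)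
  obtain ⟨c, hc, hc0, hc'⟩ := (DGLA.isODE_dK (𝓜 := 𝓜) (I := I)
    (Submodule.neg_mem _ hb)).exists_solution hI (Submodule.zero_mem _)
  rw [map_zero, zero_add, LinearMap.id_apply] at hg'
  change 𝓛.logDer (deriv R L) g = -a at hg'
  have hdc : 𝓜.dR R[X] c ∈ ext (polyIdeal I) (𝓜.gr 0) := 𝓜.dR_mem (by norm_num) hc
  -- As `dc` is closed, `d` commutes with `φ(ad_{dc})`; so this is `d` applied to the equation of
  -- `c`.
  have hdc' : 𝓜.logDer (deriv R M) (𝓜.dR R[X] c) = -𝓜.dR R[X] b := by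
    rw [DGLA.logDer, DGLA.dR, deriv_baseChange]
    change nilEval (𝓜.adR (𝓜.dR R[X] c)) (phiS K) (𝓜.dR R[X] (deriv R M c)) = _
    rw [← dR_nilEval_adR_of_closed 𝓜 hJ hdc (𝓜.dR_dR c)]
    rw [𝓜.dK_apply] at hc'
    rw [hc', map_neg]
    rfl
  have hm0 : const R M (evalAt R M 0 m) ∈ ext (polyIdeal I) (𝓜.gr 0) := const_mem (evalAt_mem 0 hm)
  have hχg : -(χ.toLin.baseChange R[X] g) ∈ ext (polyIdeal I) (𝓜.gr 0) :=
    Submodule.neg_mem _ (χ.map_mem_ext hg)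
  have hp := bch_mem_gr hJ hdc hm0
  have hev : ∀ r : R, evalAt R M r (bch 𝓜 R[X] (bch 𝓜 R[X] (𝓜.dR R[X] c)
      (const R M (evalAt R M 0 m))) (-(χ.toLin.baseChange R[X] g)))
      = bch 𝓜 R (bch 𝓜 R (𝓜.dR R (evalAt R M r c)) (evalAt R M 0 m))
        (-(χ.toLin.baseChange R (evalAt R L r g))) := by
    intro r
    rw [evalAt_bch 𝓜 hI r (ext_le_top hp) (ext_le_top hχg),
      evalAt_bch 𝓜 hI r (ext_le_top hdc) (ext_le_top hm0), evalAt_const, map_neg,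
      evalAt_baseChange, DGLA.dR, evalAt_baseChange]
    rfl
  have hmeq : m = bch 𝓜 R[X] (bch 𝓜 R[X] (𝓜.dR R[X] c) (const R M (evalAt R M 0 m)))
      (-(χ.toLin.baseChange R[X] g)) := by
    -- Both paths satisfy `φ(ad_u) u' = e^{ad_u} χ(a) - db` with the same value at `0`.
    refine (DGLA.isODE_id hI (χ.map_mem_ext ha) (Submodule.neg_mem _
      (𝓜.dR_mem (by norm_num) hb))).unique hI hm (bch_mem_gr hJ hp hχg) ?_ ?_ ?_
    · rw [hev, hc0, hg0, map_zero, map_zero, neg_zero, bch_zero_right 𝓜,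
        bch_zero_left hI (evalAt_mem 0 hm)]
    · rw [← sub_eq_add_neg]
      exact hm'
    · refine (logDer_deriv_path χ hI hdc (evalAt_mem 0 hm) hg).trans ?_
      rw [hdc', hg', (χ.toLin.baseChange R[X]).map_neg, LinearMap.map_neg (nilEval _ _)]
      abel
  have hleq : l = gauge 𝓛 R[X] g (const R L (evalAt R L 0 l)) := by
    rw [← sub_eq_zero]
    -- Both paths solve the same affine equation, so their difference `z` satisfies `z' = [-a, z]`
    -- and starts at `0`.
    refine eq_zero_of_deriv_eq_adR hI (ext_le_top (Submodule.neg_mem _ ha)) (𝓜 := 𝓛) ?_ ?_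
    · rw [map_sub, hl', deriv_gauge 𝓛 hI hg, hg', map_sub, map_neg, map_neg, LinearMap.neg_apply,
        LinearMap.neg_apply]
      abel
    · rw [map_sub, evalAt_gauge 𝓛 hI 0 (ext_le_top hg), hg0, gauge_zero_left, evalAt_const, sub_self]
  refine ⟨evalAt R L 1 g, evalAt_mem 1 hg, evalAt R M 1 c, evalAt_mem 1 hc, ?_, ?_⟩
  · conv_lhs => rw [hleq]
    rw [evalAt_gauge 𝓛 hI 1 (ext_le_top hg), evalAt_const]
  · conv_lhs => rw [hmeq]
    exact hev 1

/-- Gauge transformations along a path preserve the Maurer-Cartan equation. -/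
theorem maurerCartan_of_deriv (hI : IsNilpotent I) {l : R[X] ⊗[K] L} {a : R[X] ⊗[K] L}
    (hl : l ∈ ext (polyIdeal I) (𝓛.gr 1)) (ha : a ∈ ext (polyIdeal I) (𝓛.gr 0))
    (hl' : deriv R L l = 𝓛.adR a l - 𝓛.dR R[X] a)
    (h0 : 𝓛.dR R (evalAt R L 0 l) + (2⁻¹ : K) • 𝓛.adR (evalAt R L 0 l) (evalAt R L 0 l) = 0) :
    𝓛.dR R[X] l + (2⁻¹ : K) • 𝓛.adR l l = 0 := by
  have ha' := ext_mono (le_top (a := polyIdeal I)) le_rfl ha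
  have hl1 := ext_mono (le_top (a := polyIdeal I)) le_rfl hl
  -- The curvature `F = dl + ½[l, l]` satisfies the linear equation `F' = [a, F]`.
  refine eq_zero_of_deriv_eq_adR hI (ext_le_top ha) (𝓜 := 𝓛) ?_ ?_
  · have hc : 𝓛.adR l (deriv R L l) = 𝓛.adR (deriv R L l) l :=
      𝓛.adR_comm_of_odd (by decide) hl1 (ext_mono le_top le_rfl (deriv_mem hl))
    have hc2 : 𝓛.adR l (𝓛.adR a l) = 𝓛.adR (𝓛.adR a l) l :=
      𝓛.adR_comm_of_odd (by decide) hl1 (ext_mono le_top le_rfl (𝓛.adR_mem (zero_add 1) ha' hl1))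
    have hd : deriv R L (𝓛.dR R[X] l) = 𝓛.dR R[X] (deriv R L l) := deriv_baseChange _ _
    rw [map_add, map_smul, deriv_adR, hc, hd, hl', map_add, map_smul, 𝓛.adR_jacobi ha', hc2,
      map_sub, map_sub, LinearMap.sub_apply, 𝓛.dR_dR, 𝓛.dR_adR ha']
    module
  · rw [map_add, map_smul, evalAt_adR 𝓛, DGLA.dR, evalAt_baseChange]
    exact h0

/-- The transformations are scaled by `t`: `l = e^{t a} * l₀` and `e^m = e^{t db} e^{m₀} e^{-t
χ(a)}`. -/
theorem exists_path_of_gauge (hI : IsNilpotent I) {l₀ a : R ⊗[K] L} {m₀ b : R ⊗[K] M}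
    (hl₀ : l₀ ∈ ext I (𝓛.gr 1)) (hm₀ : m₀ ∈ ext I (𝓜.gr 0)) (ha : a ∈ ext I (𝓛.gr 0))
    (hb : b ∈ ext I (𝓜.gr (-1)))
    (h1 : 𝓛.dR R l₀ + (2⁻¹ : K) • 𝓛.adR l₀ l₀ = 0)
    (h2 : gauge 𝓜 R m₀ (χ.toLin.baseChange R l₀) = 0) :
    ∃ l ∈ ext (polyIdeal I) (𝓛.gr 1), ∃ m ∈ ext (polyIdeal I) (𝓜.gr 0),
    ∃ a' ∈ ext (polyIdeal I) (𝓛.gr 0), ∃ b' ∈ ext (polyIdeal I) (𝓜.gr (-1)),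
      (𝓛.dR R[X] l + (2⁻¹ : K) • 𝓛.adR l l = 0 ∧
        gauge 𝓜 R[X] m (χ.toLin.baseChange R[X] l) = 0) ∧
      (deriv R L l = 𝓛.dR R[X] a' - 𝓛.adR a' l ∧
        𝓜.logDer (deriv R M) m = nilEval (𝓜.adR m) (expS K) (χ.toLin.baseChange R[X] a')
          - 𝓜.dR R[X] (nilEval (𝓜.adR m) (phiS K) b')) ∧
      (evalAt R L 0 l = l₀ ∧ evalAt R M 0 m = m₀) ∧
      evalAt R L 1 l = gauge 𝓛 R a l₀ ∧
      evalAt R M 1 m = bch 𝓜 R (bch 𝓜 R (𝓜.dR R b) m₀) (-(χ.toLin.baseChange R a)) := by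
  have hJ := polyIdeal_isNilpotent hI
  have hdb : 𝓜.dR R b ∈ ext I (𝓜.gr 0) := 𝓜.dR_mem (by norm_num) hb
  have hg := X_smul_const_mem (I := I) ha
  have hc := X_smul_const_mem (I := I) hdb
  have hm0 : const R M m₀ ∈ ext (polyIdeal I) (𝓜.gr 0) := const_mem hm₀
  set g := (Polynomial.X : R[X]) • const R L a
  set c := (Polynomial.X : R[X]) • const R M (𝓜.dR R b)
  have hχg : -(χ.toLin.baseChange R[X] g) ∈ ext (polyIdeal I) (𝓜.gr 0) :=
    Submodule.neg_mem _ (χ.map_mem_ext hg)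
  have hp := bch_mem_gr hJ hc hm0
  have hm := bch_mem_gr hJ hp hχg
  set m := bch 𝓜 R[X] (bch 𝓜 R[X] c (const R M m₀)) (-(χ.toLin.baseChange R[X] g))
  have hnm := 𝓜.adR_isNilpotent hJ (ext_le_top hm)
  have hev : ∀ r : R, evalAt R M r m = bch 𝓜 R (bch 𝓜 R (r • 𝓜.dR R b) m₀)
      (-(χ.toLin.baseChange R (r • a))) := by
    intro r
    rw [evalAt_bch 𝓜 hI r (ext_le_top hp) (ext_le_top hχg),
      evalAt_bch 𝓜 hI r (ext_le_top hc) (ext_le_top hm0), evalAt_const, map_neg,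
      evalAt_baseChange, evalAt_X_smul_const, evalAt_X_smul_const]
  have hng := 𝓛.adR_isNilpotent hJ (ext_le_top hg)
  have hl0 : const R L l₀ ∈ ext (polyIdeal I) (𝓛.gr 1) := const_mem hl₀
  have hgr : gauge 𝓛 R[X] g (const R L l₀) ∈ ext (polyIdeal I) (𝓛.gr 1) := by
    rw [gauge_eq 𝓛 hng]
    have hg' := ext_mono (le_top (a := polyIdeal I)) le_rfl hg
    exact Submodule.sub_mem _ (nilEval_adR_mem 𝓛 hng hg' hl0 _)
      (nilEval_adR_mem 𝓛 hng hg' (𝓛.dR_mem (zero_add 1) hg) _)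
  have hlog : 𝓛.logDer (deriv R L) g = const R L a := logDer_X_smul_const 𝓛 hI ha
  have hl' := deriv_gauge 𝓛 hI hg l₀
  rw [hlog] at hl'
  have hevl : ∀ r : R, evalAt R L r (gauge 𝓛 R[X] g (const R L l₀)) = gauge 𝓛 R (r • a) l₀ := by
    intro r
    rw [evalAt_gauge 𝓛 hI r (ext_le_top hg), evalAt_const, evalAt_X_smul_const]
  have hb' : -const R M b ∈ ext (polyIdeal I) (𝓜.gr (-1)) := Submodule.neg_mem _ (const_mem hb)
  -- The `dt`-part is `(-a, φ(ad_m)^{-1}(-b))`: the signs come from the sign convention of the path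
  -- equations, and `φ(ad_m)^{-1}` undoes the factor in them.
  refine ⟨gauge 𝓛 R[X] g (const R L l₀), hgr, m, hm, -const R L a,
    Submodule.neg_mem _ (const_mem ha), nilEval (𝓜.adR m) (phiInv K) (-const R M b),
    nilEval_adR_mem 𝓜 hnm (ext_mono le_top le_rfl hm) hb' _, ⟨?_, ?_⟩, ⟨?_, ?_⟩, ⟨?_, ?_⟩, ?_, ?_⟩
  · refine maurerCartan_of_deriv hI hgr (const_mem ha) hl' ?_
    rw [hevl, zero_smul, gauge_zero_left, h1]
  · have hdc : 𝓜.dR R[X] c = 0 := by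
      rw [map_smul, DGLA.dR, const_baseChange]
      change Polynomial.X • const R M (𝓜.dR R (𝓜.dR R b)) = 0
      rw [𝓜.dR_dR, map_zero, smul_zero]
    -- `e^{-χ(g)}` undoes the transformation of `χ(l₀)`, then `e^{m₀}` sends `χ(l₀)` to `0`, and
    -- `e^{t db}` fixes `0` because `t db` is closed.
    rw [gauge_bch hJ hp hχg, χ.map_gauge hJ (ext_le_top hg), gauge_neg_gauge hJ (χ.map_mem_ext hg),
      gauge_bch hJ hc hm0, const_baseChange, ← const_gauge 𝓜 hI (ext_le_top hm₀), h2, map_zero,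
      gauge_zero_of_closed 𝓜 hdc]
  · rw [hl', map_neg, map_neg, LinearMap.neg_apply]
    abel
  · rw [phiS_phiInv hnm, logDer_deriv_path χ hI hc hm₀ hg, hlog, logDer_X_smul_const 𝓜 hI hdb,
      (χ.toLin.baseChange R[X]).map_neg, LinearMap.map_neg (nilEval _ _), (𝓜.dR R[X]).map_neg,
      show 𝓜.dR R[X] (const R M b) = const R M (𝓜.dR R b) from const_baseChange _ _]
    change _ - nilEval (𝓜.adR m) (expS K) _ = _
    abel
  · rw [hevl, zero_smul, gauge_zero_left]
  · rw [hev, zero_smul, zero_smul, map_zero, neg_zero, bch_zero_right 𝓜, bch_zero_left hI hm₀]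
  · rw [hevl, one_smul]
  · rw [hev, one_smul, one_smul]

end HomotopyGauge

/-! ### The isomorphism of deformation functors. -/

section Main

variable {K : Type u} [Field K]
    {L : Type v₁} [AddCommGroup L] [Module K L] {M : Type v₂} [AddCommGroup M] [Module K M]
    {𝓛 : DGLA K L} {𝓜 : DGLA K M} (χ : DGLA.Hom 𝓛 𝓜)

/-- The element of `R ⊗ (L × M)` with given components. -/
noncomputable def pairR {R : Type*} [CommRing R] [Algebra K R] (l : R ⊗[K] L) (m : R ⊗[K] M) :
    R ⊗[K] (L × M) :=
  (LinearMap.inl K L M).baseChange R l + (LinearMap.inr K L M).baseChange R m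

theorem fstR_pairR {R : Type*} [CommRing R] [Algebra K R] (l : R ⊗[K] L) (m : R ⊗[K] M) :
    fstR (pairR l m) = l := by
  have h1 : ∀ l : R ⊗[K] L, fstR ((LinearMap.inl K L M).baseChange R l) = l := fun l => by
    rw [← LinearMap.comp_apply, ← LinearMap.baseChange_comp]; simp
  have h2 : ∀ m : R ⊗[K] M, fstR ((LinearMap.inr K L M).baseChange R m) = 0 := fun l => by
    rw [← LinearMap.comp_apply, ← LinearMap.baseChange_comp]; simp
  rw [pairR, map_add, h1, h2, add_zero]

theorem sndR_pairR {R : Type*} [CommRing R] [Algebra K R] (l : R ⊗[K] L) (m : R ⊗[K] M) :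
    sndR (pairR l m) = m := by
  have h1 : ∀ l : R ⊗[K] L, sndR ((LinearMap.inl K L M).baseChange R l) = 0 := fun l => by
    rw [← LinearMap.comp_apply, ← LinearMap.baseChange_comp]; simp
  have h2 : ∀ m : R ⊗[K] M, sndR ((LinearMap.inr K L M).baseChange R m) = m := fun l => by
    rw [← LinearMap.comp_apply, ← LinearMap.baseChange_comp]; simp
  rw [pairR, map_add, h1, h2, zero_add]

theorem pairR_mem {R : Type*} [CommRing R] [Algebra K R] {I : Ideal R} {i j : ℤ} (hj : i - 1 = j)
    {l : R ⊗[K] L} {m : R ⊗[K] M} (hl : l ∈ ext I (𝓛.gr i)) (hm : m ∈ ext I (𝓜.gr j)) :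
    pairR l m ∈ ext I (coneGr 𝓛 𝓜 i) := by
  subst hj
  exact Submodule.add_mem _
    (baseChange_mem_ext _ (fun x hx => Submodule.mem_prod.2 ⟨hx, Submodule.zero_mem _⟩) hl)
    (baseChange_mem_ext _ (fun x hx => Submodule.mem_prod.2 ⟨Submodule.zero_mem _, hx⟩) hm)

/-- The bijection `(l, m) ↦ (l, e^m)` between Maurer-Cartan elements. -/
noncomputable def mcEquiv [CharZero K] (A : Art.{u, w} K) : (cone χ).MC A ≃ MCχ χ A where
  toFun γ := ⟨(fstR γ.1, sndR γ.1), fstR_mem γ.2.1, sndR_mem rfl γ.2.1,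
    (mcSum_eq_zero_iff χ A.m_nilpotent γ.2.1).1 γ.2.2⟩
  invFun p := ⟨pairR p.1.1 p.1.2, pairR_mem rfl p.2.1 p.2.2.1, by
    rw [mcSum_eq_zero_iff χ A.m_nilpotent (pairR_mem rfl p.2.1 p.2.2.1), fstR_pairR, sndR_pairR]
    exact p.2.2.2⟩
  left_inv γ := Subtype.ext (tensorProd_ext (fstR_pairR _ _) (sndR_pairR _ _))
  right_inv p := Subtype.ext (Prod.ext (fstR_pairR _ _) (sndR_pairR _ _))

/-- The two relations correspond exactly, before passing to generated equivalence relations, so the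
bijection of Maurer-Cartan elements descends to the quotients without proving that either relation
is transitive. -/
theorem homotopic_iff [CharZero K] (A : Art.{u, w} K) (γ₀ γ₁ : (cone χ).MC A) :
    (cone χ).Homotopic A γ₀ γ₁ ↔ GaugeEquiv χ A (mcEquiv χ A γ₀) (mcEquiv χ A γ₁) := by
  have hI : IsNilpotent A.m := A.m_nilpotent
  constructor
  · rintro ⟨x, hx, y, hy, h, h0, h1⟩
    obtain ⟨-, hl, hm⟩ := (mcSumTdt_eq_zero_iff χ hI hx hy).1 h
    have hm0 : sndR x ∈ ext (polyIdeal A.m) (𝓜.gr 0) := sndR_mem rfl hx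
    -- The degree `-1` path fed in is `φ(ad_m)` applied to the `M`-component of `y`, as it occurs in
    -- the path equation.
    obtain ⟨a, ha, b, hb, e1, e2⟩ := exists_gauge_of_path χ hI hm0 (fstR_mem hy)
      (nilEval_adR_mem 𝓜 (𝓜.adR_isNilpotent (polyIdeal_isNilpotent hI) (ext_le_top hm0))
        (ext_mono le_top le_rfl hm0) (sndR_mem rfl hy) _) hl hm
    rw [evalAt_baseChange, evalAt_baseChange, h0, h1] at e1 e2
    exact ⟨a, ha, b, hb, e1, e2⟩
  · rintro ⟨a, ha, b, hb, e1, e2⟩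
    obtain ⟨l, hl, m, hm, a', ha', b', hb', hmc, hp, ⟨hl0, hm0⟩, hl1, hm1⟩ :=
      exists_path_of_gauge χ hI (mcEquiv χ A γ₀).2.1 (mcEquiv χ A γ₀).2.2.1 ha hb
        (mcEquiv χ A γ₀).2.2.2.1 (mcEquiv χ A γ₀).2.2.2.2
    have hx : pairR l m ∈ ext (polyIdeal A.m) (coneGr 𝓛 𝓜 1) := pairR_mem rfl hl hm
    have hy : pairR a' b' ∈ ext (polyIdeal A.m) (coneGr 𝓛 𝓜 0) := pairR_mem rfl ha' hb'
    refine ⟨pairR l m, hx, pairR a' b', hy, ?_, ?_, ?_⟩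
    · rw [mcSumTdt_eq_zero_iff χ hI hx hy,
        mcSum_eq_zero_iff χ (polyIdeal_isNilpotent hI) hx]
      simp only [fstR_pairR, sndR_pairR]
      exact ⟨hmc, hp⟩
    · refine tensorProd_ext ?_ ?_
      · rw [← evalAt_baseChange, fstR_pairR, hl0]; rfl
      · rw [← evalAt_baseChange, sndR_pairR, hm0]; rfl
    · refine tensorProd_ext ?_ ?_
      · rw [← evalAt_baseChange, fstR_pairR, hl1]; exact e1.symm
      · rw [← evalAt_baseChange, sndR_pairR, hm1]; exact e2.symm

theorem mcEquiv_map [CharZero K] {A B : Art.{u, w} K} (f : A ⟶ B) (γ : (cone χ).MC A) :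
    mcEquiv χ B (HigherOps.MC.map (cone χ) f γ) = MCχ.map χ f (mcEquiv χ A γ) :=
  Subtype.ext (Prod.ext (push_baseChange _ _ _).symm (push_baseChange _ _ _).symm)

/-- The isomorphism of deformation functors induced by `(l, m) ↦ (l, e^m)`. -/
noncomputable def defIso [CharZero K] : (cone χ).defFunctor ≅ defχ.{u, v₁, v₂, w} χ :=
  NatIso.ofComponents (fun A => (Quot.congr (mcEquiv χ A) (homotopic_iff χ A)).toIso) fun f => by
    ext ⟨γ⟩
    exact congrArg (Quot.mk _) (mcEquiv_map χ f γ)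

end Main

end LInfCone

theorem theorem2 {K : Type u} [Field K] [CharZero K]
    {L : Type v₁} [AddCommGroup L] [Module K L] {M : Type v₂} [AddCommGroup M] [Module K M]
    (𝓛 : DGLA K L) (𝓜 : DGLA K M) (χ : DGLA.Hom 𝓛 𝓜) :
    ∃ Φ : (cone χ).defFunctor ≅ defχ.{u, v₁, v₂, w} χ,
      ∀ (A : Art.{u, w} K) (γ : (cone χ).MC A),
        ∃ p : MCχ χ A,
          p.1 = ((LinearMap.fst K L M).baseChange A.carrier γ.1,
            (LinearMap.snd K L M).baseChange A.carrier γ.1) ∧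
          Φ.hom.app A (Quot.mk _ γ) = Quot.mk _ p :=
  ⟨defIso χ, fun A γ => ⟨mcEquiv χ A γ, rfl, rfl⟩⟩
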